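/- Throughout, $M$ is a smooth (Hausdorff, second countable, boundaryless) $3$-manifold. Two $C^1$ vector fields $X,Y$ on $M$ commute if for every $x\in M$ there is $\varepsilon>0$ such that for all $s,t\in[-\varepsilon,\varepsilon]$ both $X_t\circ Y_s(x)$ and $Y_s\circ X_t(x)$ are defined and coincide ($X_t,Y_s$ are the local flows). For $U\subset M$ put $\operatorname{Col}(X,Y,U)=\{p\in U:\dim\langle X(p),Y(p)\rangle\le 1\}$. If $U$ is compact and $X$ is a continuous vector field without zeros on the topological boundary $\partial U$, the Poincaré–Hopf index $\operatorname{Ind}(X,U)\in\mathbb Z$ is the common value of the sums $\sum_{p\in U,\,Z(p)=0}\operatorname{Ind}(Z,p)$, over all vector fields $Z$ on $U$ that have finitely many zeros in $U$ and are homotopic to $X$ through continuous vector fields on $U$ without zeros on $\partial U$; here $\operatorname{Ind}(Z,p)$ is the degree of $Z/\|Z\|$ on a small sphere around $p$ in a chart. Let $U\subset M$ be compact, $X,Y$ be $C^1$ vector fields on $M$, $\Sigma$ be a map to $\mathbb R/\mathbb Z$ defined and smooth on a neighbourhood of $U$, and $\mathcal B=(e_1,e_2,e_3)$ be continuous vector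 fields on $U$. We say that $(U,X,Y,\Sigma,\mathcal B)$ is a prepared counterexample if the following hold. 1. $X$ and $Y$ commute; $Y$ has no zero in $U$; $X$ has no zero on $\partial U$; $\operatorname{Ind}(X,U)\ne 0$; and $\operatorname{Col}(X,Y,U)$ is contained in a compact boundaryless $C^1$ surface embedded in $M$. 2. There are $\mu_0>0$ and a $C^1$ diffeomorphism $\varphi$ from $\mathbb R/\mathbb Z\times[-\mu_0,\mu_0]$ onto $\operatorname{Col}(X,Y,U)$ such that, writing $\gamma_t$ for the set of zeros of $X-tY$ in $U$: for $|t|\le\mu_0$, $\gamma_t$ is exactly one periodic orbit of $Y$ and $\varphi(\mathbb R/\mathbb Z\times\{t\})=\gamma_t$; for $|t|>\mu_0$, $\gamma_t=\emptyset$; for $|t|<\mu_0$, $\gamma_t\cap\partial U=\emptyset$. 3. $\Sigma$ is a submersion at each point of $U$; each fibre $\Sigma_t=\{x\in U:\Sigma(x)=t\}$, $t\in\mathbb R/\mathbb Z$, is a $C^1$ embedded closed disc; and $Y$ is transverse to the fibres at each point of $U$. 4. For $|s|\le\mu_0$, $\gamma_s$ meets every $\Sigma_t$ in exactly one point, and the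 minimal period $\tau(s)$ of $\gamma_s$ has nonzero derivative at every $s\in[-\mu_0,\mu_0]$ (one-sided at the end points). 5. For each $x\in U$, $(e_1(x),e_2(x),e_3(x))$ is a basis of $T_xM$; $e_3=Y$ on $U$; $D\Sigma(e_1)=D\Sigma(e_2)=0$ on $U$; and $e_1$ is tangent to $\operatorname{Col}(X,Y,U)$ at each of its points. Proposition. Let $(U,X,Y,\Sigma,\mathcal B)$ be a prepared counterexample. Let $\mathcal P$ be the first return map of $Y$ on the surface $\{\Sigma=0\}$ (which contains $\Sigma_0$, and coincides with it in the interior of $U$): $\mathcal P(y)$ is the first point at which the forward $Y$-orbit of $y$ meets $\{\Sigma=0\}$ at a positive time. Then for every $x\in\operatorname{Col}(X,Y,U)\cap\Sigma_0$, the map $\mathcal P$ is defined on a neighbourhood of $x$ in $\{\Sigma=0\}$, $\mathcal P(x)=x$, $\mathcal P$ is differentiable at $x$ along $\{\Sigma=0\}$, and $D\mathcal P(x)$ is the identity of $T_x\Sigma_0=\ker D\Sigma(x)$. -/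

import Mathlib

open Set Filter Topology Manifold
open scoped ContDiff

noncomputable section

namespace CommutingFields

/-- Euclidean `3`-space. -/
abbrev E3 : Type := EuclideanSpace ℝ (Fin 3)

/-- The Euclidean plane. -/
abbrev E2 : Type := EuclideanSpace ℝ (Fin 2)

/-- The unit sphere of Euclidean `3`-space. -/
abbrev S2 : Type := Metric.sphere (0 : E3) 1

/-! ### Topological degree of self-maps of the 2-sphere -/

/-- The endomorphism of `H₂(S²; ℤ)` (singular homology) induced by `f` is multiplication by `d`. -/
def HasDegree (f : C(S2, S2)) (d : ℤ) : Prop :=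
  ((AlgebraicTopology.singularHomologyFunctor (ModuleCat.{0} ℤ) 2).obj (ModuleCat.of ℤ ℤ)).map
      (TopCat.ofHom f) =
    d • CategoryTheory.CategoryStruct.id
      (((AlgebraicTopology.singularHomologyFunctor (ModuleCat.{0} ℤ) 2).obj
        (ModuleCat.of ℤ ℤ)).obj (TopCat.of S2))

section Manifold

variable {M : Type*} [TopologicalSpace M] [ChartedSpace E3 M] [IsManifold (𝓡 3) ∞ M]

/-! ### Poincaré–Hopf index -/

/-- The vector field `Z`, read in the preferred chart at `p`. -/
def inChart (Z : ∀ x : M, TangentSpace (𝓡 3) x) (p : M) (y : E3) : E3 :=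
  mfderiv (𝓡 3) 𝓘(ℝ, E3) (extChartAt (𝓡 3) p) ((extChartAt (𝓡 3) p).symm y)
    (Z ((extChartAt (𝓡 3) p).symm y))

/-- In the preferred chart at `p`, for all sufficiently small `r > 0`, the normalised field `Z / ‖Z‖`
on the sphere of radius `r` around `p` is a continuous map `S² → S²` of degree `d`. -/
def HasLocalIndex (Z : ∀ x : M, TangentSpace (𝓡 3) x) (p : M) (d : ℤ) : Prop :=
  ∀ᶠ r : ℝ in 𝓝[>] 0, ∃ f : C(S2, S2),
    (∀ u : S2, inChart Z p (extChartAt (𝓡 3) p p + r • (u : E3)) ≠ 0 ∧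
      (f u : E3) = ‖inChart Z p (extChartAt (𝓡 3) p p + r • (u : E3))‖⁻¹ •
        inChart Z p (extChartAt (𝓡 3) p p + r • (u : E3))) ∧
    HasDegree f d

open Classical in
/-- The Poincaré–Hopf index `Ind(Z, p)` at an isolated zero `p` of `Z`. -/
def localIndex (Z : ∀ x : M, TangentSpace (𝓡 3) x) (p : M) : ℤ :=
  if h : ∃ d, HasLocalIndex Z p d then h.choose else 0

/-- `Z` has finitely many zeros in `U` and is homotopic to `X` through continuous vector fields
on `U` without zeros on the boundary of `U`. -/
structure IsPerturbation (X : ∀ x : M, TangentSpace (𝓡 3) x) (U : Set M)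
    (Z : ∀ x : M, TangentSpace (𝓡 3) x) : Prop where
  finite_zeros : {x ∈ U | Z x = 0}.Finite
  homotopic : ∃ H : ℝ → ∀ x : M, TangentSpace (𝓡 3) x,
    ContinuousOn (fun q : ℝ × M => (⟨q.2, H q.1 q.2⟩ : TangentBundle (𝓡 3) M)) (Icc 0 1 ×ˢ U) ∧
    (∀ x ∈ U, H 0 x = X x) ∧ (∀ x ∈ U, H 1 x = Z x) ∧
    ∀ t ∈ Icc (0 : ℝ) 1, ∀ x ∈ frontier U, H t x ≠ 0

/-- `n` is the sum of the indices of the zeros in `U` of every perturbation of `X`. -/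
def IsIndex (X : ∀ x : M, TangentSpace (𝓡 3) x) (U : Set M) (n : ℤ) : Prop :=
  ∀ Z : (∀ x : M, TangentSpace (𝓡 3) x), IsPerturbation X U Z →
    ∑ᶠ x ∈ {x ∈ U | Z x = 0}, localIndex Z x = n

open Classical in
/-- The Poincaré–Hopf index `Ind(X, U)` of a vector field on a compact set `U` without zeros on the
boundary of `U`: the common value of the sums of the indices of the zeros in `U` of the
perturbations of `X`. -/
def poincareHopfIndex (X : ∀ x : M, TangentSpace (𝓡 3) x) (U : Set M) : ℤ :=
  if h : ∃! n, IsIndex X U n then h.choose else 0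

/-! ### Commuting vector fields, collinearity, surfaces -/

/-- The vector field `X` is of class `C¹`. -/
def IsC1Field (X : ∀ x : M, TangentSpace (𝓡 3) x) : Prop :=
  ContMDiff (𝓡 3) (𝓡 3).tangent 1 (fun x => (⟨x, X x⟩ : TangentBundle (𝓡 3) M))

/-- The vector field `X` is continuous on `U`. -/
def IsC0FieldOn (X : ∀ x : M, TangentSpace (𝓡 3) x) (U : Set M) : Prop :=
  ContinuousOn (fun x => (⟨x, X x⟩ : TangentBundle (𝓡 3) M)) U

/-- `X_t(x)` is defined and equal to `y`. -/
def FlowsTo (X : ∀ x : M, TangentSpace (𝓡 3) x) (t : ℝ) (x y : M) : Prop :=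
  ∃ c : ℝ → M, IsMIntegralCurveOn c X (uIcc 0 t) ∧ c 0 = x ∧ c t = y

/-- `X` and `Y` commute: at every point the local flows commute for small times. -/
def FieldsCommute (X Y : ∀ x : M, TangentSpace (𝓡 3) x) : Prop :=
  ∀ x : M, ∃ ε > 0, ∀ s ∈ Icc (-ε) ε, ∀ t ∈ Icc (-ε) ε, ∃ y z w : M,
    FlowsTo Y s x y ∧ FlowsTo X t y w ∧ FlowsTo X t x z ∧ FlowsTo Y s z w

/-- The collinearity locus `Col(X, Y, U)`. -/
def Col (X Y : ∀ x : M, TangentSpace (𝓡 3) x) (U : Set M) : Set M :=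
  {p ∈ U | Module.finrank ℝ (Submodule.span ℝ {X p, Y p}) ≤ 1}

/-- `S` is a `2`-dimensional `C¹` submanifold (without boundary): near each of its points it is a
coordinate plane in some `C¹` chart. -/
def IsC1Surface (S : Set M) : Prop :=
  ∀ p ∈ S, ∃ e : OpenPartialHomeomorph M E3, p ∈ e.source ∧
    ContMDiffOn (𝓡 3) 𝓘(ℝ, E3) 1 e e.source ∧
    ContMDiffOn 𝓘(ℝ, E3) (𝓡 3) 1 e.symm e.target ∧
    ∀ x ∈ e.source, x ∈ S ↔ e x 2 = 0

/-- `(U, X, Y)` is a counterexample to the theorem asserting `Ind(X, U) = 0`. -/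
structure IsCounterexample (U : Set M) (X Y : ∀ x : M, TangentSpace (𝓡 3) x) : Prop where
  isCompact : IsCompact U
  c1_X : IsC1Field X
  c1_Y : IsC1Field Y
  commute : FieldsCommute X Y
  zero_Y : ∀ x ∈ U, Y x ≠ 0
  zero_X : ∀ x ∈ frontier U, X x ≠ 0
  index_ne_zero : poincareHopfIndex X U ≠ 0
  col_subset : ∃ S : Set M, IsCompact S ∧ IsC1Surface S ∧ Col X Y U ⊆ S

/-! ### Prepared counterexamples -/

/-- `Γ` is a (nonconstant) periodic orbit of `Y` of minimal period `T`. -/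
def IsPeriodicOrbit (Y : ∀ x : M, TangentSpace (𝓡 3) x) (Γ : Set M) (T : ℝ) : Prop :=
  ∃ c : ℝ → M, IsMIntegralCurve c Y ∧ 0 < T ∧ Function.Periodic c T ∧ InjOn c (Ico 0 T) ∧
    range c = Γ

/-- The set `γ_t` of zeros of `X - t Y` in `U`. -/
def gam (U : Set M) (X Y : ∀ x : M, TangentSpace (𝓡 3) x) (t : ℝ) : Set M :=
  {x ∈ U | X x - t • Y x = 0}

/-- `D` is a closed disc, `C¹` embedded in `M`. -/
def IsC1Disc (D : Set M) : Prop :=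
  ∃ ψ : E2 → M,
    ContMDiffOn 𝓘(ℝ, E2) (𝓡 3) 1 ψ (Metric.closedBall 0 1) ∧
    InjOn ψ (Metric.closedBall 0 1) ∧
    (∀ q ∈ Metric.closedBall (0 : E2) 1,
      Function.Injective (mfderivWithin 𝓘(ℝ, E2) (𝓡 3) ψ (Metric.closedBall 0 1) q)) ∧
    ψ '' Metric.closedBall 0 1 = D

/-- `φ`, which is `1`-periodic in the first variable, induces a `C¹` diffeomorphism of
`ℝ/ℤ × [-μ₀, μ₀]` onto the subset `A` of `M`. -/
structure IsC1AnnulusParam (μ₀ : ℝ) (φ : ℝ × ℝ → M) (A : Set M) : Prop where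
  contMDiffOn : ContMDiffOn 𝓘(ℝ, ℝ × ℝ) (𝓡 3) 1 φ (univ ×ˢ Icc (-μ₀) μ₀)
  periodic : ∀ θ : ℝ, ∀ s ∈ Icc (-μ₀) μ₀, φ (θ + 1, s) = φ (θ, s)
  injective : ∀ θ θ' : ℝ, ∀ s ∈ Icc (-μ₀) μ₀, ∀ s' ∈ Icc (-μ₀) μ₀, φ (θ, s) = φ (θ', s') →
    s = s' ∧ ∃ k : ℤ, θ' = θ + k
  immersive : ∀ q ∈ (univ : Set ℝ) ×ˢ Icc (-μ₀) μ₀,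
    Function.Injective (mfderivWithin 𝓘(ℝ, ℝ × ℝ) (𝓡 3) φ (univ ×ˢ Icc (-μ₀) μ₀) q)
  image_eq : φ '' (univ ×ˢ Icc (-μ₀) μ₀) = A

/-- `(U, X, Y, Σ, (e₁, e₂, e₃))` is a prepared counterexample. The circle `ℝ/ℤ` is realised as
Mathlib's unit circle `Circle`, with `0 ∈ ℝ/ℤ` corresponding to `1`; a smooth map on the compact
set `U` is the restriction of a map that is smooth on a neighbourhood of `U`. -/
structure IsPreparedCounterexample (U : Set M) (X Y : ∀ x : M, TangentSpace (𝓡 3) x)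
    (Sg : M → Circle) (e₁ e₂ e₃ : ∀ x : M, TangentSpace (𝓡 3) x) : Prop where
  counterexample : IsCounterexample U X Y
  smooth : ∃ W : Set M, IsOpen W ∧ U ⊆ W ∧ ContMDiffOn (𝓡 3) (𝓡 1) ∞ Sg W
  submersion : ∀ x ∈ U, Function.Surjective (mfderiv (𝓡 3) (𝓡 1) Sg x)
  disc : ∀ z : Circle, IsC1Disc {x ∈ U | Sg x = z}
  transverse : ∀ x ∈ U, mfderiv (𝓡 3) (𝓡 1) Sg x (Y x) ≠ 0
  continuous_e₁ : IsC0FieldOn e₁ U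
  continuous_e₂ : IsC0FieldOn e₂ U
  continuous_e₃ : IsC0FieldOn e₃ U
  basis : ∀ x ∈ U, LinearIndependent ℝ ![e₁ x, e₂ x, e₃ x] ∧
    Submodule.span ℝ {e₁ x, e₂ x, e₃ x} = ⊤
  e₃_eq : ∀ x ∈ U, e₃ x = Y x
  e₁_fiber : ∀ x ∈ U, mfderiv (𝓡 3) (𝓡 1) Sg x (e₁ x) = 0
  e₂_fiber : ∀ x ∈ U, mfderiv (𝓡 3) (𝓡 1) Sg x (e₂ x) = 0
  annulus : ∃ (μ₀ : ℝ) (φ : ℝ × ℝ → M) (τ : ℝ → ℝ), 0 < μ₀ ∧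
    IsC1AnnulusParam μ₀ φ (Col X Y U) ∧
    (∀ t ∈ Icc (-μ₀) μ₀, φ '' (univ ×ˢ {t}) = gam U X Y t) ∧
    -- `γ_t` is a periodic orbit of `Y`, of period `τ(t)`
    (∀ t ∈ Icc (-μ₀) μ₀, IsPeriodicOrbit Y (gam U X Y t) (τ t)) ∧
    (∀ t ∉ Icc (-μ₀) μ₀, gam U X Y t = ∅) ∧
    -- only the boundary of the annulus may meet the boundary of `U`
    (∀ t ∈ Ioo (-μ₀) μ₀, Disjoint (gam U X Y t) (frontier U)) ∧
    (∀ t ∈ Icc (-μ₀) μ₀, ∀ z : Circle, ∃! x, x ∈ gam U X Y t ∧ Sg x = z) ∧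
    -- a nonzero `derivWithin` entails differentiability
    (∀ t ∈ Icc (-μ₀) μ₀, derivWithin τ (Icc (-μ₀) μ₀) t ≠ 0) ∧
    -- `e₁` is tangent to the annulus
    ∀ q ∈ (univ : Set ℝ) ×ˢ Icc (-μ₀) μ₀, ∃ w,
      mfderivWithin 𝓘(ℝ, ℝ × ℝ) (𝓡 3) φ (univ ×ˢ Icc (-μ₀) μ₀) q w = e₁ (φ q)

/-! ### First return map -/

/-- The forward orbit of `y` under `Y` hits `S` at a positive time, for the first time at `z`. -/
def IsFirstReturn (Y : ∀ x : M, TangentSpace (𝓡 3) x) (S : Set M) (y z : M) : Prop :=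
  ∃ (c : ℝ → M) (T : ℝ), 0 < T ∧ IsMIntegralCurveOn c Y (Icc 0 T) ∧ c 0 = y ∧ c T = z ∧ z ∈ S ∧
    ∀ s ∈ Ioo 0 T, c s ∉ S

open Classical in
/-- The first return map of `Y` on `S` (with value `y` at points that do not return). -/
def firstReturn (Y : ∀ x : M, TangentSpace (𝓡 3) x) (S : Set M) (y : M) : M :=
  if h : ∃ z, IsFirstReturn Y S y z then h.choose else y

end Manifold

end CommutingFields

end

/-! Let `R` follow the orbit of `Y` from `q` until it first comes back to the fibre of `Sg` through
`q`. Near a point `a` of the annulus, `R(q)` is the flow of `Y` at a time `r(q)` of class C¹. It is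
thus defined on a whole neighbourhood in `M`, it preserves the fibres, and it fixes the annulus
pointwise because each `γ_s` meets each fibre only once. Hence `DR(a)` fixes `e₁` and `Y`, and
`DR(a) e₂ = b e₁ + l e₂`. Here `l > 0`, since the flow preserves the orientation transverse to `Y`
(`dflow_e₂`). What has to be shown is `l = 1` and `b = 0`: this is `fderiv_return_eq_id` on the open
annulus, and the boundary circles follow by continuity of the differential.

Let `a ∈ γ_t`, `V = X - tY` and `B = DV(a)`. Commutation makes `V` invariant under `R` modulo `Y`.
The nonzero index enters as follows. Suppose that near the points of `γ_t` the field `V` is never,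
modulo `Y`, a nonzero multiple of a vector close to `w` (`Avoid`). Then `X - tY + εw` has no zero in
`U` for small `ε ≠ 0`, and it is joined to `X` without zeros on the boundary, so the index is `0`
(`poincareHopfIndex_eq_zero_of_avoid`). Avoidance need only be checked at `a`, because the flow
transports it along `γ_t`.

If `l ≠ 1`, passing to the inverse of `R` allows `l < 1`. Let `N` be the projection of `V` along `Y`
to the tangent planes of the fibres; it is invariant under `DR` and bounded by a multiple of the
transverse coordinate `H` of the annulus. `R` contracts `H` at a rate close to `l`, whereas in a
narrow cone around `e₁` the vector `N` shrinks at a rate close to `1`. Iteration forces `N = 0`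
wherever `N` lies in the cone, so `V` avoids `e₁` (`avoid_of_lt_one`).

If `l = 1`, write `B e₂ = x e₁ + w e₂ + z Y`. Modulo `Y`, `V` is `H` times a field close to `B e₂`.
So `V` avoids `e₁` if `w ≠ 0`, and avoids `e₂` if `w = 0` and `x ≠ 0`. There remains `B e₂ = z Y`.
Differentiating `V ∘ R = DR·V - dr(V) Y ∘ R` in the direction `e₂` then gives `b B e₁ = 0`. Now `B
e₁ = k Y` with `k ≠ 0`, because `X = sY` on `γ_s` and `e₁` is transverse to the circles `γ_s`; hence
`b = 0` (`eq_id_or_avoid`). -/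

noncomputable section

namespace CommutingFields

section

/-! ### The local flow of a `C¹` vector field on a vector space -/

/-! ### Superposition operators on spaces of continuous functions. -/

section Superposition

variable {K E F : Type*} [TopologicalSpace K] [CompactSpace K]
  [NormedAddCommGroup E] [NormedSpace ℝ E] [NormedAddCommGroup F] [NormedSpace ℝ F]

/-- A continuous family of continuous linear maps acts on continuous functions. -/
def pointwiseApply : C(K, E →L[ℝ] F) →L[ℝ] C(K, E) →L[ℝ] C(K, F) :=
  LinearMap.mkContinuous₂
    (LinearMap.mk₂ ℝ (fun (A : C(K, E →L[ℝ] F)) (h : C(K, E)) =>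
        (⟨fun z => A z (h z), by fun_prop⟩ : C(K, F)))
      (fun _ _ _ => by ext z; simp) (fun _ _ _ => by ext z; simp)
      (fun _ _ _ => by ext z; simp) (fun _ _ _ => by ext z; simp)) 1
    (fun A h => by
      rw [one_mul, ContinuousMap.norm_le _ (by positivity)]
      intro z
      exact (A z).le_of_opNorm_le_of_le (A.norm_coe_le_norm z) (h.norm_coe_le_norm z))

/-- The superposition operator `γ ↦ V ∘ γ`. -/
def superposition (V : C(E, F)) (γ : C(K, E)) : C(K, F) := V.comp γ

/-- Strict differentiability of `V` at `γ z` gives the error bound for all small increments and all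
points of `K` near `z`; compactness of `K` makes it uniform, which is what the sup norm requires. -/
theorem hasFDerivAt_superposition {V : C(E, F)} (hV : ContDiff ℝ 1 V) (γ : C(K, E)) :
    HasFDerivAt (superposition V)
      (pointwiseApply (superposition ⟨fderiv ℝ V, hV.continuous_fderiv one_ne_zero⟩ γ)) γ := by
  rw [hasFDerivAt_iff_isLittleO_nhds_zero, Asymptotics.isLittleO_iff]
  intro ε hε
  have key : ∀ z : K, z ∈ (univ : Set K) → ∀ᶠ q : C(K, E) × K in 𝓝 ((0 : C(K, E)), z),
      ‖V (γ q.2 + q.1 q.2) - V (γ q.2) - fderiv ℝ V (γ q.2) (q.1 q.2)‖ ≤ ε * ‖q.1 q.2‖ := by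
    intro z _
    have h1 := (hV.contDiffAt (x := γ z)).hasStrictFDerivAt one_ne_zero
    rw [hasStrictFDerivAt_iff_isLittleO, Asymptotics.isLittleO_iff] at h1
    have h2 := h1 (half_pos hε)
    have ev : Continuous fun q : C(K, E) × K => q.1 q.2 := by fun_prop
    have h3 : Tendsto (fun q : C(K, E) × K => (γ q.2 + q.1 q.2, γ q.2)) (𝓝 (0, z))
        (𝓝 (γ z, γ z)) := by
      have : Continuous fun q : C(K, E) × K => (γ q.2 + q.1 q.2, γ q.2) := by fun_prop
      simpa using this.tendsto ((0 : C(K, E)), z)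
    have h4 : ∀ᶠ q : C(K, E) × K in 𝓝 ((0 : C(K, E)), z),
        ‖fderiv ℝ V (γ z) - fderiv ℝ V (γ q.2)‖ < ε / 2 := by
      have hc : Continuous fun q : C(K, E) × K => ‖fderiv ℝ V (γ z) - fderiv ℝ V (γ q.2)‖ := by
        have := hV.continuous_fderiv one_ne_zero
        fun_prop
      have := hc.tendsto ((0 : C(K, E)), z)
      simp only [sub_self, norm_zero] at this
      exact this.eventually (gt_mem_nhds (half_pos hε))
    filter_upwards [h3.eventually h2, h4] with q hq hq'
    simp only [add_sub_cancel_left] at hq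
    have e : V (γ q.2 + q.1 q.2) - V (γ q.2) - fderiv ℝ V (γ q.2) (q.1 q.2)
        = (V (γ q.2 + q.1 q.2) - V (γ q.2) - fderiv ℝ V (γ z) (q.1 q.2)) +
          (fderiv ℝ V (γ z) - fderiv ℝ V (γ q.2)) (q.1 q.2) := by
      simp
    rw [e]
    have h5 := (fderiv ℝ V (γ z) - fderiv ℝ V (γ q.2)).le_of_opNorm_le hq'.le (q.1 q.2)
    calc _ ≤ _ := norm_add_le _ _
      _ ≤ ε / 2 * ‖q.1 q.2‖ + ε / 2 * ‖q.1 q.2‖ := add_le_add hq h5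
      _ = _ := by ring
  have := isCompact_univ.eventually_forall_of_forall_eventually (P := fun (h : C(K, E)) (z : K) =>
    ‖V (γ z + h z) - V (γ z) - fderiv ℝ V (γ z) (h z)‖ ≤ ε * ‖h z‖) key
  filter_upwards [this] with h hh
  rw [ContinuousMap.norm_le _ (by positivity)]
  intro z
  exact (hh z (mem_univ z)).trans (by gcongr; exact h.norm_coe_le_norm z)

theorem contDiff_superposition {V : C(E, F)} (hV : ContDiff ℝ 1 V) :
    ContDiff ℝ 1 (superposition V : C(K, E) → C(K, F)) := by
  rw [contDiff_one_iff_hasFDerivAt]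
  refine ⟨_, ?_, hasFDerivAt_superposition hV⟩
  exact pointwiseApply.continuous.comp (ContinuousMap.continuous_postcomp _)

end Superposition

/-! ### The flow equation as an implicit function problem in `C([0, 1], E)`. -/

section LocalFlow

variable {E : Type*} [NormedAddCommGroup E] [NormedSpace ℝ E]

/-- The constant functions, as an operator into `C([0, 1], E)`. -/
def constFun : E →L[ℝ] C(Icc (0 : ℝ) 1, E) :=
  LinearMap.mkContinuous
    { toFun := fun x => ContinuousMap.const _ x
      map_add' := fun _ _ => rfl
      map_smul' := fun _ _ => rfl } 1
    (fun x => by rw [one_mul, ContinuousMap.norm_le _ (by positivity)]; intro z; exact le_rfl)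

theorem constFun_apply (x : E) (z : Icc (0 : ℝ) 1) : constFun x z = x := rfl

/-- The primitive vanishing at `0`, as an operator on `C([0, 1], E)`. -/
def primitive : C(Icc (0 : ℝ) 1, E) →L[ℝ] C(Icc (0 : ℝ) 1, E) :=
  LinearMap.mkContinuous
    { toFun := fun γ => ⟨fun z => ∫ u in (0 : ℝ)..z, IccExtend zero_le_one γ u, by
          have h : Continuous (IccExtend (zero_le_one : (0 : ℝ) ≤ 1) γ) := γ.continuous.Icc_extend'
          exact (intervalIntegral.continuous_primitive
            (fun a b => h.intervalIntegrable a b) 0).comp continuous_subtype_val⟩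
      map_add' := fun γ γ' => by
        ext z
        have h : Continuous (IccExtend (zero_le_one : (0 : ℝ) ≤ 1) γ) := γ.continuous.Icc_extend'
        have h' : Continuous (IccExtend (zero_le_one : (0 : ℝ) ≤ 1) γ') :=
          γ'.continuous.Icc_extend'
        exact intervalIntegral.integral_add (h.intervalIntegrable _ _) (h'.intervalIntegrable _ _)
      map_smul' := fun c γ => by
        ext z
        exact intervalIntegral.integral_smul c _ } 1
    (fun γ => by
      rw [one_mul, ContinuousMap.norm_le _ (by positivity)]
      intro z
      have h := intervalIntegral.norm_integral_le_of_norm_le_const (a := (0 : ℝ)) (b := z)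
        (C := ‖γ‖) (f := IccExtend zero_le_one γ) (fun u _ => γ.norm_coe_le_norm _)
      refine h.trans ?_
      have hz : |(z : ℝ) - 0| ≤ 1 := by
        rw [sub_zero, abs_of_nonneg z.2.1]; exact z.2.2
      exact mul_le_of_le_one_right (norm_nonneg _) hz)

theorem primitive_apply (γ : C(Icc (0 : ℝ) 1, E)) (z : Icc (0 : ℝ) 1) :
    primitive γ z = ∫ u in (0 : ℝ)..z, IccExtend zero_le_one γ u := rfl

variable [CompleteSpace E]

/-- The local flow of a Lipschitz `C¹` vector field is of class `C¹`. -/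
theorem contDiffAt_flow_of_lipschitz {V : C(E, E)} (hV : ContDiff ℝ 1 V) {k : NNReal}
    (hk : LipschitzWith k V) (p : E) {α : E → ℝ → E}
    (hα : ∀ᶠ q : E × ℝ in 𝓝 p ×ˢ 𝓝 (0 : ℝ), α q.1 0 = q.1 ∧
      HasDerivAt (α q.1) (V (α q.1 q.2)) q.2) :
    ContDiffAt ℝ 1 (fun q : E × ℝ => α q.1 q.2) (p, 0) := by
  set γ₀ : C(Icc (0 : ℝ) 1, E) := ContinuousMap.const _ p
  -- Time is rescaled to `[0, 1]`: `F = 0` says that `γ z = x + τ ∫₀ᶻ V(γ)`, that is, `γ z` is the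
  -- solution from `x` at time `τ z`. Thus `τ` becomes a parameter and the domain of the curves
  -- stays fixed.
  let F : (E × ℝ) × C(Icc (0 : ℝ) 1, E) → C(Icc (0 : ℝ) 1, E) := fun q =>
    q.2 - constFun q.1.1 - q.1.2 • primitive (superposition V q.2)
  have hF : ContDiff ℝ 1 F := by
    have h1 : ContDiff ℝ 1 fun q : (E × ℝ) × C(Icc (0 : ℝ) 1, E) =>
        primitive (superposition V q.2) :=
      primitive.contDiff.comp ((contDiff_superposition hV).comp contDiff_snd)
    have h2 : ContDiff ℝ 1 fun q : (E × ℝ) × C(Icc (0 : ℝ) 1, E) => constFun q.1.1 :=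
      (constFun (E := E)).contDiff.comp (contDiff_fst.comp contDiff_fst)
    exact (contDiff_snd.sub h2).sub ((contDiff_snd.comp contDiff_fst).smul h1)
  set u : (E × ℝ) × C(Icc (0 : ℝ) 1, E) := ((p, 0), γ₀)
  have hFu : F u = 0 := by
    ext z
    simp [F, u, constFun_apply, γ₀]
  -- At `τ = 0` the nonlinear term disappears, so the partial differential in `γ` is the identity.
  have hinv : fderiv ℝ F u ∘L .inr ℝ (E × ℝ) C(Icc (0 : ℝ) 1, E) =
      ContinuousLinearMap.id ℝ _ := by
    have h1 : HasFDerivAt (fun γ : C(Icc (0 : ℝ) 1, E) => F ((p, 0), γ))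
        (fderiv ℝ F u ∘L .inr ℝ (E × ℝ) C(Icc (0 : ℝ) 1, E)) γ₀ :=
      ((hF.differentiable one_ne_zero).differentiableAt (x := u)).hasFDerivAt.comp γ₀
        (hasFDerivAt_prodMk_right (p, (0 : ℝ)) γ₀)
    have h2 : HasFDerivAt (fun γ : C(Icc (0 : ℝ) 1, E) => F ((p, 0), γ))
        (ContinuousLinearMap.id ℝ _) γ₀ := by
      have : (fun γ : C(Icc (0 : ℝ) 1, E) => F ((p, 0), γ)) = fun γ => γ - constFun p := by
        funext γ
        simp [F]
      rw [this]
      exact (hasFDerivAt_id γ₀).sub_const _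
    exact h1.unique h2
  have if₂ : (fderiv ℝ F u ∘L .inr ℝ (E × ℝ) C(Icc (0 : ℝ) 1, E)).IsInvertible := by
    rw [hinv]
    exact ⟨ContinuousLinearEquiv.refl ℝ _, rfl⟩
  have cF : ContDiffAt ℝ 1 F u := hF.contDiffAt
  set G := cF.implicitFunction one_ne_zero if₂
  have hG : ContDiffAt ℝ 1 G (p, 0) := cF.contDiffAt_implicitFunction one_ne_zero if₂
  have hGe : ∀ᶠ q in 𝓝 (p, (0 : ℝ)), F (q, G q) = 0 := by
    have := cF.eventually_apply_implicitFunction one_ne_zero if₂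
    rwa [hFu] at this
  have hev : ContDiffAt ℝ 1 (fun q : E × ℝ => G q ⟨1, by simp⟩) (p, 0) := by
    have h1 := (ContinuousMap.evalCLM (M := E) ℝ
      (⟨1, by simp⟩ : Icc (0 : ℝ) 1)).contDiff (n := 1)
    exact h1.contDiffAt.comp (p, (0 : ℝ)) hG
  refine hev.congr_of_eventuallyEq ?_
  rw [← nhds_prod_eq, nhds_prod_eq, Filter.eventually_prod_iff] at hα
  obtain ⟨pa, hpa, pb, hpb, hab⟩ := hα
  obtain ⟨δ, hδ, hδb⟩ := Metric.eventually_nhds_iff_ball.1 hpb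
  have hs : ∀ᶠ q : E × ℝ in 𝓝 (p, (0 : ℝ)), pa q.1 ∧ |q.2| < δ := by
    rw [nhds_prod_eq]
    refine Filter.Eventually.prod_mk hpa (pb := fun s : ℝ => |s| < δ) ?_
    filter_upwards [Metric.ball_mem_nhds (0 : ℝ) hδ] with s hs
    simpa using hs
  filter_upwards [hGe, hs] with q hq ⟨hqa, hqb⟩
  obtain ⟨x, τ⟩ := q
  simp only at hqa hqb
  set γ := G (x, τ)
  have hγ : ∀ z : Icc (0 : ℝ) 1, γ z = x + τ • ∫ v in (0 : ℝ)..z,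
      IccExtend zero_le_one (superposition V γ) v := by
    intro z
    have := congrArg (fun f : C(Icc (0 : ℝ) 1, E) => f z) hq
    simp only [F, constFun_apply, ContinuousMap.sub_apply, ContinuousMap.smul_apply, primitive_apply,
      ContinuousMap.zero_apply] at this
    have h' : γ z - x - τ • ∫ v in (0 : ℝ)..z, IccExtend zero_le_one (superposition V γ) v = 0 :=
      this
    rw [sub_sub, sub_eq_zero] at h'
    exact h'
  let σ : ℝ → E := fun z => x + τ • ∫ v in (0 : ℝ)..z, IccExtend zero_le_one (superposition V γ) v
  have hσ : ∀ z, HasDerivAt σ (τ • IccExtend zero_le_one (superposition V γ) z) z := by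
    intro z
    have hc : Continuous (IccExtend (zero_le_one : (0 : ℝ) ≤ 1) (superposition V γ)) :=
      (superposition V γ).continuous.Icc_extend'
    exact ((hc.integral_hasStrictDerivAt 0 z).hasDerivAt.const_smul τ).const_add x
  have hbox : ∀ s, |s| < δ → α x 0 = x ∧ HasDerivAt (α x) (V (α x s)) s := fun s hs =>
    hab hqa (hδb s (by simpa using hs))
  have hτz : ∀ z ∈ Icc (0 : ℝ) 1, |τ * z| < δ := by
    intro z hz
    rw [abs_mul, abs_of_nonneg hz.1]
    exact (mul_le_of_le_one_right (abs_nonneg _) hz.2).trans_lt hqb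
  have hα' : ∀ z ∈ Icc (0 : ℝ) 1,
      HasDerivAt (fun z => α x (τ * z)) (τ • V (α x (τ * z))) z := by
    intro z hz
    have h1 := (hbox _ (hτz z hz)).2
    have h2 : HasDerivAt (fun z : ℝ => τ * z) τ z := by
      simpa using (hasDerivAt_id z).const_mul τ
    exact h1.scomp z h2
  -- The curve produced by the implicit function theorem and the rescaled flow line solve the same
  -- Lipschitz equation, so they agree; at `z = 1` this identifies the flow with a C¹ function of
  -- `(x, τ)`.
  have huniq : EqOn σ (fun z => α x (τ * z)) (Icc 0 1) := by
    refine ODE_solution_unique (v := fun _ y => τ • V y) (K := ‖τ‖₊ * k)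
      (fun _ => ?_) ?_ ?_ ?_ ?_ ?_
    · exact LipschitzWith.of_dist_le_mul fun a b => by
        rw [dist_smul₀, NNReal.coe_mul, mul_assoc]
        exact mul_le_mul_of_nonneg_left (hk.dist_le_mul a b) (by positivity)
    · exact fun z _ => (hσ z).continuousAt.continuousWithinAt
    · intro z hz
      have : IccExtend zero_le_one (superposition V γ) z = V (σ z) := by
        rw [IccExtend_of_mem _ _ (Ico_subset_Icc_self hz)]
        change V (γ _) = V (σ z)
        rw [hγ]
      have h := hσ z
      rw [this] at h
      exact h.hasDerivWithinAt
    · exact fun z hz => (hα' z hz).continuousAt.continuousWithinAt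
    · exact fun z hz => (hα' z (Ico_subset_Icc_self hz)).hasDerivWithinAt
    · simp [σ, (hbox 0 (by simpa using hδ)).1]
  have h1 := huniq (right_mem_Icc.2 zero_le_one)
  simp only [mul_one] at h1
  change α x τ = γ _
  rw [hγ, ← h1]

/-- Near a point, a `C¹` vector field has a local flow of class `C¹`. -/
theorem exists_contDiffAt_flow [FiniteDimensional ℝ E] {V : E → E} {p : E}
    (hV : ContDiffAt ℝ 1 V p) :
    ∃ Φ : E × ℝ → E, ContDiffAt ℝ 1 Φ (p, 0) ∧ ∀ᶠ q : E × ℝ in 𝓝 (p, 0),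
      Φ (q.1, 0) = q.1 ∧ HasDerivAt (fun s => Φ (q.1, s)) (V (Φ q)) q.2 := by
  obtain ⟨u, hu, hVu⟩ := hV.contDiffOn le_rfl (by simp)
  -- Multiplying by a bump function supported where `V` is C¹ gives a globally Lipschitz C¹ field
  -- that coincides with `V` near `p`.
  obtain ⟨b, hb⟩ : ∃ b : ContDiffBump p, tsupport b ⊆ interior u := by
    obtain ⟨ε, hε, h⟩ := Metric.mem_nhds_iff.1 (interior_mem_nhds.2 hu)
    refine ⟨⟨ε / 4, ε / 2, by positivity, by linarith⟩, ?_⟩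
    rw [ContDiffBump.tsupport_eq]
    exact (Metric.closedBall_subset_ball (show ε / 2 < ε by linarith)).trans h
  have hW : ContDiff ℝ 1 fun y => b y • V y := by
    rw [contDiff_iff_contDiffAt]
    intro y
    by_cases hy : y ∈ tsupport b
    · exact b.contDiffAt.smul ((hVu y (interior_subset (hb hy))).contDiffAt
        (mem_interior_iff_mem_nhds.1 (hb hy)))
    · refine contDiffAt_const (c := 0) |>.congr_of_eventuallyEq ?_
      filter_upwards [(isClosed_tsupport b).isOpen_compl.mem_nhds hy] with z hz
      rw [image_eq_zero_of_notMem_tsupport hz, zero_smul]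
  have hsupp : HasCompactSupport fun y => b y • V y := b.hasCompactSupport.smul_right
  obtain ⟨k, hk⟩ := ContDiff.lipschitzWith_of_hasCompactSupport hsupp hW one_ne_zero
  obtain ⟨α, hα⟩ := hW.contDiffAt (x := p) |>.exists_eventually_eq_hasDerivAt 0
  have hc := contDiffAt_flow_of_lipschitz (V := ⟨fun y => b y • V y, hW.continuous⟩) hW hk p hα
  refine ⟨fun q => α q.1 q.2, hc, ?_⟩
  rw [← nhds_prod_eq] at hα
  have h0 : α p 0 = p := hα.self_of_nhds.1
  have hE : ∀ᶠ y in 𝓝 p, b y = 1 := b.eventuallyEq_one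
  -- Short orbits starting near `p` stay where the bump function is `1`, so they solve the original
  -- equation.
  have hE' : ∀ᶠ q : E × ℝ in 𝓝 (p, 0), b (α q.1 q.2) = 1 := by
    have : Tendsto (fun q : E × ℝ => α q.1 q.2) (𝓝 (p, 0)) (𝓝 p) := by
      simpa [h0] using hc.continuousAt.tendsto
    exact this.eventually hE
  filter_upwards [hα, hE'] with q hq hq'
  refine ⟨hq.1, ?_⟩
  have := hq.2
  rwa [hq', one_smul] at this

end LocalFlow

end

section

variable {M : Type*} [TopologicalSpace M] [ChartedSpace E3 M]

/-! ### Reading vector fields, curves and maps in charts -/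

/-- The value at `q` of a vector field, the tangent space being identified with `E3`, as it is by
definition. -/
def vec (Z : ∀ x : M, TangentSpace (𝓡 3) x) (q : M) : E3 := Z q

/-- The derivative at `q` of the preferred chart at `p`. -/
def dchart (p q : M) : E3 →L[ℝ] E3 :=
  mfderiv (𝓡 3) 𝓘(ℝ, E3) (extChartAt (𝓡 3) p) q

theorem inChart_apply (Z : ∀ x : M, TangentSpace (𝓡 3) x) (p : M) (y : E3) :
    inChart Z p y = dchart p ((extChartAt (𝓡 3) p).symm y) (vec Z ((extChartAt (𝓡 3) p).symm y)) :=
  rfl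

theorem inChart_extChartAt (Z : ∀ x : M, TangentSpace (𝓡 3) x) {p q : M}
    (hq : q ∈ (extChartAt (𝓡 3) p).source) :
    inChart Z p (extChartAt (𝓡 3) p q) = dchart p q (vec Z q) := by
  rw [inChart_apply, (extChartAt (𝓡 3) p).left_inv hq]

variable [IsManifold (𝓡 3) ∞ M]

theorem dchart_isInvertible {p q : M} (hq : q ∈ (extChartAt (𝓡 3) p).source) :
    (dchart p q).IsInvertible :=
  isInvertible_mfderiv_extChartAt hq

theorem dchart_injective {p q : M} (hq : q ∈ (extChartAt (𝓡 3) p).source) :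
    Function.Injective (dchart p q) :=
  (dchart_isInvertible hq).injective

theorem dchart_surjective {p q : M} (hq : q ∈ (extChartAt (𝓡 3) p).source) :
    Function.Surjective (dchart p q) :=
  (dchart_isInvertible hq).surjective

/-- Links the tangent bundle to the charts: continuity and smoothness of fields, stated in the
bundle, become those of vector-valued functions in a chart. -/
theorem trivializationAt_snd_eq {p q : M} (hq : q ∈ (extChartAt (𝓡 3) p).source)
    (v : E3) :
    (trivializationAt E3 (TangentSpace (𝓡 3)) p ⟨q, v⟩).2 = dchart p q v := by
  rw [extChartAt_source] at hq
  have h1 : ∀ v : TangentSpace (𝓡 3) q,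
      (trivializationAt E3 (TangentSpace (𝓡 3)) p).continuousLinearMapAt ℝ q v =
        (trivializationAt E3 (TangentSpace (𝓡 3)) p ⟨q, v⟩).2 := by
    intro v
    rw [Bundle.Trivialization.continuousLinearMapAt_apply,
      Bundle.Trivialization.coe_linearMapAt_of_mem]
    simpa using hq
  exact (h1 v).symm.trans
    (DFunLike.congr_fun (TangentBundle.continuousLinearMapAt_trivializationAt hq) v)

theorem contDiffAt_inChart {Y : ∀ x : M, TangentSpace (𝓡 3) x} (hY : IsC1Field Y) (p : M) {y : E3}
    (hy : y ∈ (extChartAt (𝓡 3) p).target) : ContDiffAt ℝ 1 (inChart Y p) y := by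
  have h1 : ContMDiffAt (𝓡 3) 𝓘(ℝ, E3) 1
      (fun q => (trivializationAt E3 (TangentSpace (𝓡 3)) p ⟨q, Y q⟩).2)
      ((extChartAt (𝓡 3) p).symm y) := by
    refine (Bundle.Trivialization.contMDiffAt_section_iff _ ?_).1 hY.contMDiffAt
    have := (extChartAt (𝓡 3) p).map_target hy
    rw [extChartAt_source] at this
    simpa using this
  have h2 : ContMDiffAt 𝓘(ℝ, E3) (𝓡 3) 1 (extChartAt (𝓡 3) p).symm y :=
    (contMDiffOn_extChartAt_symm p).contMDiffAt ((isOpen_extChartAt_target p).mem_nhds hy)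
  have h3 := (h1.comp y h2).contDiffAt
  refine h3.congr_of_eventuallyEq ?_
  filter_upwards [(isOpen_extChartAt_target p).mem_nhds hy] with z hz
  exact (trivializationAt_snd_eq ((extChartAt (𝓡 3) p).map_target hz) _).symm

theorem continuousWithinAt_field_iff {T : Type*} [TopologicalSpace T] {f : T → M}
    {w : T → E3} {u : Set T} {t : T} {p : M}
    (ht : f t ∈ (extChartAt (𝓡 3) p).source) (hf : ContinuousWithinAt f u t) :
    ContinuousWithinAt (fun s => (⟨f s, w s⟩ : TangentBundle (𝓡 3) M)) u t ↔
      ContinuousWithinAt (fun s => dchart p (f s) (w s)) u t := by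
  have hs : (⟨f t, w t⟩ : TangentBundle (𝓡 3) M) ∈
      (trivializationAt E3 (TangentSpace (𝓡 3)) p).source := by
    rw [Bundle.Trivialization.mem_source]
    rw [extChartAt_source] at ht
    simpa using ht
  have h0 := (trivializationAt E3 (TangentSpace (𝓡 3)) p).tendsto_nhds_iff
    (l := 𝓝[u] t) (f := fun s => (⟨f s, w s⟩ : TangentBundle (𝓡 3) M)) hs
  have hev : ∀ᶠ s in 𝓝[u] t, (trivializationAt E3 (TangentSpace (𝓡 3)) p ⟨f s, w s⟩).2 =
      dchart p (f s) (w s) := by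
    filter_upwards [hf.eventually ((isOpen_extChartAt_source p).mem_nhds ht)] with s hs
    exact trivializationAt_snd_eq hs _
  rw [ContinuousWithinAt, h0]
  refine ⟨fun h => ?_, fun h => ⟨hf, ?_⟩⟩
  · have := h.2
    rw [trivializationAt_snd_eq ht] at this
    exact this.congr' hev
  · rw [trivializationAt_snd_eq ht]
    exact Tendsto.congr' (hev.mono fun _ h => h.symm) h

/-- The expression of `g` in the preferred charts at `p` and `p'`. -/
def mapInChart (g : M → M) (p p' : M) (y : E3) : E3 :=
  extChartAt (𝓡 3) p' (g ((extChartAt (𝓡 3) p).symm y))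

omit [IsManifold (𝓡 3) ∞ M] in
theorem mapInChart_extChartAt (g : M → M) {p p' q : M} (hq : q ∈ (extChartAt (𝓡 3) p).source) :
    mapInChart g p p' (extChartAt (𝓡 3) p q) = extChartAt (𝓡 3) p' (g q) := by
  rw [mapInChart, (extChartAt (𝓡 3) p).left_inv hq]

theorem contMDiffAt_extChartAt_symm {p : M} {y : E3} (hy : y ∈ (extChartAt (𝓡 3) p).target)
    (n : ℕ∞) : ContMDiffAt 𝓘(ℝ, E3) (𝓡 3) n (extChartAt (𝓡 3) p).symm y :=
  ((contMDiffOn_extChartAt_symm (n := ∞) p).contMDiffAt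
    ((isOpen_extChartAt_target p).mem_nhds hy)).of_le (by exact_mod_cast le_top)

theorem contMDiffAt_extChartAt_of_mem {p q : M} (hq : q ∈ (extChartAt (𝓡 3) p).source)
    (n : ℕ∞) : ContMDiffAt (𝓡 3) 𝓘(ℝ, E3) n (extChartAt (𝓡 3) p) q := by
  rw [extChartAt_source] at hq
  exact (contMDiffAt_extChartAt' (n := ∞) hq).of_le (by exact_mod_cast le_top)

theorem contDiffAt_mapInChart {g : M → M} {p p' q : M} (hq : q ∈ (extChartAt (𝓡 3) p).source)
    (hq' : g q ∈ (extChartAt (𝓡 3) p').source) (hg : ContMDiffAt (𝓡 3) (𝓡 3) 1 g q) :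
    ContDiffAt ℝ 1 (mapInChart g p p') (extChartAt (𝓡 3) p q) := by
  rw [← contMDiffAt_iff_contDiffAt]
  have h1 := contMDiffAt_extChartAt_symm ((extChartAt (𝓡 3) p).map_source hq) 1
  have e := (extChartAt (𝓡 3) p).left_inv hq
  have h2 : ContMDiffAt (𝓡 3) 𝓘(ℝ, E3) 1 (fun z => extChartAt (𝓡 3) p' (g z))
      ((extChartAt (𝓡 3) p).symm (extChartAt (𝓡 3) p q)) := by
    rw [e]
    exact (contMDiffAt_extChartAt_of_mem hq' 1).comp q hg
  exact h2.comp _ h1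

/-- Derivatives of the chart, applied to derivatives of curves, maps, ... -/
theorem hasMFDerivAt_dchart {p q : M} (hq : q ∈ (extChartAt (𝓡 3) p).source) :
    HasMFDerivAt (𝓡 3) 𝓘(ℝ, E3) (extChartAt (𝓡 3) p) q (dchart p q) := by
  rw [extChartAt_source] at hq
  exact (mdifferentiableAt_extChartAt hq).hasMFDerivAt

theorem fderiv_mapInChart {g : M → M} {p p' q : M} (hq : q ∈ (extChartAt (𝓡 3) p).source)
    (hq' : g q ∈ (extChartAt (𝓡 3) p').source) (hg : MDifferentiableAt (𝓡 3) (𝓡 3) g q)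
    (v : E3) :
    fderiv ℝ (mapInChart g p p') (extChartAt (𝓡 3) p q) (dchart p q v) =
      dchart p' (g q) (mfderiv (𝓡 3) (𝓡 3) g q v) := by
  have hy := (extChartAt (𝓡 3) p).map_source hq
  have e := (extChartAt (𝓡 3) p).left_inv hq
  have hs : MDifferentiableAt 𝓘(ℝ, E3) (𝓡 3) (extChartAt (𝓡 3) p).symm (extChartAt (𝓡 3) p q) :=
    (contMDiffAt_extChartAt_symm hy 1).mdifferentiableAt one_ne_zero
  have h1 : MDifferentiableAt 𝓘(ℝ, E3) 𝓘(ℝ, E3) (mapInChart g p p') (extChartAt (𝓡 3) p q) := by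
    have h2 : MDifferentiableAt (𝓡 3) 𝓘(ℝ, E3) (fun z => extChartAt (𝓡 3) p' (g z))
        ((extChartAt (𝓡 3) p).symm (extChartAt (𝓡 3) p q)) := by
      rw [e]
      exact (hasMFDerivAt_dchart hq').mdifferentiableAt.comp q hg
    exact h2.comp _ hs
  have h2 : HasMFDerivAt (𝓡 3) 𝓘(ℝ, E3) (fun z => mapInChart g p p' (extChartAt (𝓡 3) p z)) q
      ((mfderiv 𝓘(ℝ, E3) 𝓘(ℝ, E3) (mapInChart g p p') (extChartAt (𝓡 3) p q)).comp
        (dchart p q)) :=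
    HasMFDerivAt.comp (g := mapInChart g p p') q h1.hasMFDerivAt (hasMFDerivAt_dchart hq)
  have h3 : HasMFDerivAt (𝓡 3) 𝓘(ℝ, E3) (fun z => extChartAt (𝓡 3) p' (g z)) q
      ((dchart p' (g q)).comp (mfderiv (𝓡 3) (𝓡 3) g q)) :=
    HasMFDerivAt.comp q (hasMFDerivAt_dchart hq') hg.hasMFDerivAt
  have h4 : (fun z => extChartAt (𝓡 3) p' (g z)) =ᶠ[𝓝 q]
      fun z => mapInChart g p p' (extChartAt (𝓡 3) p z) := by
    filter_upwards [(isOpen_extChartAt_source p).mem_nhds hq] with z hz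
    exact (mapInChart_extChartAt g hz).symm
  have h5 := hasMFDerivAt_unique (h2.congr_of_eventuallyEq h4) h3
  rw [mfderiv_eq_fderiv] at h5
  exact DFunLike.congr_fun h5 v

/-- A solution of the equation read in a chart is an integral curve. -/
theorem hasMFDerivAt_chart_symm_comp {Y : ∀ x : M, TangentSpace (𝓡 3) x} {p : M} {σ : ℝ → E3}
    {t : ℝ} (ht : σ t ∈ (extChartAt (𝓡 3) p).target) (hσ : HasDerivAt σ (inChart Y p (σ t)) t) :
    HasMFDerivAt 𝓘(ℝ, ℝ) (𝓡 3) (fun s => (extChartAt (𝓡 3) p).symm (σ s)) t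
      ((1 : ℝ →L[ℝ] ℝ).smulRight (Y ((extChartAt (𝓡 3) p).symm (σ t)))) := by
  have hsrc := (extChartAt (𝓡 3) p).map_target ht
  have hs : MDifferentiableAt 𝓘(ℝ, E3) (𝓡 3) (extChartAt (𝓡 3) p).symm (σ t) :=
    (contMDiffAt_extChartAt_symm ht 1).mdifferentiableAt one_ne_zero
  have h1 : HasMFDerivAt 𝓘(ℝ, ℝ) 𝓘(ℝ, E3) σ t
      ((1 : ℝ →L[ℝ] ℝ).smulRight (inChart Y p (σ t))) := hσ.hasFDerivAt.hasMFDerivAt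
  have h2 := HasMFDerivAt.comp t hs.hasMFDerivAt h1
  refine h2.congr_mfderiv ?_
  have h3 : HasMFDerivAt 𝓘(ℝ, ℝ) 𝓘(ℝ, E3)
      (fun s => extChartAt (𝓡 3) p ((extChartAt (𝓡 3) p).symm (σ s))) t
      ((dchart p _).comp ((mfderiv 𝓘(ℝ, E3) (𝓡 3) (extChartAt (𝓡 3) p).symm (σ t)).comp
        ((1 : ℝ →L[ℝ] ℝ).smulRight (inChart Y p (σ t))))) :=
    HasMFDerivAt.comp t (hasMFDerivAt_dchart hsrc) h2
  have h4 : (fun s => extChartAt (𝓡 3) p ((extChartAt (𝓡 3) p).symm (σ s))) =ᶠ[𝓝 t] σ := by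
    filter_upwards [hσ.continuousAt.eventually ((isOpen_extChartAt_target p).mem_nhds ht)] with s hs
    exact (extChartAt (𝓡 3) p).right_inv hs
  have h5 := hasMFDerivAt_unique (h1.congr_of_eventuallyEq (f₁ := fun s =>
    extChartAt (𝓡 3) p ((extChartAt (𝓡 3) p).symm (σ s))) h4) h3
  ext1
  apply dchart_injective hsrc
  have h6 := DFunLike.congr_fun h5 (1 : ℝ)
  refine h6.symm.trans ?_
  change (1 : ℝ) • inChart Y p (σ t) = dchart p _ ((1 : ℝ) • vec Y _)
  rw [one_smul, one_smul, inChart_apply]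

/-- The derivative, in a chart, of an integral curve. -/
theorem hasDerivAt_extChartAt_comp {p : M} {c : ℝ → M}
    {t : ℝ} (ht : c t ∈ (extChartAt (𝓡 3) p).source)
    {v : E3}
    (hc : HasMFDerivAt 𝓘(ℝ, ℝ) (𝓡 3) c t ((1 : ℝ →L[ℝ] ℝ).smulRight v)) :
    HasDerivAt (fun s => extChartAt (𝓡 3) p (c s)) (dchart p (c t) v) t := by
  have h := HasMFDerivAt.comp t (hasMFDerivAt_dchart ht) hc
  have h2 : HasMFDerivAt 𝓘(ℝ, ℝ) 𝓘(ℝ, E3) (fun s => extChartAt (𝓡 3) p (c s)) t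
      ((1 : ℝ →L[ℝ] ℝ).smulRight (dchart p (c t) v)) := by
    refine h.congr_mfderiv ?_
    ext1
    change dchart p (c t) ((1 : ℝ) • v) = (1 : ℝ) • dchart p (c t) v
    rw [map_smul]
  exact (hasDerivAt_iff_hasFDerivAt).2 h2.hasFDerivAt

end

section

variable {M : Type*} [TopologicalSpace M] [ChartedSpace E3 M]

/-! ### The flow of a `C¹` vector field -/

/-- Some integral curve on an open interval goes from `q` to `q'` in time `r`. -/
def FlowRel (Y : ∀ x : M, TangentSpace (𝓡 3) x) (q : M) (r : ℝ) (q' : M) : Prop :=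
  ∃ (c : ℝ → M) (a b : ℝ), IsMIntegralCurveOn c Y (Ioo a b) ∧ 0 ∈ Ioo a b ∧ r ∈ Ioo a b ∧
    c 0 = q ∧ c r = q'

/-- The flow of `Y` through `q` is defined at time `r`. -/
def FlowDef (Y : ∀ x : M, TangentSpace (𝓡 3) x) (q : M) (r : ℝ) : Prop := ∃ q', FlowRel Y q r q'

open Classical in
/-- The flow of `Y`. -/
def flow (Y : ∀ x : M, TangentSpace (𝓡 3) x) (q : M) (r : ℝ) : M :=
  if h : FlowDef Y q r then h.choose else q

variable {Y : ∀ x : M, TangentSpace (𝓡 3) x}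

theorem FlowDef.flowRel {q : M} {r : ℝ} (h : FlowDef Y q r) : FlowRel Y q r (flow Y q r) := by
  rw [flow, dif_pos h]; exact h.choose_spec

theorem FlowRel.symm {q q' : M} {r : ℝ} (h : FlowRel Y q r q') : FlowRel Y q' (-r) q := by
  obtain ⟨c, a, b, hc, h0, hr, rfl, rfl⟩ := h
  refine ⟨c ∘ (· + r), a - r, b - r, ?_, ⟨by linarith [hr.1], by linarith [hr.2]⟩,
    ⟨by linarith [h0.1], by linarith [h0.2]⟩, by simp, by simp⟩
  convert hc.comp_add r using 1
  ext x
  simp only [mem_Ioo, mem_ofPred_eq]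
  constructor <;> rintro ⟨h1, h2⟩ <;> constructor <;> linarith

variable [IsManifold (𝓡 3) ∞ M] [T2Space M]

theorem eq_of_isMIntegralCurveOn_Ioo (hY : IsC1Field Y) {c c' : ℝ → M} {a b a' b' t₀ : ℝ}
    (hc : IsMIntegralCurveOn c Y (Ioo a b)) (hc' : IsMIntegralCurveOn c' Y (Ioo a' b'))
    (h : t₀ ∈ Ioo a b) (h' : t₀ ∈ Ioo a' b') (e : c t₀ = c' t₀) {t : ℝ} (ht : t ∈ Ioo a b)
    (ht' : t ∈ Ioo a' b') : c t = c' t :=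
  isMIntegralCurveOn_Ioo_eqOn_of_contMDiff_boundaryless (a := max a a') (b := min b b')
    ⟨max_lt h.1 h'.1, lt_min h.2 h'.2⟩ hY
    (hc.mono (Ioo_subset_Ioo (le_max_left _ _) (min_le_left _ _)))
    (hc'.mono (Ioo_subset_Ioo (le_max_right _ _) (min_le_right _ _))) e
    ⟨max_lt ht.1 ht'.1, lt_min ht.2 ht'.2⟩

theorem FlowRel.unique (hY : IsC1Field Y) {q q₁ q₂ : M} {r : ℝ} (h₁ : FlowRel Y q r q₁)
    (h₂ : FlowRel Y q r q₂) : q₁ = q₂ := by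
  obtain ⟨c, a, b, hc, h0, hr, rfl, rfl⟩ := h₁
  obtain ⟨c', a', b', hc', h0', hr', e, rfl⟩ := h₂
  exact eq_of_isMIntegralCurveOn_Ioo hY hc hc' h0 h0' e.symm hr hr'

theorem FlowRel.flow_eq (hY : IsC1Field Y) {q q' : M} {r : ℝ} (h : FlowRel Y q r q') :
    flow Y q r = q' :=
  FlowRel.unique hY (FlowDef.flowRel ⟨q', h⟩) h

/-- The second curve, shifted by `r`, agrees with the first on the overlap of their intervals by
uniqueness, so the two glue to an integral curve on the union. -/
theorem FlowRel.add (hY : IsC1Field Y) {q q' q'' : M} {r r' : ℝ} (h : FlowRel Y q r q')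
    (h' : FlowRel Y q' r' q'') : FlowRel Y q (r + r') q'' := by
  obtain ⟨c, a, b, hc, h0, hr, rfl, rfl⟩ := h
  obtain ⟨d, a', b', hd, h0', hr', e, rfl⟩ := h'
  have hd' : IsMIntegralCurveOn (d ∘ (· + -r)) Y (Ioo (a' + r) (b' + r)) := by
    convert hd.comp_add (-r) using 1
    ext x
    simp only [mem_Ioo, mem_ofPred_eq]
    constructor <;> rintro ⟨h1, h2⟩ <;> constructor <;> linarith
  have hrd : r ∈ Ioo (a' + r) (b' + r) := ⟨by linarith [h0'.1], by linarith [h0'.2]⟩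
  have hrd' : r + r' ∈ Ioo (a' + r) (b' + r) := ⟨by linarith [hr'.1], by linarith [hr'.2]⟩
  have hed : c r = (d ∘ (· + -r)) r := by simp [e]
  refine ⟨piecewise (Ioo a b) c (d ∘ (· + -r)), min a (a' + r), max b (b' + r), ?_,
    ⟨min_lt_of_left_lt h0.1, lt_max_of_lt_left h0.2⟩,
    ⟨min_lt_of_right_lt hrd'.1, lt_max_of_lt_right hrd'.2⟩, ?_, ?_⟩
  · rw [← Ioo_union_Ioo']
    · exact isMIntegralCurveOn_piecewise hY hc hd' ⟨hr, hrd⟩ hed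
    · exact hrd.1.trans hr.2
    · exact hr.1.trans hrd.2
  · rw [piecewise_eq_of_mem _ _ _ h0]
  · rw [eqOn_piecewise_of_isMIntegralCurveOn_Ioo hY hc hd' ⟨hr, hrd⟩ hed hrd',
      Function.comp_apply, add_neg_cancel_comm]

theorem FlowDef.add (hY : IsC1Field Y) {q : M} {r r' : ℝ} (h : FlowDef Y q r)
    (h' : FlowDef Y (flow Y q r) r') : FlowDef Y q (r + r') :=
  ⟨_, h.flowRel.add hY h'.flowRel⟩

theorem flow_add (hY : IsC1Field Y) {q : M} {r r' : ℝ} (h : FlowDef Y q r)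
    (h' : FlowDef Y (flow Y q r) r') : flow Y q (r + r') = flow Y (flow Y q r) r' :=
  (h.flowRel.add hY h'.flowRel).flow_eq hY

omit [IsManifold (𝓡 3) ∞ M] [T2Space M] in
theorem FlowDef.neg {q : M} {r : ℝ} (h : FlowDef Y q r) : FlowDef Y (flow Y q r) (-r) :=
  ⟨_, h.flowRel.symm⟩

omit [IsManifold (𝓡 3) ∞ M] [T2Space M] in
theorem flowRel_of_curve {c : ℝ → M} {a b s t : ℝ} (hc : IsMIntegralCurveOn c Y (Ioo a b))
    (hs : s ∈ Ioo a b) (ht : t ∈ Ioo a b) : FlowRel Y (c s) (t - s) (c t) := by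
  refine ⟨c ∘ (· + s), a - s, b - s, ?_, ⟨by linarith [hs.1], by linarith [hs.2]⟩,
    ⟨by linarith [ht.1], by linarith [ht.2]⟩, by simp, by simp⟩
  convert hc.comp_add s using 1
  ext x
  simp only [mem_Ioo, mem_ofPred_eq]
  constructor <;> rintro ⟨h1, h2⟩ <;> constructor <;> linarith

theorem FlowDef.exists_curve (hY : IsC1Field Y) {q : M} {r : ℝ} (h : FlowDef Y q r) :
    ∃ a b : ℝ, 0 ∈ Ioo a b ∧ r ∈ Ioo a b ∧ IsMIntegralCurveOn (flow Y q) Y (Ioo a b) ∧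
      ∀ s ∈ Ioo a b, FlowDef Y q s := by
  obtain ⟨q', c, a, b, hc, h0, hr, rfl, rfl⟩ := h
  have key : ∀ s ∈ Ioo a b, FlowRel Y (c 0) s (c s) := fun s hs => by
    simpa using flowRel_of_curve hc h0 hs
  have e : ∀ s ∈ Ioo a b, flow Y (c 0) s = c s := fun s hs => (key s hs).flow_eq hY
  refine ⟨a, b, h0, hr, fun s hs => ?_, fun s hs => ⟨_, key s hs⟩⟩
  have h1 := hc s hs
  rw [e s hs]
  exact h1.congr_of_eventuallyEq (eventually_of_mem self_mem_nhdsWithin e) (e s hs)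

theorem FlowDef.hasMFDerivAt (hY : IsC1Field Y) {q : M} {r : ℝ} (h : FlowDef Y q r) :
    HasMFDerivAt 𝓘(ℝ, ℝ) (𝓡 3) (flow Y q) r
      ((1 : ℝ →L[ℝ] ℝ).smulRight (Y (flow Y q r))) := by
  obtain ⟨a, b, -, hr, hc, -⟩ := h.exists_curve hY
  exact (hc r hr).hasMFDerivAt (Ioo_mem_nhds hr.1 hr.2)

omit [T2Space M] in
theorem exists_local_flow (hY : IsC1Field Y) (p : M) : ∃ Φ : M × ℝ → M,
    ContMDiffAt ((𝓡 3).prod 𝓘(ℝ, ℝ)) (𝓡 3) 1 Φ (p, 0) ∧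
      ∀ᶠ z in 𝓝 (p, (0 : ℝ)), FlowRel Y z.1 z.2 (Φ z) := by
  set χ := extChartAt (𝓡 3) p
  have hp : p ∈ χ.source := mem_extChartAt_source p
  have hχp : χ p ∈ χ.target := mem_extChartAt_target p
  obtain ⟨Φ, hΦ, hev⟩ := exists_contDiffAt_flow (contDiffAt_inChart hY p hχp)
  have h0 : Φ (χ p, 0) = χ p := hev.self_of_nhds.1
  have ht : ∀ᶠ z in 𝓝 (χ p, (0 : ℝ)), Φ z ∈ χ.target := by
    refine hΦ.continuousAt.eventually ((isOpen_extChartAt_target p).mem_nhds ?_)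
    rw [h0]; exact hχp
  have hm : ContMDiffAt ((𝓡 3).prod 𝓘(ℝ, ℝ)) 𝓘(ℝ, E3 × ℝ) 1
      (fun z : M × ℝ => (χ z.1, z.2)) (p, 0) :=
    ((contMDiffAt_extChartAt (x := p)).comp (p, (0 : ℝ)) contMDiffAt_fst).prodMk_space
      contMDiffAt_snd
  refine ⟨fun z => χ.symm (Φ (χ z.1, z.2)), ?_, ?_⟩
  · have h1 : ContMDiffAt ((𝓡 3).prod 𝓘(ℝ, ℝ)) 𝓘(ℝ, E3) 1
        (fun z : M × ℝ => Φ (χ z.1, z.2)) (p, 0) :=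
      ContMDiffAt.comp (I' := 𝓘(ℝ, E3 × ℝ)) (p, (0 : ℝ)) hΦ.contMDiffAt hm
    have h2 : ContMDiffAt 𝓘(ℝ, E3) (𝓡 3) 1 χ.symm (Φ (χ p, 0)) := by
      rw [h0]; exact contMDiffAt_extChartAt_symm hχp 1
    exact ContMDiffAt.comp (I' := 𝓘(ℝ, E3)) (p, (0 : ℝ)) h2 h1
  · have hb := hev.and ht
    -- A product neighbourhood is needed: for each starting point the equation must hold on the
    -- whole interval `(-δ, δ)`, not at one time only.
    rw [nhds_prod_eq, Filter.eventually_prod_iff] at hb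
    obtain ⟨pa, hpa, pb, hpb, hab⟩ := hb
    obtain ⟨δ, hδ, hδb⟩ := Metric.eventually_nhds_iff_ball.1 hpb
    have hc : ContinuousAt χ p := continuousAt_extChartAt p
    rw [nhds_prod_eq]
    have h1 : ∀ᶠ q in 𝓝 p, pa (χ q) ∧ q ∈ χ.source :=
      (hc.eventually hpa).and ((isOpen_extChartAt_source p).mem_nhds hp)
    have h2 : ∀ᶠ s in 𝓝 (0 : ℝ), s ∈ Ioo (-δ) δ := Ioo_mem_nhds (by linarith) hδ
    filter_upwards [h1.prod_mk h2] with z ⟨⟨hz1, hz2⟩, hz3⟩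
    have hI : ∀ s ∈ Ioo (-δ) δ, s ∈ Metric.ball (0 : ℝ) δ := fun s hs => by
      rw [Real.ball_eq_Ioo]; simpa using hs
    refine ⟨fun s => χ.symm (Φ (χ z.1, s)), -δ, δ, fun s hs => ?_, ⟨by linarith, hδ⟩, hz3, ?_, rfl⟩
    · have := hab hz1 (hδb s (hI s hs))
      exact (hasMFDerivAt_chart_symm_comp (σ := fun s => Φ (χ z.1, s)) this.2
        this.1.2).hasMFDerivWithinAt
    · have := hab hz1 (hδb 0 (hI 0 ⟨by linarith, hδ⟩))
      simp only at this ⊢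
      rw [this.1.1, χ.left_inv hz2]

/-- The flow is defined and of class `C¹` near `(p, r)`. -/
def FlowRegular (Y : ∀ x : M, TangentSpace (𝓡 3) x) (p : M) (r : ℝ) : Prop :=
  ContMDiffAt ((𝓡 3).prod 𝓘(ℝ, ℝ)) (𝓡 3) 1 (fun z : M × ℝ => flow Y z.1 z.2) (p, r) ∧
    ∀ᶠ z in 𝓝 (p, r), FlowDef Y z.1 z.2

theorem flowRegular_zero (hY : IsC1Field Y) (p : M) : FlowRegular Y p 0 := by
  obtain ⟨Φ, hΦ, hev⟩ := exists_local_flow hY p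
  exact ⟨hΦ.congr_of_eventuallyEq (hev.mono fun z hz => hz.flow_eq hY),
    hev.mono fun z hz => ⟨_, hz⟩⟩

theorem flow_zero (hY : IsC1Field Y) (p : M) : flow Y p 0 = p := by
  obtain ⟨q, c, a, b, hc, h0, -, rfl, rfl⟩ := (flowRegular_zero hY p).2.self_of_nhds
  exact FlowRel.flow_eq hY ⟨c, a, b, hc, h0, h0, rfl, rfl⟩

omit [T2Space M] in
theorem FlowRegular.eventually {p : M} {r : ℝ} (h : FlowRegular Y p r) :
    ∀ᶠ z in 𝓝 (p, r), FlowRegular Y z.1 z.2 := by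
  filter_upwards [(contMDiffAt_iff_contMDiffAt_nhds (by simp)).1 h.1, h.2.eventually_nhds] with z h1 h2
  exact ⟨h1, h2⟩

/-- Near `(p, r')` the flow is the time `r` map followed by the flow for time `r' - r`. The order of
`r` and `r'` plays no role, so regularity propagates in both directions of time. -/
theorem FlowRegular.trans (hY : IsC1Field Y) {p : M} {r r' : ℝ} (h : FlowRegular Y p r)
    (h' : FlowRegular Y (flow Y p r) (r' - r)) : FlowRegular Y p r' := by
  have hm : ContMDiffAt ((𝓡 3).prod 𝓘(ℝ, ℝ)) ((𝓡 3).prod 𝓘(ℝ, ℝ)) 1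
      (fun z : M × ℝ => (flow Y z.1 r, z.2 - r)) (p, r') := by
    refine ContMDiffAt.prodMk ?_ ?_
    · have h1 : ContMDiffAt ((𝓡 3).prod 𝓘(ℝ, ℝ)) ((𝓡 3).prod 𝓘(ℝ, ℝ)) 1
          (fun z : M × ℝ => (z.1, r)) (p, r') :=
        contMDiffAt_fst.prodMk contMDiffAt_const
      exact ContMDiffAt.comp (I' := (𝓡 3).prod 𝓘(ℝ, ℝ)) (p, r') (g := fun z : M × ℝ => flow Y z.1 z.2) h.1 h1
    · have h2 : ContMDiffAt 𝓘(ℝ, ℝ) 𝓘(ℝ, ℝ) 1 (fun s : ℝ => s - r) r' :=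
        (contDiff_id.sub contDiff_const).contDiffAt.contMDiffAt
      exact h2.comp (p, r') (contMDiffAt_snd (I := 𝓡 3) (M := M))
  have hE : ∀ᶠ z in 𝓝 (p, r'), FlowDef Y z.1 r ∧ FlowDef Y (flow Y z.1 r) (z.2 - r) := by
    have hc1 : Tendsto (fun z : M × ℝ => (z.1, r)) (𝓝 (p, r')) (𝓝 (p, r)) :=
      (continuous_fst.prodMk continuous_const).tendsto' _ _ rfl
    exact (hc1.eventually h.2).and (hm.continuousAt.eventually h'.2)
  refine ⟨?_, ?_⟩
  · have h3 := ContMDiffAt.comp (p, r') (g := fun z : M × ℝ => flow Y z.1 z.2) h'.1 hm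
    refine h3.congr_of_eventuallyEq ?_
    filter_upwards [hE] with z hz
    have := flow_add hY hz.1 hz.2
    rwa [add_sub_cancel] at this
  · filter_upwards [hE] with z hz
    have := hz.1.add hY hz.2
    rwa [add_sub_cancel] at this

/-- The domain of the flow is open, and the flow is of class `C¹`. -/
theorem FlowDef.regular (hY : IsC1Field Y) {p : M} {r : ℝ} (h : FlowDef Y p r) :
    FlowRegular Y p r := by
  obtain ⟨a, b, h0, hr, hc, hd⟩ := h.exists_curve hY
  have key : FlowRegular Y p 0 → FlowRegular Y p r := by
    -- Regularity passes between any two close times of the orbit, by regularity at time `0` at the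
    -- nearby point; connectedness of the interval then carries it from `0` to `r`.
    refine isPreconnected_Ioo.induction₂' (s := Ioo a b)
      (fun s t => FlowRegular Y p s → FlowRegular Y p t) ?_ ?_ h0 hr
    · intro s hs
      rw [nhdsWithin_eq_nhds.2 (Ioo_mem_nhds hs.1 hs.2)]
      have hcs : ContinuousAt (flow Y p) s := (hd s hs).hasMFDerivAt hY |>.continuousAt
      have hreg := (flowRegular_zero hY (flow Y p s)).eventually
      have h1 : Tendsto (fun t => (flow Y p s, t - s)) (𝓝 s) (𝓝 (flow Y p s, 0)) :=
        (continuous_const.prodMk (continuous_id.sub continuous_const)).tendsto' _ _ (by simp)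
      have h2 : Tendsto (fun t => (flow Y p t, s - t)) (𝓝 s) (𝓝 (flow Y p s, 0)) := by
        have : ContinuousAt (fun t => (flow Y p t, s - t)) s :=
          hcs.prodMk (continuous_const.sub continuous_id).continuousAt
        simpa using this.tendsto
      filter_upwards [h1.eventually hreg, h2.eventually hreg] with t ht1 ht2
      exact ⟨fun h => h.trans hY ht1, fun h => h.trans hY ht2⟩
    · exact fun s t u _ _ _ h1 h2 h3 => h2 (h1 h3)
  exact key (flowRegular_zero hY p)

theorem FlowDef.contMDiffAt (hY : IsC1Field Y) {p : M} {r : ℝ} (h : FlowDef Y p r) :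
    ContMDiffAt (𝓡 3) (𝓡 3) 1 (fun z => flow Y z r) p := by
  have h1 : ContMDiffAt (𝓡 3) ((𝓡 3).prod 𝓘(ℝ, ℝ)) 1 (fun z : M => (z, r)) p :=
    contMDiffAt_id.prodMk contMDiffAt_const
  exact ContMDiffAt.comp p (g := fun z : M × ℝ => flow Y z.1 z.2) (h.regular hY).1 h1

theorem FlowDef.eventually_left (hY : IsC1Field Y) {p : M} {r : ℝ} (h : FlowDef Y p r) :
    ∀ᶠ z in 𝓝 p, FlowDef Y z r :=
  ((continuous_id.prodMk continuous_const).tendsto' p (p, r) rfl).eventually (h.regular hY).2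

end

section

variable {M : Type*} [TopologicalSpace M] [ChartedSpace E3 M]
  {X Y : ∀ x : M, TangentSpace (𝓡 3) x}

/-! ### Integral curves on closed intervals -/

section

variable [IsManifold (𝓡 3) ∞ M]

/-- `FlowsTo` and `IsFirstReturn` use curves on closed intervals, with one-sided derivatives at the
ends, while `FlowRel` uses open intervals. Local integral curves are attached at both ends, and the
one-sided derivatives match there because both are given by the field. -/
theorem exists_extension_of_Icc (hY : IsC1Field Y) {c : ℝ → M} {a b : ℝ} (hab : a < b)
    (hc : IsMIntegralCurveOn c Y (Icc a b)) :
    ∃ (e : ℝ → M) (a' b' : ℝ), a' < a ∧ b < b' ∧ IsMIntegralCurveOn e Y (Ioo a' b') ∧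
      EqOn e c (Icc a b) := by
  obtain ⟨d₁, h₁, hd₁⟩ := exists_isMIntegralCurveAt_of_contMDiffAt_boundaryless (t₀ := a)
    (x₀ := c a) hY.contMDiffAt
  obtain ⟨d₂, h₂, hd₂⟩ := exists_isMIntegralCurveAt_of_contMDiffAt_boundaryless (t₀ := b)
    (x₀ := c b) hY.contMDiffAt
  obtain ⟨ε₁, hε₁, hd₁⟩ := Metric.eventually_nhds_iff_ball.1 hd₁
  obtain ⟨ε₂, hε₂, hd₂⟩ := Metric.eventually_nhds_iff_ball.1 hd₂
  set e : ℝ → M := fun t => if t < a then d₁ t else if t ≤ b then c t else d₂ t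
  have e_left : EqOn e d₁ (Iic a) := by
    intro t ht
    rcases (show t ≤ a from ht).lt_or_eq with h | rfl
    · simp [e, h]
    · simp [e, h₁, hab.le]
  have e_mid : EqOn e c (Icc a b) := fun t ht => by simp [e, ht.1.not_gt, ht.2]
  have e_right : EqOn e d₂ (Ici b) := by
    intro t ht
    rcases (show b ≤ t from ht).lt_or_eq with h | rfl
    · simp [e, (hab.trans h).not_gt, h.not_ge]
    · simp [e, h₂, hab.le]
  refine ⟨e, a - ε₁, b + ε₂, by linarith, by linarith, fun t ht => ?_, e_mid⟩
  have hl : t ∈ Iic a → HasMFDerivWithinAt 𝓘(ℝ, ℝ) (𝓡 3) e (Iic a) t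
      ((1 : ℝ →L[ℝ] ℝ).smulRight (Y (e t))) := by
    intro hta
    have := (hd₁ t (by rw [Real.ball_eq_Ioo]; exact ⟨ht.1, by linarith [show t ≤ a from hta]⟩))
    rw [e_left hta]
    exact this.hasMFDerivWithinAt.congr_of_eventuallyEq
      (eventually_of_mem self_mem_nhdsWithin e_left) (e_left hta)
  have hr : t ∈ Ici b → HasMFDerivWithinAt 𝓘(ℝ, ℝ) (𝓡 3) e (Ici b) t
      ((1 : ℝ →L[ℝ] ℝ).smulRight (Y (e t))) := by
    intro hta
    have := (hd₂ t (by rw [Real.ball_eq_Ioo]; exact ⟨by linarith [show b ≤ t from hta], ht.2⟩))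
    rw [e_right hta]
    exact this.hasMFDerivWithinAt.congr_of_eventuallyEq
      (eventually_of_mem self_mem_nhdsWithin e_right) (e_right hta)
  have hm : t ∈ Icc a b → HasMFDerivWithinAt 𝓘(ℝ, ℝ) (𝓡 3) e (Icc a b) t
      ((1 : ℝ →L[ℝ] ℝ).smulRight (Y (e t))) := by
    intro hta
    have := hc t hta
    rw [e_mid hta]
    exact this.congr_of_eventuallyEq (eventually_of_mem self_mem_nhdsWithin e_mid) (e_mid hta)
  have hfin : HasMFDerivAt 𝓘(ℝ, ℝ) (𝓡 3) e t ((1 : ℝ →L[ℝ] ℝ).smulRight (Y (e t))) := by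
    rcases lt_trichotomy t a with h | h | h
    · exact (hl h.le).hasMFDerivAt (Iic_mem_nhds h)
    · refine ((hl h.le).union (hm ⟨h.ge, by linarith⟩)).hasMFDerivAt ?_
      rw [Iic_union_Icc_eq_Iic hab.le]
      exact Iic_mem_nhds (by linarith)
    · rcases lt_trichotomy t b with h' | h' | h'
      · exact (hm ⟨h.le, h'.le⟩).hasMFDerivAt (Icc_mem_nhds h h')
      · refine ((hm ⟨h.le, h'.le⟩).union (hr h'.ge)).hasMFDerivAt ?_
        rw [Icc_union_Ici_eq_Ici hab.le]
        exact Ici_mem_nhds h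
      · exact (hr h'.le).hasMFDerivAt (Ici_mem_nhds h')
  exact hfin.hasMFDerivWithinAt

theorem flowRel_of_curve_Icc (hY : IsC1Field Y) {c : ℝ → M} {a b s t : ℝ} (hab : a < b)
    (hc : IsMIntegralCurveOn c Y (Icc a b)) (hs : s ∈ Icc a b) (ht : t ∈ Icc a b) :
    FlowRel Y (c s) (t - s) (c t) := by
  obtain ⟨e, a', b', ha, hb, he, hec⟩ := exists_extension_of_Icc hY hab hc
  rw [← hec hs, ← hec ht]
  exact flowRel_of_curve he ⟨ha.trans_le hs.1, hs.2.trans_lt hb⟩ ⟨ha.trans_le ht.1, ht.2.trans_lt hb⟩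

variable [T2Space M]

theorem FlowsTo.flowRel (hY : IsC1Field Y) {t : ℝ} {x y : M} (h : FlowsTo Y t x y) :
    FlowRel Y x t y := by
  obtain ⟨c, hc, rfl, rfl⟩ := h
  -- For `t = 0` the interval is a point and the given curve carries no information beyond its value
  -- there.
  rcases eq_or_ne t 0 with rfl | ht
  · have := (flowRegular_zero hY (c 0)).2.self_of_nhds.flowRel
    simp only at this
    rwa [flow_zero hY] at this
  · have h := flowRel_of_curve_Icc hY (s := 0) (t := t) (a := min 0 t) (b := max 0 t)
      (by rcases ht.lt_or_gt with h | h <;> simp [h]) hc left_mem_uIcc right_mem_uIcc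
    simpa using h

theorem flowRel_zero (hY : IsC1Field Y) (q : M) : FlowRel Y q 0 q := by
  have := (flowRegular_zero hY q).2.self_of_nhds.flowRel
  simp only at this
  rwa [flow_zero hY] at this

theorem flowDef_zero (hY : IsC1Field Y) (q : M) : FlowDef Y q 0 := ⟨_, flowRel_zero hY q⟩

end

/-! ### Invariance of a commuting vector field under the flow -/

/-- The derivative of the time `r` map of the flow at `q`. The tangent spaces are identified with
`E3`, as they are by definition, so that base points can be rewritten. -/
def dflow (Y : ∀ x : M, TangentSpace (𝓡 3) x) (q : M) (r : ℝ) : E3 →L[ℝ] E3 :=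
  mfderiv (𝓡 3) (𝓡 3) (fun z => flow Y z r) q

variable [IsManifold (𝓡 3) ∞ M] [T2Space M]

theorem FlowDef.hasMFDerivAt_left (hY : IsC1Field Y) {p : M} {r : ℝ} (h : FlowDef Y p r) :
    HasMFDerivAt (𝓡 3) (𝓡 3) (fun z => flow Y z r) p (dflow Y p r) :=
  ((h.contMDiffAt hY).mdifferentiableAt one_ne_zero).hasMFDerivAt

theorem dflow_zero (hY : IsC1Field Y) (q : M) : dflow Y q 0 = ContinuousLinearMap.id ℝ E3 := by
  have h : (fun z => flow Y z 0) = (id : M → M) := funext fun z => flow_zero hY z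
  have h1 : HasMFDerivAt (𝓡 3) (𝓡 3) (fun z => flow Y z 0) q
      (ContinuousLinearMap.id ℝ (TangentSpace (𝓡 3) q)) := by
    rw [h]; exact hasMFDerivAt_id q
  exact hasMFDerivAt_unique ((flowDef_zero hY q).hasMFDerivAt_left hY) h1

theorem dflow_add (hY : IsC1Field Y) {q : M} {r s : ℝ} (h : FlowDef Y q r)
    (h' : FlowDef Y (flow Y q r) s) :
    dflow Y q (r + s) = (dflow Y (flow Y q r) s).comp (dflow Y q r) := by
  have h1 : HasMFDerivAt (𝓡 3) (𝓡 3) (fun z => flow Y (flow Y z r) s) q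
      ((dflow Y (flow Y q r) s).comp (dflow Y q r)) :=
    HasMFDerivAt.comp (g := fun z => flow Y z s) q (h'.hasMFDerivAt_left hY)
      (h.hasMFDerivAt_left hY)
  have h2 : (fun z => flow Y z (r + s)) =ᶠ[𝓝 q] fun z => flow Y (flow Y z r) s := by
    filter_upwards [h.eventually_left hY,
      (h.contMDiffAt hY).continuousAt.eventually (h'.eventually_left hY)] with z hz hz'
    exact flow_add hY hz hz'
  exact hasMFDerivAt_unique ((h.add hY h').hasMFDerivAt_left hY) (h1.congr_of_eventuallyEq h2)

theorem dflow_neg_apply (hY : IsC1Field Y) {q : M} {r : ℝ} (h : FlowDef Y q r) (v : E3) :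
    dflow Y (flow Y q r) (-r) (dflow Y q r v) = v := by
  have h1 := dflow_add hY h h.neg
  rw [add_neg_cancel, dflow_zero hY] at h1
  exact (DFunLike.congr_fun h1 v).symm

theorem dflow_injective (hY : IsC1Field Y) {q : M} {r : ℝ} (h : FlowDef Y q r) :
    Function.Injective (dflow Y q r) :=
  Function.LeftInverse.injective (dflow_neg_apply hY h)

/-- The local flows of `X` and `Y` commute. -/
def FlowsCommute (X Y : ∀ x : M, TangentSpace (𝓡 3) x) : Prop :=
  ∀ x : M, ∃ ε > 0, ∀ s ∈ Icc (-ε) ε, ∀ t ∈ Icc (-ε) ε, ∃ y z w : M,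
    FlowRel Y x s y ∧ FlowRel X y t w ∧ FlowRel X x t z ∧ FlowRel Y z s w

theorem FieldsCommute.flowsCommute (hX : IsC1Field X) (hY : IsC1Field Y)
    (h : FieldsCommute X Y) : FlowsCommute X Y := by
  intro x
  obtain ⟨ε, hε, hx⟩ := h x
  refine ⟨ε, hε, fun s hs t ht => ?_⟩
  obtain ⟨y, z, w, h1, h2, h3, h4⟩ := hx s hs t ht
  exact ⟨y, z, w, h1.flowRel hY, h2.flowRel hX, h3.flowRel hX, h4.flowRel hY⟩

/-- With this, the invariance of commuting fields also yields the invariance of `Y` under its own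
flow. -/
theorem flowsCommute_self (hY : IsC1Field Y) : FlowsCommute Y Y := by
  intro x
  have h : ∀ᶠ s in 𝓝 (0 : ℝ), FlowDef Y x s :=
    ((continuous_const.prodMk continuous_id).tendsto' (0 : ℝ) (x, (0 : ℝ)) rfl).eventually
      (flowRegular_zero hY x).2
  obtain ⟨ε, hε, hd⟩ := Metric.eventually_nhds_iff_ball.1 h
  have hd' : ∀ s : ℝ, |s| < ε → FlowRel Y x s (flow Y x s) := fun s hs =>
    (hd s (by simpa using hs)).flowRel
  -- With `s` and `t` at most `ε / 3` in absolute value, `s + t` also stays in the interval where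
  -- the orbit is known to exist.
  refine ⟨ε / 3, by positivity, fun s hs t ht => ?_⟩
  have hs' := abs_le.2 hs
  have ht' := abs_le.2 ht
  have hst : |s + t| < ε := (abs_add_le s t).trans_lt (by linarith)
  refine ⟨_, _, flow Y x (s + t), hd' s (by linarith), ?_, hd' t (by linarith), ?_⟩
  · have := (hd' s (by linarith)).symm.add hY (hd' (s + t) hst)
    rwa [neg_add_cancel_left] at this
  · have := (hd' t (by linarith)).symm.add hY (hd' (s + t) hst)
    rwa [add_comm s t, neg_add_cancel_left, add_comm t s] at this

/-- Differentiate the identity `Y_s(X_t(q)) = X_t(Y_s(q))` at `t = 0`, in charts at `q` and at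
`Y_s(q)`. -/
theorem FlowsCommute.exists_invariant (hX : IsC1Field X) (hY : IsC1Field Y)
    (h : FlowsCommute X Y) (q : M) :
    ∃ ε > 0, ∀ s ∈ Icc (-ε) ε, FlowDef Y q s ∧ dflow Y q s (vec X q) = vec X (flow Y q s) := by
  obtain ⟨ε, hε, hq⟩ := h q
  refine ⟨ε, hε, fun s hs => ?_⟩
  have h0 : (0 : ℝ) ∈ Icc (-ε) ε := ⟨by linarith, hε.le⟩
  have hd : FlowDef Y q s := by
    obtain ⟨y, z, w, h1, -⟩ := hq s hs 0 h0
    exact ⟨y, h1⟩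
  refine ⟨hd, ?_⟩
  set q' := flow Y q s
  have hcomm : ∀ᶠ t in 𝓝 (0 : ℝ), flow Y (flow X q t) s = flow X q' t := by
    filter_upwards [Icc_mem_nhds (by linarith : -ε < 0) hε] with t ht
    obtain ⟨y, z, w, h1, h2, h3, h4⟩ := hq s hs t ht
    rw [h3.flow_eq hX, h4.flow_eq hY]
    have : q' = y := h1.flow_eq hY
    rw [this, h2.flow_eq hX]
  have hx : HasDerivAt (fun t => extChartAt (𝓡 3) q (flow X q t)) (dchart q q (vec X q)) 0 := by
    have := hasDerivAt_extChartAt_comp (p := q) (by rw [flow_zero hX]; exact mem_extChartAt_source q)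
      ((flowDef_zero hX q).hasMFDerivAt hX)
    rw [flow_zero hX] at this
    exact this
  have hx' : HasDerivAt (fun t => extChartAt (𝓡 3) q' (flow X q' t)) (dchart q' q' (vec X q')) 0 := by
    have := hasDerivAt_extChartAt_comp (p := q')
      (by rw [flow_zero hX]; exact mem_extChartAt_source q')
      ((flowDef_zero hX q').hasMFDerivAt hX)
    rw [flow_zero hX] at this
    exact this
  have hG := contDiffAt_mapInChart (mem_extChartAt_source q) (mem_extChartAt_source q')
    (hd.contMDiffAt hY)
  have hG' : HasFDerivAt (mapInChart (fun z => flow Y z s) q q')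
      (fderiv ℝ (mapInChart (fun z => flow Y z s) q q') (extChartAt (𝓡 3) q q))
      (extChartAt (𝓡 3) q (flow X q 0)) := by
    rw [flow_zero hX]
    exact (hG.differentiableAt one_ne_zero).hasFDerivAt
  have h1 := hG'.comp_hasDerivAt (0 : ℝ) hx
  rw [fderiv_mapInChart (mem_extChartAt_source q) (mem_extChartAt_source q')
    ((hd.contMDiffAt hY).mdifferentiableAt one_ne_zero)] at h1
  have h2 : (mapInChart (fun z => flow Y z s) q q' ∘ fun t => extChartAt (𝓡 3) q (flow X q t))
      =ᶠ[𝓝 0] fun t => extChartAt (𝓡 3) q' (flow X q' t) := by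
    have hc : ContinuousAt (flow X q) 0 := ((flowDef_zero hX q).hasMFDerivAt hX).continuousAt
    have hsrc : ∀ᶠ t in 𝓝 (0 : ℝ), flow X q t ∈ (extChartAt (𝓡 3) q).source :=
      hc.eventually ((isOpen_extChartAt_source q).mem_nhds (by
        rw [flow_zero hX]; exact mem_extChartAt_source q))
    filter_upwards [hcomm, hsrc] with t ht ht'
    rw [Function.comp_apply, mapInChart_extChartAt _ ht', ht]
  have h3 := h1.unique (hx'.congr_of_eventuallyEq h2)
  exact dchart_injective (mem_extChartAt_source q') h3

/-- Commutation is given for small times only. Invariance of `X` between two times of an orbit holds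
for close times and is transitive and symmetric, so connectedness of the time interval gives it for
all times. -/
theorem FlowsCommute.dflow_apply (hX : IsC1Field X) (hY : IsC1Field Y)
    (h : FlowsCommute X Y) {q : M} {r : ℝ} (hd : FlowDef Y q r) :
    dflow Y q r (vec X q) = vec X (flow Y q r) := by
  obtain ⟨a, b, h0, hr, hc, hab⟩ := hd.exists_curve hY
  have hrel : ∀ s ∈ Ioo a b, ∀ t ∈ Ioo a b, FlowRel Y (flow Y q s) (t - s) (flow Y q t) :=
    fun s hs t ht => flowRel_of_curve hc hs ht
  have key : dflow Y (flow Y q 0) (r - 0) (vec X (flow Y q 0)) = vec X (flow Y q r) := by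
    refine isPreconnected_Ioo.induction₂ (s := Ioo a b)
      (fun s t => dflow Y (flow Y q s) (t - s) (vec X (flow Y q s)) = vec X (flow Y q t)) ?_ ?_ ?_ h0 hr
    · intro s hs
      rw [nhdsWithin_eq_nhds.2 (Ioo_mem_nhds hs.1 hs.2)]
      obtain ⟨ε, hε, he⟩ := h.exists_invariant hX hY (flow Y q s)
      filter_upwards [Icc_mem_nhds (by linarith : s - ε < s) (by linarith : s < s + ε),
        Ioo_mem_nhds hs.1 hs.2] with t ht ht'
      have h1 := (he (t - s) ⟨by linarith [ht.1], by linarith [ht.2]⟩).2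
      rw [(hrel s hs t ht').flow_eq hY] at h1
      exact h1
    · intro s t u hs ht hu h1 h2
      have e1 := (hrel s hs t ht).flow_eq hY
      have h3 := dflow_add hY (q := flow Y q s) (r := t - s) (s := u - t) ⟨_, hrel s hs t ht⟩
        (by rw [e1]; exact ⟨_, hrel t ht u hu⟩)
      rw [e1, show t - s + (u - t) = u - s by ring] at h3
      have h4 := DFunLike.congr_fun h3 (vec X (flow Y q s))
      rw [h4]
      exact (congrArg _ h1).trans h2
    · intro s t hs ht h1
      have e1 := (hrel s hs t ht).flow_eq hY
      have h2 := dflow_neg_apply hY (q := flow Y q s) (r := t - s) ⟨_, hrel s hs t ht⟩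
        (vec X (flow Y q s))
      rw [e1, neg_sub] at h2
      rw [← h2]
      exact (congrArg _ h1).symm
  rw [flow_zero hY, sub_zero] at key
  exact key

end

section

variable {E F : Type*} [NormedAddCommGroup E] [NormedSpace ℝ E] [NormedAddCommGroup F]
  [NormedSpace ℝ F]

/-! ### Points that converge under iteration -/

/-- If `R` contracts `|H|`, moves points by at most a multiple of `|H|` and expands `g`, which is
bounded by a multiple of `|H|`, more strongly than it contracts `|H|`, then `g = 0`. -/
theorem eventually_eq_zero_of_contraction {E : Type*} [NormedAddCommGroup E] {R : E → E} {g H : E → ℝ} {P : E → Prop} {a : E}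
    {l k C C' : ℝ} (hl : 0 < l) (hl1 : l < 1) (hlk : l < k) (hH : ContinuousAt H a) (hHa : H a = 0)
    (h₁ : ∀ᶠ y in 𝓝 a, P y → P (R y) ∧ k * |g y| ≤ |g (R y)|)
    (h₂ : ∀ᶠ y in 𝓝 a, |H (R y)| ≤ l * |H y|)
    (h₃ : ∀ᶠ y in 𝓝 a, ‖R y - y‖ ≤ C * |H y|)
    (h₄ : ∀ᶠ y in 𝓝 a, |g y| ≤ C' * |H y|) :
    ∀ᶠ y in 𝓝 a, P y → g y = 0 := by
  obtain ⟨ρ, hρ, hb⟩ := Metric.eventually_nhds_iff_ball.1 (h₁.and (h₂.and (h₃.and h₄)))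
  have hl' : 0 < 1 - l := by linarith
  wlog hC : 0 < C generalizing C
  · refine this (C := 1) ?_ ?_ one_pos
    · filter_upwards [h₃] with y hy
      exact hy.trans (mul_le_mul_of_nonneg_right (by linarith [not_lt.1 hC]) (abs_nonneg _))
    · exact fun y hy => ⟨(hb y hy).1, (hb y hy).2.1, (hb y hy).2.2.1.trans
        (mul_le_mul_of_nonneg_right (by linarith [not_lt.1 hC]) (abs_nonneg _)), (hb y hy).2.2.2⟩
  -- This quantity does not increase under `R`: one step moves the point by at most `C |H|`, and
  -- these displacements are dominated by a geometric series of sum `C |H| / (1 - l)`. Keeping it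
  -- below `ρ` confines all iterates to the ball.
  have hsmall : ∀ᶠ y in 𝓝 a, ‖y - a‖ + C / (1 - l) * |H y| < ρ := by
    have hc : ContinuousAt (fun y => ‖y - a‖ + C / (1 - l) * |H y|) a := by fun_prop
    refine hc.eventually_lt continuousAt_const ?_
    simp [hHa, hρ]
  filter_upwards [hsmall] with y hy hPy
  have hC' : 0 < C / (1 - l) := div_pos hC hl'
  have key : ∀ n : ℕ, P (R^[n] y) ∧ ‖R^[n] y - a‖ + C / (1 - l) * |H (R^[n] y)| < ρ ∧
      k ^ n * |g y| ≤ |g (R^[n] y)| ∧ |H (R^[n] y)| ≤ l ^ n * |H y| := by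
    intro n
    induction n with
    | zero => simpa using ⟨hPy, hy⟩
    | succ n ih =>
      obtain ⟨i1, i2, i3, i4⟩ := ih
      rw [Function.iterate_succ_apply']
      set z := R^[n] y
      have hz : z ∈ Metric.ball a ρ := by
        rw [mem_ball_iff_norm]
        nlinarith [mul_nonneg hC'.le (abs_nonneg (H z))]
      obtain ⟨b1, b2, b3, b4⟩ := hb z hz
      refine ⟨(b1 i1).1, ?_, ?_, ?_⟩
      · have e1 : ‖R z - a‖ ≤ ‖z - a‖ + C * |H z| := by
          have : R z - a = (z - a) + (R z - z) := by abel
          rw [this]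
          exact (norm_add_le _ _).trans (by linarith)
        have e2 : C / (1 - l) * |H (R z)| ≤ C / (1 - l) * (l * |H z|) :=
          mul_le_mul_of_nonneg_left b2 hC'.le
        have e3 : C * |H z| + C / (1 - l) * (l * |H z|) = C / (1 - l) * |H z| := by
          field_simp; ring
        linarith
      · calc k ^ (n + 1) * |g y| = k * (k ^ n * |g y|) := by ring
          _ ≤ k * |g z| := mul_le_mul_of_nonneg_left i3 (hl.trans hlk).le
          _ ≤ _ := (b1 i1).2
      · calc |H (R z)| ≤ l * |H z| := b2
          _ ≤ l * (l ^ n * |H y|) := mul_le_mul_of_nonneg_left i4 hl.le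
          _ = _ := by ring
  by_contra hg
  have hg' : 0 < |g y| := abs_pos.2 hg
  have hk : 0 < k := hl.trans hlk
  have hq : Tendsto (fun n : ℕ => |C'| * |H y| * (l / k) ^ n) atTop (𝓝 (|C'| * |H y| * 0)) :=
    (tendsto_pow_atTop_nhds_zero_of_lt_one (by positivity)
      ((div_lt_one hk).2 hlk)).const_mul _
  rw [mul_zero] at hq
  -- The iterates give `k ^ n |g y| ≤ |C'| l ^ n |H y|` for every `n`, which is impossible for large
  -- `n` if `g y ≠ 0`, since `l < k`.
  obtain ⟨n, hn⟩ := (hq.eventually (gt_mem_nhds hg')).exists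
  obtain ⟨i1, i2, i3, i4⟩ := key n
  have hz : R^[n] y ∈ Metric.ball a ρ := by
    rw [mem_ball_iff_norm]
    nlinarith [mul_nonneg hC'.le (abs_nonneg (H (R^[n] y)))]
  have b4 := (hb _ hz).2.2.2
  have hkn : 0 < k ^ n := pow_pos hk n
  have : k ^ n * |g y| ≤ |C'| * (l ^ n * |H y|) :=
    i3.trans (b4.trans ((mul_le_mul_of_nonneg_right (le_abs_self C') (abs_nonneg _)).trans
      (mul_le_mul_of_nonneg_left i4 (abs_nonneg _))))
  rw [div_pow, mul_div_assoc', div_lt_iff₀ hkn] at hn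
  nlinarith

/-! ### Fields that are multiples of a given direction -/

/-- Near `a`, the field `V` is not a nontrivial combination of `Y` and of a vector close to `e`,
unless it is a multiple of `Y`. -/
def Avoid (V Y : E → E) (a e : E) : Prop :=
  ∀ᶠ z in 𝓝 a ×ˢ 𝓝 e, ∀ m k : ℝ, V z.1 = m • z.2 + k • Y z.1 → m = 0

/-- The flow carries `e₁` only to a combination `k e₁ + l Y`; since `Avoid` works modulo `Y` and up
to scale, this does no harm. -/
theorem Avoid.combination {V Y : E → E} {a e : E} (h : Avoid V Y a e) (hY : ContinuousAt Y a)
    {k : ℝ} (hk : k ≠ 0) (l : ℝ) : Avoid V Y a (k • e + l • Y a) := by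
  have ht : Tendsto (fun z : E × E => (z.1, k⁻¹ • (z.2 - l • Y z.1)))
      (𝓝 a ×ˢ 𝓝 (k • e + l • Y a)) (𝓝 a ×ˢ 𝓝 e) := by
    refine tendsto_fst.prodMk ?_
    have h1 : Tendsto (fun z : E × E => k⁻¹ • (z.2 - l • Y z.1)) (𝓝 a ×ˢ 𝓝 (k • e + l • Y a))
        (𝓝 (k⁻¹ • (k • e + l • Y a - l • Y a))) :=
      (tendsto_snd.sub ((hY.tendsto.comp tendsto_fst).const_smul l)).const_smul _
    rwa [add_sub_cancel_right, inv_smul_smul₀ hk] at h1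
  refine (ht.eventually h).mono fun z hz m c hV => ?_
  have := hz (m * k) (m * l + c) (by
    rw [hV, smul_smul, mul_assoc, mul_inv_cancel₀ hk, mul_one, smul_sub, smul_smul, add_smul]
    abel)
  exact (mul_eq_zero.1 this).resolve_right hk

/-- `DG` turns a relation `V' = m v + k Y'` near `a'` into the same relation between the images,
with the same coefficient `m`. -/
theorem Avoid.pullback {V Y V' Y' : E → E} {G : E → E} {a' e' : E} (hG : ContDiffAt ℝ 1 G a')
    (hV : ∀ᶠ y in 𝓝 a', V (G y) = fderiv ℝ G y (V' y))
    (hY : ∀ᶠ y in 𝓝 a', Y (G y) = fderiv ℝ G y (Y' y))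
    (h : Avoid V Y (G a') (fderiv ℝ G a' e')) : Avoid V' Y' a' e' := by
  have hc : ContinuousAt (fderiv ℝ G) a' := hG.continuousAt_fderiv one_ne_zero
  have ht : Tendsto (fun z : E × E => (G z.1, fderiv ℝ G z.1 z.2)) (𝓝 a' ×ˢ 𝓝 e')
      (𝓝 (G a') ×ˢ 𝓝 (fderiv ℝ G a' e')) := by
    refine (hG.continuousAt.tendsto.comp tendsto_fst).prodMk ?_
    exact ((isBoundedBilinearMap_apply (𝕜 := ℝ) (E := E) (F := E)).continuous.tendsto
      (fderiv ℝ G a', e')).comp ((hc.tendsto.comp tendsto_fst).prodMk_nhds tendsto_snd)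
  filter_upwards [ht.eventually h, tendsto_fst.eventually hV, tendsto_fst.eventually hY] with z h1 h2 h3 m k hm
  refine h1 m k ?_
  simp only [h2, h3, hm, map_add, map_smul]

/-! ### Tubular coordinates around a hypersurface -/

/-- Near `a`, each `y` is `pr y + H y • e` with `pr y` in the hypersurface `C ⊆ {H = 0}`. -/
structure IsTube (C : Set E) (a e : E) (om : E →L[ℝ] ℝ) (H : E → ℝ) (pr : E → E) : Prop where
  strict : HasStrictFDerivAt H om a
  value : H a = 0
  tendsto : Tendsto pr (𝓝 a) (𝓝 a)
  decomp : ∀ᶠ y in 𝓝 a, y = pr y + H y • e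
  mem : ∀ᶠ y in 𝓝 a, pr y ∈ C
  zero : ∀ᶠ y in 𝓝 a, y ∈ C → H y = 0
  apply_eq_one : om e = 1

namespace IsTube

variable {C : Set E} {a e : E} {om : E →L[ℝ] ℝ} {H : E → ℝ} {pr : E → E}

/-- Strict differentiability at `a` applied to the pair `(y, pr y)`, whose difference is exactly `H
y • e`. This first order expansion based on the hypersurface gives all the estimates in terms of
`H`. -/
theorem isLittleO (h : IsTube C a e om H pr) {f : E → F} {f' : E →L[ℝ] F}
    (hf : HasStrictFDerivAt f f' a) :
    (fun y => f y - f (pr y) - H y • f' e) =o[𝓝 a] H := by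
  have ht : Tendsto (fun y => (y, pr y)) (𝓝 a) (𝓝 (a, a)) := by
    rw [nhds_prod_eq]; exact tendsto_id.prodMk h.tendsto
  have h1 := hf.isLittleO.comp_tendsto ht
  have e1 : ∀ᶠ y in 𝓝 a, y - pr y = H y • e := by
    filter_upwards [h.decomp] with y hy
    rw [sub_eq_iff_eq_add, add_comm]; exact hy
  have h2 : (fun y => f y - f (pr y) - H y • f' e) =o[𝓝 a] fun y => H y • e := by
    refine h1.congr' ?_ e1
    filter_upwards [e1] with y hy
    simp only [Function.comp_apply, hy, map_smul]
  refine h2.trans_isBigO ?_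
  refine Asymptotics.IsBigO.of_bound ‖e‖ (Eventually.of_forall fun y => ?_)
  rw [norm_smul, mul_comm]

theorem eventually_pr (h : IsTube C a e om H pr) {p : E → Prop}
    (hp : ∀ᶠ y in 𝓝 a, y ∈ C → p y) : ∀ᶠ y in 𝓝 a, p (pr y) := by
  filter_upwards [h.tendsto.eventually hp, h.mem] with y h1 h2 using h1 h2

/-- Near `a` a field `V` that is a multiple of `Y` on `C` is a multiple of a field close to its
derivative in the transverse direction, modulo `Y`. -/
theorem exists_mod_field (h : IsTube C a e om H pr) {V Y : E → E} {B : E →L[ℝ] E}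
    (hV : HasStrictFDerivAt V B a) (hVa : V a = 0) {Y' : E →L[ℝ] E} (hY : HasStrictFDerivAt Y Y' a)
    (hYa : Y a ≠ 0) (hC : ∀ᶠ y in 𝓝 a, y ∈ C → ∃ c : ℝ, V y = c • Y y) :
    ∃ W : E → E, Tendsto W (𝓝 a) (𝓝 (B e)) ∧
      ∀ᶠ y in 𝓝 a, ∃ c : ℝ, V y = H y • W y + c • Y y := by
  classical
  have hC' := h.eventually_pr hC
  choose! c hc using fun y (hy : ∃ c : ℝ, V (pr y) = c • Y (pr y)) => hy
  have hYpr : Tendsto (fun y => Y (pr y)) (𝓝 a) (𝓝 (Y a)) :=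
    hY.hasFDerivAt.continuousAt.tendsto.comp h.tendsto
  have hVpr : Tendsto (fun y => V (pr y)) (𝓝 a) (𝓝 0) := by
    have := hV.hasFDerivAt.continuousAt.tendsto.comp h.tendsto
    rwa [hVa] at this
  -- The multiplier is the quotient of `V`, which tends to `0`, by `Y`, which does not.
  have hc0 : Tendsto c (𝓝 a) (𝓝 0) := by
    rw [tendsto_zero_iff_abs_tendsto_zero]
    have h1 : Tendsto (fun y => ‖V (pr y)‖ / ‖Y (pr y)‖) (𝓝 a) (𝓝 (‖(0 : E)‖ / ‖Y a‖)) :=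
      hVpr.norm.div hYpr.norm (norm_ne_zero_iff.2 hYa)
    rw [norm_zero, zero_div] at h1
    refine h1.congr' ?_
    filter_upwards [hC', hYpr.eventually_ne hYa] with y hy hy'
    rw [Function.comp_apply, hc y hy, norm_smul, mul_div_cancel_right₀ _ (norm_ne_zero_iff.2 hy'),
      Real.norm_eq_abs]
  -- the remainder
  have h1 := h.isLittleO hV
  have h2 : (fun y => Y y - Y (pr y)) =O[𝓝 a] H := by
    have h3 := (h.isLittleO hY).isBigO
    have h4 : (fun y => H y • Y' e) =O[𝓝 a] H :=
      Asymptotics.IsBigO.of_bound ‖Y' e‖ (Eventually.of_forall fun y => by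
        rw [norm_smul, mul_comm])
    simpa using h3.add h4
  have h3 : (fun y => c y • (Y y - Y (pr y))) =o[𝓝 a] H := by
    have h5 : c =o[𝓝 a] fun _ => (1 : ℝ) := (Asymptotics.isLittleO_one_iff ℝ).2 hc0
    simpa using h5.smul_isBigO h2
  have h4 := h1.sub h3
  set ρ : E → E := fun y => V y - V (pr y) - H y • B e - c y • (Y y - Y (pr y)) with hρ
  refine ⟨fun y => B e + (H y)⁻¹ • ρ y, ?_, ?_⟩
  · have h5 : Tendsto (fun y => (H y)⁻¹ • ρ y) (𝓝 a) (𝓝 0) := by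
      rw [tendsto_zero_iff_norm_tendsto_zero]
      refine (h4.norm_norm.tendsto_div_nhds_zero).congr fun y => ?_
      rw [norm_smul, norm_inv, div_eq_inv_mul]
    simpa using h5.const_add (B e)
  · have h6 := h4.bound one_pos
    filter_upwards [h6, hC'] with y hy hy'
    refine ⟨c y, ?_⟩
    have e1 : H y • (B e + (H y)⁻¹ • ρ y) = H y • B e + ρ y := by
      rcases eq_or_ne (H y) 0 with h0 | h0
      · have : ρ y = 0 := by
          rw [h0, norm_zero, mul_zero] at hy
          exact norm_le_zero_iff.1 hy
        rw [h0, this]; simp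
      · rw [smul_add, smul_inv_smul₀ h0]
    rw [e1, hρ]
    simp only [hc y hy', smul_sub]
    abel

end IsTube

end

section

variable {E : Type*} [NormedAddCommGroup E] [NormedSpace ℝ E]

/-- The derivative of `c y (V y)` at a zero of `V`, when `c` is merely continuous there. -/
theorem hasFDerivAt_clm_apply_of_eq_zero {F : Type*} [NormedAddCommGroup F] [NormedSpace ℝ F]
    {V : E → E} {B : E →L[ℝ] E} {a : E} {c : E → E →L[ℝ] F} (hB : HasFDerivAt V B a) (hV : V a = 0)
    (hc : ContinuousAt c a) : HasFDerivAt (fun y => c y (V y)) ((c a).comp B) a := by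
  have h1 : HasFDerivAt (fun y => c a (V y)) ((c a).comp B) a := (c a).hasFDerivAt.comp a hB
  have h2 : (fun y => (c y - c a) (V y)) =o[𝓝 a] fun y => y - a := by
    have h3 : (fun y => c y - c a) =o[𝓝 a] fun _ => (1 : ℝ) := by
      rw [Asymptotics.isLittleO_one_iff]
      have := hc.tendsto.sub_const (c a)
      rwa [sub_self] at this
    have h4 : V =O[𝓝 a] fun y => y - a := by
      have := hB.isBigO_sub
      simpa [hV] using this
    have h5 := h3.norm_left.mul_isBigO h4.norm_norm
    simp only [one_mul] at h5
    exact (Asymptotics.isBigO_of_le _ fun y => by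
      rw [norm_mul, norm_norm, norm_norm]; exact (c y - c a).le_opNorm _).trans_isLittleO
        (h5.trans_isBigO (Asymptotics.isBigO_refl _ _).norm_left)
  have h6 : HasFDerivAt (fun y => (c y - c a) (V y)) (0 : E →L[ℝ] F) a := by
    refine HasFDerivAt.of_isLittleO ?_
    simpa [hV] using h2
  have := h1.add h6
  rw [add_zero] at this
  refine this.congr_of_eventuallyEq (Eventually.of_forall fun y => ?_)
  simp

/-! ### A commuting field near a surface of collinearity -/

/-- The local situation near a point `a` of the surface `C` on which `V` and `Y` are collinear:
`e₁` is tangent to `C` and `e₂` is transverse to it, `e₁` and `e₂` are tangent to the fibers of a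
submersion of differential `L`, and `Y` is transverse to these fibers. -/
structure IsCollinearModel (C : Set E) (V Y : E → E) (L : E → E →L[ℝ] ℝ) (a e₁ e₂ : E)
    (eta om : E →L[ℝ] ℝ) (H : E → ℝ) (pr : E → E) (B Y' : E →L[ℝ] E) : Prop where
  tube : IsTube C a e₂ om H pr
  strict_V : HasStrictFDerivAt V B a
  strict_Y : HasStrictFDerivAt Y Y' a
  V_eq_zero : V a = 0
  collinear : ∀ᶠ y in 𝓝 a, y ∈ C → ∃ c : ℝ, V y = c • Y y
  continuousAt_L : ContinuousAt L a
  L_Y : L a (Y a) ≠ 0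
  L_e₁ : L a e₁ = 0
  L_e₂ : L a e₂ = 0
  om_e₁ : om e₁ = 0
  om_Y : om (Y a) = 0
  eta_e₁ : eta e₁ = 1
  eta_e₂ : eta e₂ = 0
  eta_Y : eta (Y a) = 0
  frame : ∀ v, v = eta v • e₁ + om v • e₂ + (L a v / L a (Y a)) • Y a

/-- `R` is a map fixing the points of `C`, preserving the fibers of the submersion and
preserving `V` and `Y` up to multiples of `Y`. -/
structure IsLocalReturn (C : Set E) (V Y : E → E) (L : E → E →L[ℝ] ℝ) (a e₁ e₂ : E)
    (R : E → E) (l b : ℝ) : Prop where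
  contDiffAt : ContDiffAt ℝ 1 R a
  map_self : R a = a
  fix : ∀ᶠ y in 𝓝 a, y ∈ C → R y = y
  map_V : ∀ᶠ y in 𝓝 a, ∃ c : ℝ, V (R y) = fderiv ℝ R y (V y) + c • Y (R y)
  map_Y : ∀ᶠ y in 𝓝 a, ∃ c : ℝ, fderiv ℝ R y (Y y) = c • Y (R y)
  map_L : ∀ᶠ y in 𝓝 a, ∀ v, L (R y) (fderiv ℝ R y v) = L y v
  apply_e₁ : fderiv ℝ R a e₁ = e₁
  apply_e₂ : fderiv ℝ R a e₂ = b • e₁ + l • e₂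
  apply_Y : fderiv ℝ R a (Y a) = Y a

variable {C : Set E} {V Y : E → E} {L : E → E →L[ℝ] ℝ} {a e₁ e₂ : E} {eta om : E →L[ℝ] ℝ}
  {H : E → ℝ} {pr : E → E} {B Y' : E →L[ℝ] E} {R : E → E} {l b : ℝ}

/-- The projection of `v` on the kernel of `L y` along `Y y`. -/
def projAlong (Y : E → E) (L : E → E →L[ℝ] ℝ) (y v : E) : E := v - (L y v / L y (Y y)) • Y y

/-- The projection kills `Y`, so relations that hold modulo `Y` become exact equalities in the
kernel of `L y`. -/
theorem projAlong_combination {y v w : E} {m k : ℝ} (hy : L y (Y y) ≠ 0)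
    (h : w = m • v + k • Y y) : projAlong Y L y w = m • projAlong Y L y v := by
  simp only [projAlong, h, map_add, map_smul, smul_eq_mul, smul_sub, smul_smul, add_div,
    mul_div_cancel_right₀ _ hy, add_smul, mul_div_assoc]
  abel

/-! ### Estimates for the field near the surface of collinearity. -/

namespace IsCollinearModel

theorem L_Y_ne (h : IsCollinearModel C V Y L a e₁ e₂ eta om H pr B Y') :
    ∀ᶠ y in 𝓝 a, L y (Y y) ≠ 0 :=
  (h.continuousAt_L.clm_apply h.strict_Y.hasFDerivAt.continuousAt).eventually_ne h.L_Y

theorem Y_ne_zero (h : IsCollinearModel C V Y L a e₁ e₂ eta om H pr B Y') : Y a ≠ 0 :=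
  fun h0 => h.L_Y (by rw [h0, map_zero])

/-- Near `a`, `V = H W + c Y` with `W` close to `B e₂`. Independence is an open condition, so `W`,
the vectors close to `v`, and `Y` stay independent, and the coefficient of such a vector in `V`
vanishes. -/
theorem avoid_of_linearIndependent [FiniteDimensional ℝ E]
    (h : IsCollinearModel C V Y L a e₁ e₂ eta om H pr B Y') {v : E}
    (hv : LinearIndependent ℝ ![B e₂, v, Y a]) : Avoid V Y a v := by
  obtain ⟨W, hW, hVW⟩ := h.tube.exists_mod_field h.strict_V h.V_eq_zero h.strict_Y h.Y_ne_zero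
    h.collinear
  have ht : Tendsto (fun z : E × E => ![W z.1, z.2, Y z.1]) (𝓝 a ×ˢ 𝓝 v)
      (𝓝 ![B e₂, v, Y a]) := by
    rw [tendsto_pi_nhds]
    intro i
    fin_cases i
    · exact hW.comp tendsto_fst
    · exact tendsto_snd
    · exact h.strict_Y.hasFDerivAt.continuousAt.tendsto.comp tendsto_fst
  filter_upwards [ht.eventually (isOpen_setOfPred_linearIndependent.mem_nhds hv),
    tendsto_fst.eventually hVW] with z hz hz' m k hm
  obtain ⟨c, hc⟩ := hz'
  have hlin := Fintype.linearIndependent_iff.1 hz ![H z.1, -m, c - k] (by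
    rw [Fin.sum_univ_three]
    change H z.1 • W z.1 + -m • z.2 + (c - k) • Y z.1 = 0
    rw [neg_smul, sub_smul]
    have : H z.1 • W z.1 + c • Y z.1 = m • z.2 + k • Y z.1 := by rw [← hc, hm]
    rw [← sub_eq_zero.2 this]
    abel) 1
  simpa using hlin

theorem tendsto_projAlong (h : IsCollinearModel C V Y L a e₁ e₂ eta om H pr B Y')
    {α : Type*} {f : Filter α} {y w : α → E} {v : E} (hy : Tendsto y f (𝓝 a))
    (hw : Tendsto w f (𝓝 v)) :
    Tendsto (fun t => projAlong Y L (y t) (w t)) f (𝓝 (projAlong Y L a v)) := by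
  have happ := (isBoundedBilinearMap_apply (𝕜 := ℝ) (E := E) (F := ℝ)).continuous
  have hL : Tendsto (fun t => L (y t)) f (𝓝 (L a)) := h.continuousAt_L.tendsto.comp hy
  have hY : Tendsto (fun t => Y (y t)) f (𝓝 (Y a)) :=
    h.strict_Y.hasFDerivAt.continuousAt.tendsto.comp hy
  have h1 : Tendsto (fun t => L (y t) (w t)) f (𝓝 (L a v)) :=
    (happ.tendsto (L a, v)).comp (hL.prodMk_nhds hw)
  have h2 : Tendsto (fun t => L (y t) (Y (y t))) f (𝓝 (L a (Y a))) :=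
    (happ.tendsto (L a, Y a)).comp (hL.prodMk_nhds hY)
  exact hw.sub ((h1.div h2 h.L_Y).smul hY)

/-- Modulo `Y` the field is `H` times a field with a limit at `a`. -/
theorem exists_bound (h : IsCollinearModel C V Y L a e₁ e₂ eta om H pr B Y') :
    ∃ K : ℝ, ∀ᶠ y in 𝓝 a, ‖projAlong Y L y (V y)‖ ≤ K * |H y| := by
  obtain ⟨W, hW, hVW⟩ := h.tube.exists_mod_field h.strict_V h.V_eq_zero h.strict_Y h.Y_ne_zero
    h.collinear
  have h1 := (h.tendsto_projAlong tendsto_id hW).norm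
  refine ⟨‖projAlong Y L a (B e₂)‖ + 1, ?_⟩
  filter_upwards [h1.eventually_lt_const (lt_add_one _), hVW, h.L_Y_ne] with y hy ⟨c, hc⟩ hy'
  rw [projAlong_combination hy' hc, norm_smul, Real.norm_eq_abs, mul_comm]
  exact mul_le_mul_of_nonneg_right hy.le (abs_nonneg _)

/-- `eta` and `om` are coordinates on the kernel of `L a`, but are used on the kernels of `L y`. For
`y` close to `a`, the `Y a` component of a vector of the latter has at most half its norm and is
absorbed in the left side. -/
theorem exists_coord_bound (h : IsCollinearModel C V Y L a e₁ e₂ eta om H pr B Y') :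
    ∃ K > 0, ∀ᶠ y in 𝓝 a, ∀ v, L y v = 0 → ‖v‖ ≤ K * (|eta v| + |om v|) := by
  have hYpos : 0 < ‖Y a‖ := norm_pos_iff.2 h.Y_ne_zero
  have hLpos : 0 < |L a (Y a)| := abs_pos.2 h.L_Y
  have hev : ∀ᶠ y in 𝓝 a, ‖L a - L y‖ < |L a (Y a)| / (2 * ‖Y a‖) := by
    have hc : Tendsto (fun y => ‖L a - L y‖) (𝓝 a) (𝓝 ‖L a - L a‖) :=
      (tendsto_const_nhds.sub h.continuousAt_L).norm
    refine hc.eventually_lt_const ?_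
    rw [sub_self, norm_zero]
    positivity
  refine ⟨2 * (‖e₁‖ + ‖e₂‖ + 1), by positivity, ?_⟩
  filter_upwards [hev] with y hy v hv
  have h1 : |L a v| ≤ |L a (Y a)| / (2 * ‖Y a‖) * ‖v‖ := by
    have : L a v = (L a - L y) v := by simp [hv]
    rw [this]
    exact ((L a - L y).le_opNorm v).trans (mul_le_mul_of_nonneg_right hy.le (norm_nonneg _))
  have h2 : ‖(L a v / L a (Y a)) • Y a‖ ≤ ‖v‖ / 2 := by
    rw [norm_smul, Real.norm_eq_abs, abs_div]
    calc |L a v| / |L a (Y a)| * ‖Y a‖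
        ≤ (|L a (Y a)| / (2 * ‖Y a‖) * ‖v‖) / |L a (Y a)| * ‖Y a‖ := by gcongr
      _ = ‖v‖ / 2 := by field_simp
  have h3 : ‖v‖ ≤ |eta v| * ‖e₁‖ + |om v| * ‖e₂‖ + ‖v‖ / 2 := by
    conv_lhs => rw [h.frame v]
    refine (norm_add_le _ _).trans (add_le_add ((norm_add_le _ _).trans ?_) h2)
    rw [norm_smul, norm_smul, Real.norm_eq_abs, Real.norm_eq_abs]
  nlinarith [norm_nonneg e₁, norm_nonneg e₂, mul_nonneg (abs_nonneg (eta v)) (norm_nonneg e₂),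
    mul_nonneg (abs_nonneg (om v)) (norm_nonneg e₁), abs_nonneg (eta v), abs_nonneg (om v)]

end IsCollinearModel

/-! ### Dynamics of a local return map near the surface. -/

namespace IsLocalReturn

variable (hR : IsLocalReturn C V Y L a e₁ e₂ R l b)
  (h : IsCollinearModel C V Y L a e₁ e₂ eta om H pr B Y')

include hR in
theorem tendsto : Tendsto R (𝓝 a) (𝓝 a) := by
  have := hR.contDiffAt.continuousAt.tendsto
  rwa [hR.map_self] at this

include hR in
theorem strict : HasStrictFDerivAt R (fderiv ℝ R a) a :=
  hR.contDiffAt.hasStrictFDerivAt one_ne_zero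

include hR h

/-- `DR` preserves the kernels of `L` and maps `Y` to multiples of `Y`, so it commutes with the
projection, and the invariance of `V` modulo `Y` becomes exact. -/
theorem map_projAlong : ∀ᶠ y in 𝓝 a,
    projAlong Y L (R y) (V (R y)) = fderiv ℝ R y (projAlong Y L y (V y)) := by
  filter_upwards [hR.map_V, hR.map_Y, hR.map_L, h.L_Y_ne, hR.tendsto.eventually h.L_Y_ne]
    with y ⟨c, hc⟩ ⟨c', hc'⟩ hL hy hRy
  set N := projAlong Y L y (V y) with hN
  have h0 : L y N = 0 := by
    rw [hN, projAlong, map_sub, map_smul, smul_eq_mul, div_mul_cancel₀ _ hy, sub_self]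
  have h1 : V (R y) = (1 : ℝ) • fderiv ℝ R y N + (L y (V y) / L y (Y y) * c' + c) • Y (R y) := by
    rw [hc, hN, projAlong, map_sub, map_smul, hc', one_smul, smul_smul, add_smul]
    abel
  rw [projAlong_combination hRy h1, one_smul, projAlong, hL, h0, zero_div, zero_smul, sub_zero]

theorem om_apply (v : E) : om (fderiv ℝ R a v) = l * om v := by
  conv_lhs => rw [h.frame v]
  simp [hR.apply_e₁, hR.apply_e₂, hR.apply_Y, h.om_e₁, h.om_Y, h.tube.apply_eq_one, mul_comm]

theorem eta_apply (v : E) : eta (fderiv ℝ R a v) = eta v + b * om v := by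
  conv_lhs => rw [h.frame v]
  simp [hR.apply_e₁, hR.apply_e₂, hR.apply_Y, h.eta_e₁, h.eta_Y, h.eta_e₂, mul_comm]

/-- `H ∘ R` vanishes on the surface, which `R` fixes, and its derivative along `e₂` is `om (DR e₂) =
l`: so `l` is the transverse rate of `R`. -/
theorem H_comp_isLittleO : (fun y => H (R y) - l * H y) =o[𝓝 a] H := by
  have hs : HasStrictFDerivAt (fun y => H (R y)) (om.comp (fderiv ℝ R a)) a := by
    refine HasStrictFDerivAt.comp a ?_ hR.strict
    rw [hR.map_self]; exact h.tube.strict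
  refine (h.tube.isLittleO hs).congr' ?_ EventuallyEq.rfl
  filter_upwards [h.tube.eventually_pr (hR.fix.and h.tube.zero |>.mono fun y hy hC =>
    (⟨hy.1 hC, hy.2 hC⟩ : R y = y ∧ H y = 0))] with y ⟨h1, h2⟩
  rw [h1, h2, ContinuousLinearMap.comp_apply, om_apply hR h, h.tube.apply_eq_one]
  simp [mul_comm]

/-- The displacement vanishes on the surface. Together with the contraction of `H`, this keeps the
orbits of `R` near `a`. -/
theorem sub_isBigO : (fun y => R y - y) =O[𝓝 a] H := by
  have hs : HasStrictFDerivAt (fun y => R y - y) (fderiv ℝ R a - ContinuousLinearMap.id ℝ E) a :=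
    hR.strict.sub (hasStrictFDerivAt_id a)
  have h1 := (h.tube.isLittleO hs).isBigO
  have h2 : (fun y => H y • (fderiv ℝ R a - ContinuousLinearMap.id ℝ E) e₂) =O[𝓝 a] H :=
    Asymptotics.IsBigO.of_bound ‖(fderiv ℝ R a - ContinuousLinearMap.id ℝ E) e₂‖
      (Eventually.of_forall fun y => by rw [norm_smul, mul_comm])
  refine (h1.add h2).congr' ?_ EventuallyEq.rfl
  filter_upwards [h.tube.eventually_pr hR.fix] with y h1
  rw [h1]; abel

/-- If the return map contracts the transverse direction, `V` is not close to `e₁`. -/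
theorem avoid_of_lt_one (hl : 0 < l) (hl1 : l < 1) : Avoid V Y a e₁ := by
  obtain ⟨K, hK⟩ := h.exists_bound
  obtain ⟨K', hK', hcoord⟩ := h.exists_coord_bound
  set N : E → E := fun y => projAlong Y L y (V y) with hN
  -- This choice gives `l + 3 d = 1 - d`, which closes the cone estimate below, and leaves the gap
  -- `l + d < 1 - d` between the contraction of `H` and the decay of `eta`.
  set d : ℝ := (1 - l) / 4 with hd
  have hd0 : 0 < d := by rw [hd]; linarith
  -- The opening of the cone is small enough for the shear `b` to cost at most `d / 2` of `eta`; the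
  -- variation of `DR` near `a` costs at most another `d / 2`.
  set c : ℝ := d / (2 * (|b| + 1)) with hc
  have hb0 := abs_nonneg b
  have hc0 : 0 < c := by rw [hc]; positivity
  have hbc : |b| * c ≤ d / 2 := by
    rw [hc, mul_div_assoc', div_le_div_iff₀ (by positivity) (by norm_num)]
    nlinarith
  -- the size of the perturbation
  set δ : ℝ := min (d / 2) (3 * c * d) / ((‖eta‖ + ‖om‖ + 1) * (K' * (1 + c))) with hδ
  have hm0 : 0 < min (d / 2) (3 * c * d) := lt_min (by positivity) (by positivity)
  have hδ0 : 0 < δ := by rw [hδ]; positivity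
  have hD : ∀ᶠ y in 𝓝 a, ‖fderiv ℝ R y - fderiv ℝ R a‖ < δ := by
    have hcont : ContinuousAt (fderiv ℝ R) a := hR.contDiffAt.continuousAt_fderiv one_ne_zero
    have : Tendsto (fun y => ‖fderiv ℝ R y - fderiv ℝ R a‖) (𝓝 a)
        (𝓝 ‖fderiv ℝ R a - fderiv ℝ R a‖) := (hcont.tendsto.sub_const _).norm
    refine this.eventually_lt_const ?_
    rwa [sub_self, norm_zero]
  have hL0 : ∀ᶠ y in 𝓝 a, L y (N y) = 0 := by
    filter_upwards [h.L_Y_ne] with y hy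
    change L y (projAlong Y L y (V y)) = 0
    rw [projAlong, map_sub, map_smul, smul_eq_mul, div_mul_cancel₀ _ hy, sub_self]
  -- The cone is forward invariant and in it `eta` shrinks at most by the factor `1 - d`: `DR(a)`
  -- scales `om` by `l` and preserves `eta` up to `b om`, and `r` is the error of replacing `DR(y)`
  -- by `DR(a)`.
  have h₁ : ∀ᶠ y in 𝓝 a, |om (N y)| ≤ c * |eta (N y)| → |om (N (R y))| ≤ c * |eta (N (R y))| ∧
      (1 - d) * |eta (N y)| ≤ |eta (N (R y))| := by
    filter_upwards [hD, hL0, hcoord, map_projAlong hR h] with y hy h0 hco hmap hcone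
    have hmap' : N (R y) = fderiv ℝ R a (N y) + (fderiv ℝ R y - fderiv ℝ R a) (N y) := by
      simp [hN, hmap]
    set r := (fderiv ℝ R y - fderiv ℝ R a) (N y) with hr
    have hNn : ‖N y‖ ≤ K' * (1 + c) * |eta (N y)| := by
      refine (hco _ h0).trans ?_
      nlinarith
    have hrn : (‖eta‖ + ‖om‖ + 1) * ‖r‖ ≤ min (d / 2) (3 * c * d) * |eta (N y)| := by
      have h2 : ‖r‖ ≤ δ * (K' * (1 + c) * |eta (N y)|) :=
        ((fderiv ℝ R y - fderiv ℝ R a).le_opNorm (N y)).trans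
          (mul_le_mul hy.le hNn (norm_nonneg _) hδ0.le)
      calc (‖eta‖ + ‖om‖ + 1) * ‖r‖
          ≤ (‖eta‖ + ‖om‖ + 1) * (δ * (K' * (1 + c) * |eta (N y)|)) :=
            mul_le_mul_of_nonneg_left h2 (by positivity)
        _ = _ := by rw [hδ]; field_simp
    have hre : |eta r| ≤ min (d / 2) (3 * c * d) * |eta (N y)| := by
      refine le_trans ?_ hrn
      refine (eta.le_opNorm r).trans (mul_le_mul_of_nonneg_right ?_ (norm_nonneg _))
      linarith [norm_nonneg om]
    have hro : |om r| ≤ min (d / 2) (3 * c * d) * |eta (N y)| := by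
      refine le_trans ?_ hrn
      refine (om.le_opNorm r).trans (mul_le_mul_of_nonneg_right ?_ (norm_nonneg _))
      linarith [norm_nonneg eta]
    have he0 := abs_nonneg (eta (N y))
    have hre' : |eta r| ≤ d / 2 * |eta (N y)| :=
      hre.trans (mul_le_mul_of_nonneg_right (min_le_left _ _) he0)
    have hro' : |om r| ≤ 3 * c * d * |eta (N y)| :=
      hro.trans (mul_le_mul_of_nonneg_right (min_le_right _ _) he0)
    have hexp : (1 - d) * |eta (N y)| ≤ |eta (N (R y))| := by
      rw [hmap', map_add, eta_apply hR h]
      have h3 : |eta (N y)| ≤ |eta (N y) + b * om (N y) + eta r| + |b| * |om (N y)| + |eta r| := by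
        rw [← abs_mul]
        calc |eta (N y)| = |(eta (N y) + b * om (N y) + eta r) - b * om (N y) - eta r| := by
              congr 1; ring
          _ ≤ _ := (abs_sub _ _).trans (add_le_add_left (abs_sub _ _) _)
      have h4 : |b| * |om (N y)| ≤ d / 2 * |eta (N y)| :=
        calc |b| * |om (N y)| ≤ |b| * (c * |eta (N y)|) := mul_le_mul_of_nonneg_left hcone hb0
          _ = |b| * c * |eta (N y)| := by ring
          _ ≤ _ := mul_le_mul_of_nonneg_right hbc he0
      linarith
    refine ⟨?_, hexp⟩
    refine le_trans ?_ (mul_le_mul_of_nonneg_left hexp hc0.le)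
    rw [hmap', map_add, om_apply hR h]
    calc |l * om (N y) + om r| ≤ l * |om (N y)| + |om r| := by
          refine (abs_add_le _ _).trans ?_
          rw [abs_mul, abs_of_pos hl]
      _ ≤ l * (c * |eta (N y)|) + 3 * c * d * |eta (N y)| :=
          add_le_add (mul_le_mul_of_nonneg_left hcone hl.le) hro'
      _ = c * ((1 - d) * |eta (N y)|) := by rw [hd]; ring
  have h₂ : ∀ᶠ y in 𝓝 a, |H (R y)| ≤ (l + d) * |H y| := by
    filter_upwards [(H_comp_isLittleO hR h).bound hd0] with y hy
    rw [Real.norm_eq_abs, Real.norm_eq_abs] at hy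
    have : H (R y) = l * H y + (H (R y) - l * H y) := by ring
    rw [this, add_mul]
    refine (abs_add_le _ _).trans ?_
    rw [abs_mul, abs_of_pos hl]
    linarith
  obtain ⟨K₃, hK₃⟩ := (sub_isBigO hR h).bound
  have h₄ : ∀ᶠ y in 𝓝 a, |eta (N y)| ≤ ‖eta‖ * K * |H y| := by
    filter_upwards [hK] with y hy
    rw [mul_assoc]
    exact (eta.le_opNorm _).trans (mul_le_mul_of_nonneg_left hy (norm_nonneg _))
  have key := eventually_eq_zero_of_contraction (P := fun y => |om (N y)| ≤ c * |eta (N y)|)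
    (g := fun y => eta (N y)) (l := l + d) (k := 1 - d) (by linarith) (by linarith) (by linarith)
    h.tube.strict.hasFDerivAt.continuousAt h.tube.value h₁ h₂ hK₃ h₄
  -- The projection of a vector close to `e₁` has `eta > 1 / 2` and `|om| < c / 2`, hence lies in
  -- the cone; so does `N` if `V` is a multiple of such a vector modulo `Y`.
  have ht : Tendsto (fun z : E × E => projAlong Y L z.1 z.2) (𝓝 a ×ˢ 𝓝 e₁)
      (𝓝 (projAlong Y L a e₁)) := h.tendsto_projAlong tendsto_fst tendsto_snd
  have he : projAlong Y L a e₁ = e₁ := by simp [projAlong, h.L_e₁]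
  rw [he] at ht
  have ht1 : Tendsto (fun z : E × E => eta (projAlong Y L z.1 z.2)) (𝓝 a ×ˢ 𝓝 e₁) (𝓝 1) := by
    have := (eta.continuous.tendsto e₁).comp ht
    rwa [h.eta_e₁] at this
  have ht2 : Tendsto (fun z : E × E => |om (projAlong Y L z.1 z.2)|) (𝓝 a ×ˢ 𝓝 e₁) (𝓝 0) := by
    have := ((om.continuous.tendsto e₁).comp ht).abs
    rwa [h.om_e₁, abs_zero] at this
  filter_upwards [ht1.eventually_const_lt (by norm_num : (1 / 2 : ℝ) < 1),
    ht2.eventually_lt_const (by positivity : 0 < c / 2), tendsto_fst.eventually key,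
    tendsto_fst.eventually h.L_Y_ne] with z hz1 hz2 hz3 hz4 m k hm
  have hNz : N z.1 = m • projAlong Y L z.1 z.2 := projAlong_combination hz4 hm
  have h5 := hz3 (by
    rw [hNz, map_smul, map_smul, smul_eq_mul, smul_eq_mul, abs_mul, abs_mul,
      abs_of_pos (by linarith : 0 < eta (projAlong Y L z.1 z.2))]
    have : |om (projAlong Y L z.1 z.2)| ≤ c * eta (projAlong Y L z.1 z.2) := by nlinarith
    nlinarith [abs_nonneg m])
  simp only [hNz, map_smul, smul_eq_mul] at h5
  exact (mul_eq_zero.1 h5).resolve_right (by linarith)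

/-- The inverse of a local return map is a local return map. -/
theorem exists_inverse [CompleteSpace E] (hl : l ≠ 0) (hA : (fderiv ℝ R a).IsInvertible) :
    ∃ R', IsLocalReturn C V Y L a e₁ e₂ R' l⁻¹ (-(b / l)) := by
  obtain ⟨A, hA⟩ := hA
  have hs : HasFDerivAt R (A : E →L[ℝ] E) a := by
    rw [hA]; exact hR.strict.hasFDerivAt
  have hst : HasStrictFDerivAt R (A : E →L[ℝ] E) a := by
    rw [hA]; exact hR.strict
  set R' := hR.contDiffAt.localInverse hs one_ne_zero with hR'
  have hR'c : ContDiffAt ℝ 1 R' a := by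
    have := hR.contDiffAt.to_localInverse hs one_ne_zero
    rwa [hR.map_self] at this
  have hleft : ∀ᶠ y in 𝓝 a, R' (R y) = y := hst.eventually_left_inverse
  have hright : ∀ᶠ y in 𝓝 a, R (R' y) = y := by
    have := hst.eventually_right_inverse
    rwa [hR.map_self] at this
  have hR'a : R' a = a := by
    have := hleft.self_of_nhds
    rwa [hR.map_self] at this
  have ht' : Tendsto R' (𝓝 a) (𝓝 a) := by
    have := hR'c.continuousAt.tendsto
    rwa [hR'a] at this
  have hdR : ∀ᶠ y in 𝓝 a, DifferentiableAt ℝ R y := by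
    filter_upwards [hR.contDiffAt.eventually (by simp)] with y hy
    exact hy.differentiableAt one_ne_zero
  have hdR' : ∀ᶠ y in 𝓝 a, DifferentiableAt ℝ R' y := by
    filter_upwards [hR'c.eventually (by simp)] with y hy
    exact hy.differentiableAt one_ne_zero
  have hD₁ : ∀ᶠ y in 𝓝 a, ∀ v, fderiv ℝ R' y (fderiv ℝ R (R' y) v) = v := by
    filter_upwards [ht'.eventually (hleft.eventually_nhds), ht'.eventually hdR, hright, hdR']
      with y h1 h2 h3 h4 v
    have h5 : HasFDerivAt (fun z => R' (R z)) ((fderiv ℝ R' y).comp (fderiv ℝ R (R' y))) (R' y) := by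
      refine HasFDerivAt.comp (R' y) ?_ h2.hasFDerivAt
      rw [h3]; exact h4.hasFDerivAt
    have h6 : HasFDerivAt (fun z => R' (R z)) (ContinuousLinearMap.id ℝ E) (R' y) :=
      (hasFDerivAt_id _).congr_of_eventuallyEq h1
    exact DFunLike.congr_fun (h5.unique h6) v
  have hD₂ : ∀ᶠ y in 𝓝 a, ∀ v, fderiv ℝ R (R' y) (fderiv ℝ R' y v) = v := by
    filter_upwards [hright.eventually_nhds, ht'.eventually hdR, hdR'] with y h1 h2 h4 v
    have h5 : HasFDerivAt (fun z => R (R' z)) ((fderiv ℝ R (R' y)).comp (fderiv ℝ R' y)) y :=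
      HasFDerivAt.comp y h2.hasFDerivAt h4.hasFDerivAt
    have h6 : HasFDerivAt (fun z => R (R' z)) (ContinuousLinearMap.id ℝ E) y :=
      (hasFDerivAt_id _).congr_of_eventuallyEq h1
    exact DFunLike.congr_fun (h5.unique h6) v
  have hD₀ : ∀ v w, fderiv ℝ R a v = w → fderiv ℝ R' a w = v := by
    intro v w hvw
    have := hD₁.self_of_nhds v
    rwa [hR'a, hvw] at this
  have hYne : ∀ᶠ y in 𝓝 a, Y y ≠ 0 := h.strict_Y.hasFDerivAt.continuousAt.eventually_ne h.Y_ne_zero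
  refine ⟨R', hR'c, hR'a, ?_, ?_, ?_, ?_, hD₀ _ _ hR.apply_e₁, ?_, hD₀ _ _ hR.apply_Y⟩
  · filter_upwards [hleft, hR.fix] with y h1 h2 hC
    have := h1
    rwa [h2 hC] at this
  · filter_upwards [ht'.eventually hR.map_V, ht'.eventually hR.map_Y, ht'.eventually hYne, hright, hD₁]
      with y ⟨c, hc⟩ ⟨c', hc'⟩ h3 h4 h5
    rw [h4] at hc hc'
    have h6 : Y (R' y) = c' • fderiv ℝ R' y (Y y) := by rw [← map_smul, ← hc', h5]
    have hc0 : c' ≠ 0 := by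
      rintro rfl
      rw [zero_smul] at h6; exact h3 h6
    refine ⟨-(c / c'), ?_⟩
    rw [hc, map_add, h5, map_smul, h6, smul_smul, neg_mul, div_mul_cancel₀ _ hc0, neg_smul]
    abel
  · filter_upwards [ht'.eventually hR.map_Y, ht'.eventually hYne, hright, hD₁]
      with y ⟨c', hc'⟩ h3 h4 h5
    rw [h4] at hc'
    have h6 : Y (R' y) = c' • fderiv ℝ R' y (Y y) := by rw [← map_smul, ← hc', h5]
    have hc0 : c' ≠ 0 := by
      rintro rfl
      rw [zero_smul] at h6; exact h3 h6
    exact ⟨c'⁻¹, by rw [h6, inv_smul_smul₀ hc0]⟩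
  · filter_upwards [ht'.eventually hR.map_L, hright, hD₂] with y h1 h2 h3 v
    have := h1 (fderiv ℝ R' y v)
    rw [h2, h3] at this
    exact this.symm
  -- The new shear `-(b / l)` is obtained by inverting the matrix with columns `(1, 0)` and `(b,
  -- l)`.
  · apply hD₀
    rw [map_add, map_smul, map_smul, hR.apply_e₁, hR.apply_e₂, smul_add, smul_smul, smul_smul,
      inv_mul_cancel₀ hl, one_smul, ← add_assoc, ← add_smul]
    have : -(b / l) + l⁻¹ * b = 0 := by ring
    rw [this, zero_smul, zero_add]

/-- For `l > 1` the inverse map contracts with rate `l⁻¹`. It exists because `DR(a)` is triangular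
in the frame `e₁, e₂, Y`, with diagonal entries `1, l, 1`. -/
theorem avoid_of_ne_one [FiniteDimensional ℝ E] (hl : 0 < l) (hl1 : l ≠ 1) : Avoid V Y a e₁ := by
  rcases hl1.lt_or_gt with hl1 | hl1
  · exact hR.avoid_of_lt_one h hl hl1
  · have : CompleteSpace E := FiniteDimensional.complete ℝ E
    have hinj : Function.Injective (fderiv ℝ R a : E →ₗ[ℝ] E) := by
      rw [← LinearMap.ker_eq_bot, LinearMap.ker_eq_bot']
      intro v hv
      have hv' : fderiv ℝ R a v = 0 := hv
      have h1 := om_apply hR h v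
      have h2 := eta_apply hR h v
      rw [hv', map_zero] at h1 h2
      have h3 : om v = 0 := (mul_eq_zero.1 h1.symm).resolve_left hl.ne'
      rw [h3, mul_zero, add_zero] at h2
      have h4 := h.frame v
      rw [← h2, h3, zero_smul, zero_smul, zero_add, zero_add] at h4
      rw [h4, map_smul, hR.apply_Y, ← h4] at hv'
      exact hv'
    have hinv : (fderiv ℝ R a).IsInvertible :=
      ⟨(LinearEquiv.ofInjectiveEndo _ hinj).toContinuousLinearEquiv, by ext v; rfl⟩
    obtain ⟨R', hR'⟩ := hR.exists_inverse h hl.ne' hinv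
    exact hR'.avoid_of_lt_one h (inv_pos.2 hl) (inv_lt_one_of_one_lt₀ hl1)

/-- Unless the differential of the return map is the identity, `V` avoids some direction. -/
theorem eq_id_or_avoid [FiniteDimensional ℝ E] (hl : 0 < l) {k : ℝ} (hk : k ≠ 0)
    (hB₁ : B e₁ = k • Y a) {r : E → ℝ} (hr : ContDiffAt ℝ 1 r a)
    (hrY : fderiv ℝ r a (Y a) = 0)
    (hRV : ∀ᶠ y in 𝓝 a, V (R y) = fderiv ℝ R y (V y) - fderiv ℝ r y (V y) • Y (R y)) :
    fderiv ℝ R a = ContinuousLinearMap.id ℝ E ∨ Avoid V Y a e₁ ∨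
      ∀ v, LinearIndependent ℝ ![e₁, v, Y a] → Avoid V Y a v := by
  by_cases hl1 : l ≠ 1
  · exact Or.inr (Or.inl (hR.avoid_of_ne_one h hl hl1))
  rw [not_not] at hl1
  have hframe := h.frame (B e₂)
  set x := eta (B e₂)
  set w := om (B e₂)
  set z := L a (B e₂) / L a (Y a)
  have hli : ∀ x y z : ℝ, x • e₁ + y • e₂ + z • Y a = 0 → x = 0 ∧ y = 0 ∧ z = 0 := by
    intro x y z h0
    have h1 := congrArg eta h0
    have h2 := congrArg om h0
    have h3 := congrArg (L a) h0
    simp only [map_add, map_smul, h.eta_e₁, h.eta_e₂, h.eta_Y, h.om_e₁, h.tube.apply_eq_one, h.om_Y,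
      h.L_e₁, h.L_e₂, smul_eq_mul, mul_zero, mul_one, add_zero, zero_add, map_zero] at h1 h2 h3
    exact ⟨h1, h2, (mul_eq_zero.1 h3).resolve_right h.L_Y⟩
  by_cases hw : w = 0
  swap
  -- With an `e₂` component in `B e₂`, the vectors `B e₂, e₁, Y` are independent.
  · refine Or.inr (Or.inl (h.avoid_of_linearIndependent ?_))
    rw [Fintype.linearIndependent_iff]
    intro g hg
    rw [Fin.sum_univ_three] at hg
    change g 0 • B e₂ + g 1 • e₁ + g 2 • Y a = 0 at hg
    have h1 := hli (g 0 * x + g 1) (g 0 * w) (g 0 * z + g 2) (by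
      rw [← hg, hframe]; module)
    have h0 : g 0 = 0 := (mul_eq_zero.1 h1.2.1).resolve_right hw
    simp only [h0, zero_mul, zero_add] at h1
    intro i
    fin_cases i
    · exact h0
    · exact h1.1
    · exact h1.2.2
  by_cases hx : x = 0
  swap
  -- Here `B e₂` is a nonzero multiple of `e₁` modulo `Y`, so it is independent of `v, Y` for every
  -- `v` completing `e₁, Y` to a basis.
  · refine Or.inr (Or.inr fun v hv => h.avoid_of_linearIndependent ?_)
    rw [Fintype.linearIndependent_iff] at hv ⊢
    intro g hg
    rw [Fin.sum_univ_three] at hg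
    change g 0 • B e₂ + g 1 • v + g 2 • Y a = 0 at hg
    have h1 := hv ![g 0 * x, g 1, g 0 * z + g 2] (by
      rw [Fin.sum_univ_three]
      change (g 0 * x) • e₁ + g 1 • v + (g 0 * z + g 2) • Y a = 0
      rw [← hg, hframe, hw]; module)
    have h10 : g 0 * x = 0 := h1 0
    have h11 : g 1 = 0 := h1 1
    have h12 : g 0 * z + g 2 = 0 := h1 2
    have h0 : g 0 = 0 := (mul_eq_zero.1 h10).resolve_right hx
    rw [h0, zero_mul, zero_add] at h12
    intro i
    fin_cases i
    · exact h0
    · exact h11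
    · exact h12
  left
  have hBe : B e₂ = z • Y a := by rw [hframe, hw, hx]; simp
  -- the differential of the commutation relation
  have hB : HasFDerivAt V B a := h.strict_V.hasFDerivAt
  have d1 : HasFDerivAt (fun y => V (R y)) (B.comp (fderiv ℝ R a)) a := by
    refine HasFDerivAt.comp a ?_ hR.strict.hasFDerivAt
    rw [hR.map_self]; exact hB
  have d2 := hasFDerivAt_clm_apply_of_eq_zero hB h.V_eq_zero (hR.contDiffAt.continuousAt_fderiv one_ne_zero)
  have hYR : HasFDerivAt (fun y => Y (R y)) (Y'.comp (fderiv ℝ R a)) a := by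
    refine HasFDerivAt.comp a ?_ hR.strict.hasFDerivAt
    rw [hR.map_self]; exact h.strict_Y.hasFDerivAt
  have d3 := (hasFDerivAt_clm_apply_of_eq_zero hB h.V_eq_zero
    (hr.continuousAt_fderiv one_ne_zero)).smul hYR
  have d4 := (d2.sub d3).congr_of_eventuallyEq (f₁ := fun y => V (R y)) hRV
  have key := DFunLike.congr_fun (d1.unique d4) e₂
  simp only [ContinuousLinearMap.comp_apply, sub_apply,
    ContinuousLinearMap.smulRight_apply, h.V_eq_zero, map_zero, zero_smul, zero_add,
    hR.map_self, hR.apply_e₂, hBe, map_add, map_smul, hB₁, hR.apply_Y, hrY, smul_eq_mul, mul_zero,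
    hl1, one_smul, sub_zero] at key
  -- `key` reads `b k Y + z Y = z Y`: `DR` fixes `Y`, and the term in `dr` drops out because `B e₂`
  -- is a multiple of `Y` and `dr(Y) = 0`.
  have hb : b = 0 := by
    have h1 : (b * k) • Y a = 0 := by
      rw [mul_smul]; simpa using key
    rcases smul_eq_zero.1 h1 with h1 | h1
    · exact (mul_eq_zero.1 h1).resolve_right hk
    · exact absurd h1 h.Y_ne_zero
  ext v
  conv_lhs => rw [h.frame v]
  rw [map_add, map_add, map_smul, map_smul, map_smul, hR.apply_e₁, hR.apply_e₂, hR.apply_Y, hb, hl1,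
    zero_smul, zero_add, one_smul]
  exact (h.frame v).symm

end IsLocalReturn

end

section

variable {M : Type*} [TopologicalSpace M] [ChartedSpace E3 M] [IsManifold (𝓡 3) ∞ M]
  {U : Set M} {X Y w : ∀ x : M, TangentSpace (𝓡 3) x}

/-! ### Vanishing of the index -/

/-- A perturbation without zeros has an empty sum of local indices, so the common value is `0`;
where no unique common value exists, the definition gives `0` as well. -/
theorem poincareHopfIndex_eq_zero_of_isPerturbation {Z : ∀ x : M, TangentSpace (𝓡 3) x}
    (hZ : IsPerturbation X U Z) (h0 : ∀ x ∈ U, Z x ≠ 0) : poincareHopfIndex X U = 0 := by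
  rw [poincareHopfIndex]
  split_ifs with h
  · have h1 : IsIndex X U h.choose := h.choose_spec.1
    have h2 : {x ∈ U | Z x = 0} = ∅ := by
      ext x
      simpa using h0 x
    rw [← h1 Z hZ, h2]
    simp
  · rfl

theorem IsC0FieldOn.continuousWithinAt_dchart (hw : IsC0FieldOn w U) {p x : M} (hx : x ∈ U)
    (hp : x ∈ (extChartAt (𝓡 3) p).source) :
    ContinuousWithinAt (fun q => dchart p q (vec w q)) U x :=
  (continuousWithinAt_field_iff (f := id) (w := vec w) hp continuousWithinAt_id).1 (hw x hx)

theorem IsC1Field.continuousAt_dchart (hX : IsC1Field X) {p x : M}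
    (hp : x ∈ (extChartAt (𝓡 3) p).source) : ContinuousAt (fun q => dchart p q (vec X q)) x := by
  have h : IsC0FieldOn X univ := (ContMDiff.continuous hX).continuousOn
  exact (h.continuousWithinAt_dchart (mem_univ x) hp).continuousAt univ_mem

/-- The field `X - r t Y + r ε w`. -/
def shiftField (X Y w : ∀ x : M, TangentSpace (𝓡 3) x) (t ε r : ℝ) (x : M) : E3 :=
  vec X x - (r * t) • vec Y x + (r * ε) • vec w x

theorem continuousWithinAt_shiftField (hX : IsC1Field X) (hY : IsC1Field Y) (hw : IsC0FieldOn w U)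
    (t : ℝ) {p : M} {z : ℝ × ℝ × M} (hz : z.2.2 ∈ U)
    (hp : z.2.2 ∈ (extChartAt (𝓡 3) p).source) :
    ContinuousWithinAt (fun z : ℝ × ℝ × M => dchart p z.2.2 (shiftField X Y w t z.1 z.2.1 z.2.2))
      (univ ×ˢ univ ×ˢ U) z := by
  have hf : ContinuousWithinAt (fun z : ℝ × ℝ × M => z.2.2) (univ ×ˢ univ ×ˢ U) z := by fun_prop
  have hm : MapsTo (fun z : ℝ × ℝ × M => z.2.2) (univ ×ˢ univ ×ˢ U) U := fun z hz => hz.2.2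
  have h1 := (hX.continuousAt_dchart hp).comp_continuousWithinAt
    (f := fun z : ℝ × ℝ × M => z.2.2) hf
  have h2 := (hY.continuousAt_dchart hp).comp_continuousWithinAt
    (f := fun z : ℝ × ℝ × M => z.2.2) hf
  have h3 := (hw.continuousWithinAt_dchart hz hp).comp
    (f := fun z : ℝ × ℝ × M => z.2.2) hf hm
  have h4 : ContinuousWithinAt (fun z : ℝ × ℝ × M => z.2.1 * t) (univ ×ˢ univ ×ˢ U) z := by fun_prop
  have h5 : ContinuousWithinAt (fun z : ℝ × ℝ × M => z.2.1 * z.1) (univ ×ˢ univ ×ˢ U) z := by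
    fun_prop
  refine ((h1.sub (h4.smul h2)).add (h5.smul h3)).congr (fun z _ => ?_) ?_ <;>
  simp [shiftField]

/-- The index of `X` vanishes when some zero set `X = t Y`, disjoint from the boundary of `U`, can be
removed by a perturbation in the direction of a continuous field `w`. -/
theorem poincareHopfIndex_eq_zero_of_avoid [T2Space M] (hU : IsCompact U) (hX : IsC1Field X)
    (hY : IsC1Field Y) (hw : IsC0FieldOn w U) {t : ℝ}
    (hbd : ∀ r ∈ Icc (0 : ℝ) 1, ∀ x ∈ frontier U, vec X x - (r * t) • vec Y x ≠ 0)
    (hav : ∀ p ∈ U, vec X p - t • vec Y p = 0 →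
      Avoid (fun y => inChart X p y - t • inChart Y p y) (inChart Y p) (extChartAt (𝓡 3) p p)
        (dchart p p (vec w p))) :
    poincareHopfIndex X U = 0 := by
  have hfU : frontier U ⊆ U := hU.isClosed.frontier_subset
  have hne : ∀ {p q : M} {v : E3}, dchart p q v ≠ 0 → v ≠ 0 := by
    rintro p q v h rfl; exact h (map_zero _)
  have hne' : ∀ {p : M} {v : E3}, v ≠ 0 → dchart p p v ≠ 0 := by
    intro p v h h0
    exact h (dchart_injective (mem_extChartAt_source p) (by rw [h0, map_zero]))
  -- No zeros on the boundary along the homotopy, by compactness of `[0, 1] × ∂U`. Membership is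
  -- repeated inside the predicate because it is tested on full neighbourhoods, whereas `w` is
  -- continuous only on `U`.
  have c1 : ∀ᶠ ε in 𝓝 (0 : ℝ), ∀ z ∈ Icc (0 : ℝ) 1 ×ˢ frontier U, z ∈ Icc (0 : ℝ) 1 ×ˢ frontier U →
      shiftField X Y w t ε z.1 z.2 ≠ 0 := by
    refine (isCompact_Icc.prod (hU.of_isClosed_subset isClosed_frontier hfU)).eventually_forall_of_forall_eventually
      (P := fun ε z => z ∈ Icc (0 : ℝ) 1 ×ˢ frontier U → shiftField X Y w t ε z.1 z.2 ≠ 0) ?_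
    rintro ⟨r, x⟩ ⟨hr, hx⟩
    have hc := continuousWithinAt_shiftField hX hY hw t (p := x) (z := (0, r, x)) (hfU hx)
      (mem_extChartAt_source x)
    have h0 : dchart x x (shiftField X Y w t 0 r x) ≠ 0 := by
      refine hne' ?_
      rw [shiftField, mul_zero, zero_smul, add_zero]
      exact hbd r hr x hx
    filter_upwards [eventually_nhdsWithin_iff.1 (hc.eventually_ne h0)] with z hz hz'
    exact hne (hz ⟨mem_univ _, mem_univ _, hfU hz'.2⟩)
  -- No zeros in `U` at the end of the homotopy: `Avoid` serves near the zeros of `X - t Y`, and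
  -- continuity elsewhere.
  have c2 : ∀ᶠ ε in 𝓝 (0 : ℝ), ∀ x ∈ U, x ∈ U → ε ≠ 0 → shiftField X Y w t ε 1 x ≠ 0 := by
    refine hU.eventually_forall_of_forall_eventually
      (P := fun ε x => x ∈ U → ε ≠ 0 → shiftField X Y w t ε 1 x ≠ 0) ?_
    intro x hx
    by_cases hxt : vec X x - t • vec Y x = 0
    · have hwc := hw.continuousWithinAt_dchart hx (mem_extChartAt_source x)
      have ht : Tendsto (fun q => (extChartAt (𝓡 3) x q, dchart x q (vec w q))) (𝓝[U] x)
          (𝓝 (extChartAt (𝓡 3) x x) ×ˢ 𝓝 (dchart x x (vec w x))) :=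
        ((continuousAt_extChartAt x).tendsto.mono_left nhdsWithin_le_nhds).prodMk hwc
      have h1 := eventually_nhdsWithin_iff.1 (ht.eventually (hav x hx hxt))
      have h2 : ∀ᶠ q in 𝓝 x, q ∈ (extChartAt (𝓡 3) x).source := extChartAt_source_mem_nhds x
      filter_upwards [(continuous_snd.tendsto' ((0 : ℝ), x) x rfl).eventually (h1.and h2)] with
        z ⟨hz1, hz2⟩ hzU hε h0
      refine hε ?_
      -- A zero of `X - t Y + ε w` displays `X - t Y` as `(-ε) w + 0 Y`, so avoidance gives `ε = 0`.
      have h3 := hz1 hzU (-z.1) 0 ?_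
      · simpa using h3
      · have h4 := congrArg (dchart x z.2) h0
        rw [shiftField, one_mul, one_mul, map_add, map_sub, map_smul, map_smul, map_zero] at h4
        simp only [inChart_extChartAt _ hz2, zero_smul, add_zero, neg_smul]
        exact eq_neg_of_add_eq_zero_left h4
    · have hc := continuousWithinAt_shiftField hX hY hw t (p := x) (z := (0, 1, x)) hx
        (mem_extChartAt_source x)
      have h0 : dchart x x (shiftField X Y w t 0 1 x) ≠ 0 := by
        refine hne' ?_
        rwa [shiftField, mul_zero, zero_smul, add_zero, one_mul]
      have hcont : Tendsto (fun z : ℝ × M => (z.1, (1 : ℝ), z.2)) (𝓝 (0, x)) (𝓝 (0, 1, x)) :=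
        Continuous.tendsto' (by fun_prop) _ _ rfl
      filter_upwards [hcont.eventually (eventually_nhdsWithin_iff.1 (hc.eventually_ne h0))]
        with z hz hzU _
      exact hne (hz ⟨mem_univ _, mem_univ _, hzU⟩)
  obtain ⟨ε, ⟨hε1, hε2⟩, hε⟩ := (((c1.and c2).filter_mono nhdsWithin_le_nhds).and
    (self_mem_nhdsWithin (s := {(0 : ℝ)}ᶜ))).exists
  refine poincareHopfIndex_eq_zero_of_isPerturbation (Z := fun x => shiftField X Y w t ε 1 x)
    ⟨?_, fun r x => shiftField X Y w t ε r x, ?_, ?_, fun _ _ => rfl, ?_⟩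
    fun x hx => hε2 x hx hx hε
  · convert Set.finite_empty
    refine eq_empty_of_forall_notMem ?_
    rintro x ⟨hx, h0⟩
    exact hε2 x hx hx hε h0
  · rintro ⟨r, x⟩ ⟨hr, hx⟩
    have hf : ContinuousWithinAt (fun q : ℝ × M => q.2) (Icc 0 1 ×ˢ U) (r, x) := by fun_prop
    refine (continuousWithinAt_field_iff (p := x) (f := fun q : ℝ × M => q.2)
      (w := fun q : ℝ × M => shiftField X Y w t ε q.1 q.2) (mem_extChartAt_source x) hf).2 ?_
    have hc := continuousWithinAt_shiftField hX hY hw t (p := x) (z := (ε, r, x)) hx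
      (mem_extChartAt_source x)
    have hg : ContinuousWithinAt (fun q : ℝ × M => (ε, q.1, q.2)) (Icc 0 1 ×ˢ U) (r, x) := by
      fun_prop
    have hm : MapsTo (fun q : ℝ × M => (ε, q.1, q.2)) (Icc 0 1 ×ˢ U)
        ((univ : Set ℝ) ×ˢ (univ : Set ℝ) ×ˢ U) := fun q hq => ⟨mem_univ _, mem_univ _, hq.2⟩
    exact hc.comp (f := fun q : ℝ × M => (ε, q.1, q.2)) hg hm
  · intro x hx
    change shiftField X Y w t ε 0 x = vec X x
    simp [shiftField]
  · exact fun r hr x hx => hε1 (r, x) ⟨hr, hx⟩ ⟨hr, hx⟩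

end

section

variable {M : Type*} [TopologicalSpace M] [ChartedSpace E3 M] [IsManifold (𝓡 3) ∞ M] [T2Space M]
  {X Y : ∀ x : M, TangentSpace (𝓡 3) x}

/-! ### The flow at a variable time -/

theorem eventually_extChartAt_symm {p : M} {P : M → Prop} (h : ∀ᶠ q in 𝓝 p, P q) :
    ∀ᶠ y in 𝓝 (extChartAt (𝓡 3) p p), P ((extChartAt (𝓡 3) p).symm y) := by
  have := (continuousAt_extChartAt_symm (I := 𝓡 3) p).tendsto
  rw [extChartAt_to_inv] at this
  exact this.eventually h

/-- To prove an assertion near the image of `p` in a chart, prove it at the images of points. -/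
theorem eventually_of_eventually_extChartAt {p : M} {P : E3 → Prop}
    (h : ∀ᶠ q in 𝓝 p, P (extChartAt (𝓡 3) p q)) : ∀ᶠ y in 𝓝 (extChartAt (𝓡 3) p p), P y := by
  filter_upwards [eventually_extChartAt_symm h,
    (isOpen_extChartAt_target p).mem_nhds (mem_extChartAt_target p)] with y hy hy'
  rwa [(extChartAt (𝓡 3) p).right_inv hy'] at hy

theorem eventually_extChartAt {p : M} {P : E3 → Prop}
    (h : ∀ᶠ y in 𝓝 (extChartAt (𝓡 3) p p), P y) : ∀ᶠ q in 𝓝 p, P (extChartAt (𝓡 3) p q) :=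
  (continuousAt_extChartAt (I := 𝓡 3) p).eventually h

/-- The derivative of a scalar function. -/
def dscalar (r : M → ℝ) (q : M) : E3 →L[ℝ] ℝ := mfderiv (𝓡 3) 𝓘(ℝ, ℝ) r q

theorem fderiv_comp_extChartAt_symm {r : M → ℝ} {p q : M} (hq : q ∈ (extChartAt (𝓡 3) p).source)
    (hr : MDifferentiableAt (𝓡 3) 𝓘(ℝ, ℝ) r q) (v : E3) :
    fderiv ℝ (fun y => r ((extChartAt (𝓡 3) p).symm y)) (extChartAt (𝓡 3) p q) (dchart p q v) =
      dscalar r q v := by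
  have hy := (extChartAt (𝓡 3) p).map_source hq
  have e := (extChartAt (𝓡 3) p).left_inv hq
  have hs : MDifferentiableAt 𝓘(ℝ, E3) (𝓡 3) (extChartAt (𝓡 3) p).symm (extChartAt (𝓡 3) p q) :=
    (contMDiffAt_extChartAt_symm hy 1).mdifferentiableAt one_ne_zero
  have h1 : MDifferentiableAt 𝓘(ℝ, E3) 𝓘(ℝ, ℝ) (fun y => r ((extChartAt (𝓡 3) p).symm y))
      (extChartAt (𝓡 3) p q) := by
    have hr' : MDifferentiableAt (𝓡 3) 𝓘(ℝ, ℝ) r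
      ((extChartAt (𝓡 3) p).symm (extChartAt (𝓡 3) p q)) := by rwa [e]
    exact hr'.comp _ hs
  have h2 : HasMFDerivAt (𝓡 3) 𝓘(ℝ, ℝ)
      (fun z => r ((extChartAt (𝓡 3) p).symm (extChartAt (𝓡 3) p z))) q
      ((mfderiv 𝓘(ℝ, E3) 𝓘(ℝ, ℝ) (fun y => r ((extChartAt (𝓡 3) p).symm y))
        (extChartAt (𝓡 3) p q)).comp (dchart p q)) :=
    HasMFDerivAt.comp (g := fun y => r ((extChartAt (𝓡 3) p).symm y)) q h1.hasMFDerivAt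
      (hasMFDerivAt_dchart hq)
  have h4 : r =ᶠ[𝓝 q] fun z => r ((extChartAt (𝓡 3) p).symm (extChartAt (𝓡 3) p z)) := by
    filter_upwards [(isOpen_extChartAt_source p).mem_nhds hq] with z hz
    rw [(extChartAt (𝓡 3) p).left_inv hz]
  have h5 := hasMFDerivAt_unique (h2.congr_of_eventuallyEq h4) hr.hasMFDerivAt
  rw [mfderiv_eq_fderiv] at h5
  exact DFunLike.congr_fun h5 v

theorem contDiffAt_comp_extChartAt_symm {r : M → ℝ} {p : M} {n : ℕ∞}
    (hr : ContMDiffAt (𝓡 3) 𝓘(ℝ, ℝ) n r p) :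
    ContDiffAt ℝ n (fun y => r ((extChartAt (𝓡 3) p).symm y)) (extChartAt (𝓡 3) p p) := by
  rw [← contMDiffAt_iff_contDiffAt]
  have h1 := contMDiffAt_extChartAt_symm (mem_extChartAt_target (I := 𝓡 3) p) n
  have hr' : ContMDiffAt (𝓡 3) 𝓘(ℝ, ℝ) n r
      ((extChartAt (𝓡 3) p).symm (extChartAt (𝓡 3) p p)) := by rwa [extChartAt_to_inv]
  exact hr'.comp _ h1

/-- The flow of `Y` at the variable time `r`. -/
def flowMap (Y : ∀ x : M, TangentSpace (𝓡 3) x) (r : M → ℝ) (q : M) : M := flow Y q (r q)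

theorem contMDiffAt_flowMap (hY : IsC1Field Y) {r : M → ℝ} {q : M} (hd : FlowDef Y q (r q))
    (hr : ContMDiffAt (𝓡 3) 𝓘(ℝ, ℝ) 1 r q) : ContMDiffAt (𝓡 3) (𝓡 3) 1 (flowMap Y r) q := by
  have h1 : ContMDiffAt (𝓡 3) ((𝓡 3).prod 𝓘(ℝ, ℝ)) 1 (fun z : M => (z, r z)) q :=
    contMDiffAt_id.prodMk hr
  exact ContMDiffAt.comp q (g := fun z : M × ℝ => flow Y z.1 z.2) (hd.regular hY).1 h1

theorem eventually_flowDef_flowMap (hY : IsC1Field Y) {r : M → ℝ} {q : M} (hd : FlowDef Y q (r q))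
    (hr : ContinuousAt r q) : ∀ᶠ z in 𝓝 q, FlowDef Y z (r z) :=
  (continuousAt_id.prodMk hr : ContinuousAt (fun z : M => (z, r z)) q).eventually (hd.regular hY).2

theorem mfderiv_flow_apply (hY : IsC1Field Y) {q : M} {s : ℝ} (hd : FlowDef Y q s) (v : E3)
    (x : ℝ) : mfderiv ((𝓡 3).prod 𝓘(ℝ, ℝ)) (𝓡 3) (fun z : M × ℝ => flow Y z.1 z.2) (q, s) (v, x) =
      (dflow Y q s v + x • vec Y (flow Y q s) : E3) := by
  have h := mfderiv_prod_eq_add_apply (I := 𝓡 3) (I' := 𝓘(ℝ, ℝ)) (v := (v, x))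
    ((hd.regular hY).1.mdifferentiableAt one_ne_zero)
  have h2 := (hd.hasMFDerivAt hY).mfderiv
  have h3 : mfderiv 𝓘(ℝ, ℝ) (𝓡 3) (fun z => flow Y q z) s x = x • vec Y (flow Y q s) := by
    rw [h2]; rfl
  exact h.trans (congrArg (fun u : E3 => dflow Y q s v + u) h3)

theorem mfderiv_flowMap_apply (hY : IsC1Field Y) {r : M → ℝ} {q : M} (hd : FlowDef Y q (r q))
    (hr : MDifferentiableAt (𝓡 3) 𝓘(ℝ, ℝ) r q) (v : E3) :
    mfderiv (𝓡 3) (𝓡 3) (flowMap Y r) q v =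
      (dflow Y q (r q) v + dscalar r q v • vec Y (flowMap Y r q) : E3) := by
  have h1 : HasMFDerivAt (𝓡 3) ((𝓡 3).prod 𝓘(ℝ, ℝ)) (fun z : M => (z, r z)) q
      ((ContinuousLinearMap.id ℝ (TangentSpace (𝓡 3) q)).prod (mfderiv (𝓡 3) 𝓘(ℝ, ℝ) r q)) :=
    (hasMFDerivAt_id q).prodMk hr.hasMFDerivAt
  have h2 := ((hd.regular hY).1.mdifferentiableAt one_ne_zero).hasMFDerivAt
  have h3 := (HasMFDerivAt.comp (g := fun z : M × ℝ => flow Y z.1 z.2) q h2 h1).mfderiv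
  have h4 : mfderiv (𝓡 3) (𝓡 3) (flowMap Y r) q v =
      mfderiv ((𝓡 3).prod 𝓘(ℝ, ℝ)) (𝓡 3) (fun z : M × ℝ => flow Y z.1 z.2) (q, r q)
        (v, dscalar r q v) := DFunLike.congr_fun h3 v
  exact h4.trans (mfderiv_flow_apply hY hd v _)

/-- Invariance, up to multiples of `Y`, of a field commuting with `Y` under the flow at a variable
time, read in charts. -/
theorem FlowsCommute.eventually_inChart (hX : IsC1Field X) (hY : IsC1Field Y)
    (h : FlowsCommute X Y) {r : M → ℝ} {p p' : M} (hd : FlowDef Y p (r p))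
    (hr : ContMDiffAt (𝓡 3) 𝓘(ℝ, ℝ) 1 r p) (hp' : flowMap Y r p ∈ (extChartAt (𝓡 3) p').source) :
    ∀ᶠ y in 𝓝 (extChartAt (𝓡 3) p p),
      inChart X p' (mapInChart (flowMap Y r) p p' y) =
        fderiv ℝ (mapInChart (flowMap Y r) p p') y (inChart X p y) -
        fderiv ℝ (fun y => r ((extChartAt (𝓡 3) p).symm y)) y (inChart X p y) •
          inChart Y p' (mapInChart (flowMap Y r) p p' y) := by
  refine eventually_of_eventually_extChartAt ?_
  filter_upwards [extChartAt_source_mem_nhds (I := 𝓡 3) p,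
    (contMDiffAt_flowMap hY hd hr).continuousAt.eventually
      ((isOpen_extChartAt_source (I := 𝓡 3) p').mem_nhds hp'),
    eventually_flowDef_flowMap hY hd hr.continuousAt,
    (contMDiffAt_iff_contMDiffAt_nhds (by simp)).1 hr] with q h1 h2 h3 h4
  have h4' := h4.mdifferentiableAt one_ne_zero
  rw [mapInChart_extChartAt _ h1, inChart_extChartAt _ h1, inChart_extChartAt _ h2,
    inChart_extChartAt _ h2, fderiv_comp_extChartAt_symm h1 h4',
    fderiv_mapInChart h1 h2 ((contMDiffAt_flowMap hY h3 h4).mdifferentiableAt one_ne_zero)]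
  have h5 := mfderiv_flowMap_apply hY h3 h4' (vec X q)
  have h6 := h.dflow_apply hX hY h3
  rw [h6] at h5
  have h7 : dchart p' (flowMap Y r q) (mfderiv (𝓡 3) (𝓡 3) (flowMap Y r) q (vec X q)) =
      dchart p' (flowMap Y r q) (vec X (flowMap Y r q) +
        dscalar r q (vec X q) • vec Y (flowMap Y r q)) := congrArg _ h5
  rw [h7, map_add, map_smul, add_sub_cancel_right]

end

section

/-! ### Tubular coordinates of a parametrised surface -/

section

variable {E : Type*} [NormedAddCommGroup E] [NormedSpace ℝ E]

/-- Invert `(z, h) ↦ ψ z + h e` near `(z₀, 0)`; `H` is the coordinate `h` and `pr y` is `ψ` of the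
coordinate `z`. By `hN`, points of `C` near `ψ z₀` come from parameters near `z₀`, so no other sheet
of `C` returns there and `H` vanishes on `C`. -/
theorem exists_isTube [FiniteDimensional ℝ E] (hE : Module.finrank ℝ E = 3) {ψ : ℝ × ℝ → E}
    {z₀ : ℝ × ℝ} {e : E} {C : Set E} (hψ : ContDiffAt ℝ 1 ψ z₀)
    (hinj : Function.Injective (fderiv ℝ ψ z₀)) (he : ∀ z, fderiv ℝ ψ z₀ z ≠ e)
    (hC : ∀ᶠ z in 𝓝 z₀, ψ z ∈ C)
    (hN : ∀ N ∈ 𝓝 z₀, ∀ᶠ y in 𝓝 (ψ z₀), y ∈ C → ∃ z ∈ N, ψ z = y) :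
    ∃ (om : E →L[ℝ] ℝ) (H : E → ℝ) (pr : E → E), IsTube C (ψ z₀) e om H pr ∧
      (∀ z, om (fderiv ℝ ψ z₀ z) = 0) ∧ ∀ v, ∃ z, v = fderiv ℝ ψ z₀ z + om v • e := by
  have : CompleteSpace E := FiniteDimensional.complete ℝ E
  set D := fderiv ℝ ψ z₀ with hD
  set T : (ℝ × ℝ) × ℝ →L[ℝ] E := D.coprod ((1 : ℝ →L[ℝ] ℝ).smulRight e) with hT
  have hTapp : ∀ z h, T (z, h) = D z + h • e := fun z h => by simp [hT]
  have hTinj : Function.Injective (T : (ℝ × ℝ) × ℝ →ₗ[ℝ] E) := by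
    rw [← LinearMap.ker_eq_bot, LinearMap.ker_eq_bot']
    rintro ⟨z, h⟩ hz
    have hz' : D z + h • e = 0 := (hTapp z h).symm.trans hz
    have hh : h = 0 := by
      by_contra hh
      refine he (-(h⁻¹ • z)) ?_
      rw [map_neg, map_smul, eq_neg_of_add_eq_zero_left hz', smul_neg, neg_neg, inv_smul_smul₀ hh]
    rw [hh, zero_smul, add_zero] at hz'
    rw [hh, hinj (hz'.trans (map_zero D).symm)]
    rfl
  set T' : ((ℝ × ℝ) × ℝ) ≃L[ℝ] E :=
    (LinearMap.linearEquivOfInjective (T : (ℝ × ℝ) × ℝ →ₗ[ℝ] E) hTinj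
      (by simp [hE])).toContinuousLinearEquiv with hT'
  have hT'app : ∀ z h, T' (z, h) = D z + h • e := hTapp
  set Ψ : (ℝ × ℝ) × ℝ → E := fun w => ψ w.1 + w.2 • e with hΨ
  have hΨs : HasStrictFDerivAt Ψ (T' : (ℝ × ℝ) × ℝ →L[ℝ] E) (z₀, 0) := by
    have h1 : HasStrictFDerivAt (fun w : (ℝ × ℝ) × ℝ => ψ w.1)
        (D.comp (ContinuousLinearMap.fst ℝ (ℝ × ℝ) ℝ)) (z₀, 0) :=
      HasStrictFDerivAt.comp (g := ψ) (z₀, (0 : ℝ)) (hψ.hasStrictFDerivAt one_ne_zero)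
        hasStrictFDerivAt_fst
    have h2 : HasStrictFDerivAt (fun w : (ℝ × ℝ) × ℝ => w.2 • e)
        ((ContinuousLinearMap.snd ℝ (ℝ × ℝ) ℝ).smulRight e) (z₀, 0) :=
      hasStrictFDerivAt_snd.smul_const e
    refine (h1.add h2).congr_fderiv ?_
    ext <;> simp [hT'app]
  have hΨ0 : Ψ (z₀, 0) = ψ z₀ := by simp [hΨ]
  set Φ := hΨs.localInverse Ψ T' (z₀, 0) with hΦ
  have hΦs : HasStrictFDerivAt Φ (T'.symm : E →L[ℝ] (ℝ × ℝ) × ℝ) (ψ z₀) := by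
    rw [← hΨ0]; exact hΨs.to_localInverse
  have hleft : ∀ᶠ w in 𝓝 (z₀, (0 : ℝ)), Φ (Ψ w) = w := hΨs.eventually_left_inverse
  have hright : ∀ᶠ y in 𝓝 (ψ z₀), Ψ (Φ y) = y := by
    rw [← hΨ0]; exact hΨs.eventually_right_inverse
  have hΦ0 : Φ (ψ z₀) = (z₀, 0) := by
    have := hleft.self_of_nhds
    rwa [hΨ0] at this
  have hΦt : Tendsto Φ (𝓝 (ψ z₀)) (𝓝 (z₀, 0)) := by
    rw [← hΦ0]; exact hΦs.hasFDerivAt.continuousAt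
  have hΦt1 : Tendsto (fun y => (Φ y).1) (𝓝 (ψ z₀)) (𝓝 z₀) :=
    (continuous_fst.tendsto' (z₀, (0 : ℝ)) z₀ rfl).comp hΦt
  refine ⟨(ContinuousLinearMap.snd ℝ (ℝ × ℝ) ℝ).comp (T'.symm : E →L[ℝ] (ℝ × ℝ) × ℝ),
    fun y => (Φ y).2, fun y => ψ (Φ y).1, ⟨?_, by simp [hΦ0], ?_, ?_, hΦt1.eventually hC, ?_, ?_⟩,
    fun z => ?_, fun v => ⟨(T'.symm v).1, ?_⟩⟩
  · exact HasStrictFDerivAt.comp (g := Prod.snd) _ hasStrictFDerivAt_snd hΦs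
  · exact hψ.continuousAt.tendsto.comp hΦt1
  · filter_upwards [hright] with y hy using hy.symm
  · have hN' : {z : ℝ × ℝ | Φ (Ψ (z, 0)) = (z, 0)} ∈ 𝓝 z₀ :=
      ((continuous_id.prodMk continuous_const).tendsto' z₀ (z₀, (0 : ℝ)) rfl).eventually hleft
    filter_upwards [hN _ hN'] with y hy hyC
    obtain ⟨z, hz, rfl⟩ := hy hyC
    have : Φ (ψ z) = (z, 0) := by simpa [hΨ] using hz
    rw [this]
  · have : T'.symm e = (0, 1) := by
      rw [ContinuousLinearEquiv.symm_apply_eq, hT'app]; simp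
    simp [this]
  · have : T'.symm (D z) = (z, 0) := by
      rw [ContinuousLinearEquiv.symm_apply_eq, hT'app]; simp
    simp [this]
  · have := hT'app (T'.symm v).1 (T'.symm v).2
    simpa using this

/-- A test for tangency: `H` vanishes along a curve lying in `C`, so the velocity of the curve is
killed by `DH = om`. -/
theorem IsTube.om_eq_zero {C : Set E} {a e : E} {om : E →L[ℝ] ℝ} {H : E → ℝ} {pr : E → E}
    (h : IsTube C a e om H pr) {c : ℝ → E} {t : ℝ} {v : E} (hc : HasDerivAt c v t) (hca : c t = a)
    (hC : ∀ᶠ s in 𝓝 t, c s ∈ C) : om v = 0 := by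
  have h1 : HasFDerivAt H om (c t) := by rw [hca]; exact h.strict.hasFDerivAt
  have h2 := h1.comp_hasDerivAt t hc
  have ht : Tendsto c (𝓝 t) (𝓝 a) := by rw [← hca]; exact hc.continuousAt
  have h3 : (H ∘ c) =ᶠ[𝓝 t] fun _ => 0 := by
    filter_upwards [ht.eventually h.zero, hC] with s h1 h2 using h1 h2
  exact h2.unique ((hasDerivAt_const t (0 : ℝ)).congr_of_eventuallyEq h3)

end

end

section

variable {M : Type*} [TopologicalSpace M] [ChartedSpace E3 M] [IsManifold (𝓡 3) ∞ M] [T2Space M]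
  {U : Set M} {X Y : ∀ x : M, TangentSpace (𝓡 3) x} {Sg : M → Circle}
  {e₁ e₂ : ∀ x : M, TangentSpace (𝓡 3) x} {μ : ℝ} {φ : ℝ × ℝ → M}

/-! ### The annulus of collinearity -/

/-- The part of the definition of a prepared counterexample used below, with `μ` and `φ` as
parameters. -/
structure IsAnnulus (U : Set M) (X Y : ∀ x : M, TangentSpace (𝓡 3) x) (Sg : M → Circle)
    (e₁ e₂ : ∀ x : M, TangentSpace (𝓡 3) x) (μ : ℝ) (φ : ℝ × ℝ → M) : Prop where
  isCompact : IsCompact U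
  c1_X : IsC1Field X
  c1_Y : IsC1Field Y
  commute : FlowsCommute X Y
  index_ne_zero : poincareHopfIndex X U ≠ 0
  smooth : ∃ W : Set M, IsOpen W ∧ U ⊆ W ∧ ContMDiffOn (𝓡 3) (𝓡 1) ∞ Sg W
  transverse : ∀ x ∈ U, mfderiv (𝓡 3) (𝓡 1) Sg x (Y x) ≠ 0
  continuous_e₁ : IsC0FieldOn e₁ U
  continuous_e₂ : IsC0FieldOn e₂ U
  basis : ∀ x ∈ U, LinearIndependent ℝ ![vec e₁ x, vec e₂ x, vec Y x]
  e₁_fiber : ∀ x ∈ U, mfderiv (𝓡 3) (𝓡 1) Sg x (e₁ x) = 0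
  e₂_fiber : ∀ x ∈ U, mfderiv (𝓡 3) (𝓡 1) Sg x (e₂ x) = 0
  pos : 0 < μ
  param : IsC1AnnulusParam μ φ (Col X Y U)
  image_eq : ∀ t ∈ Icc (-μ) μ, φ '' (univ ×ˢ {t}) = gam U X Y t
  orbit : ∀ t ∈ Icc (-μ) μ, ∃ T, IsPeriodicOrbit Y (gam U X Y t) T
  disjoint : ∀ t ∈ Ioo (-μ) μ, Disjoint (gam U X Y t) (frontier U)
  unique : ∀ t ∈ Icc (-μ) μ, ∀ z : Circle, ∃! x, x ∈ gam U X Y t ∧ Sg x = z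
  tangent : ∀ q ∈ (univ : Set ℝ) ×ˢ Icc (-μ) μ, ∃ w,
    mfderivWithin 𝓘(ℝ, ℝ × ℝ) (𝓡 3) φ (univ ×ˢ Icc (-μ) μ) q w = e₁ (φ q)

/-! ### The annulus as an invariant surface with tubular coordinates. -/

namespace IsAnnulus

section

variable (h : IsAnnulus U X Y Sg e₁ e₂ μ φ)

include h

theorem flow_mem {t : ℝ} (ht : t ∈ Icc (-μ) μ) {p : M} (hp : p ∈ gam U X Y t) (r : ℝ) :
    FlowDef Y p r ∧ flow Y p r ∈ gam U X Y t := by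
  obtain ⟨T, c, hc, -, -, -, hran⟩ := h.orbit t ht
  rw [← hran] at hp ⊢
  obtain ⟨s, rfl⟩ := hp
  have hs : FlowRel Y (c s) (s + r - s) (c (s + r)) :=
    flowRel_of_curve (hc.isMIntegralCurveOn (Ioo (min s (s + r) - 1) (max s (s + r) + 1)))
      ⟨by linarith [min_le_left s (s + r)], by linarith [le_max_left s (s + r)]⟩
      ⟨by linarith [min_le_right s (s + r)], by linarith [le_max_right s (s + r)]⟩
  rw [add_sub_cancel_left] at hs
  exact ⟨⟨_, hs⟩, by rw [hs.flow_eq h.c1_Y]; exact mem_range_self _⟩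

theorem exists_flow_eq {t : ℝ} (ht : t ∈ Icc (-μ) μ) {p p' : M} (hp : p ∈ gam U X Y t)
    (hp' : p' ∈ gam U X Y t) : ∃ r, flow Y p r = p' := by
  obtain ⟨T, c, hc, -, -, -, hran⟩ := h.orbit t ht
  rw [← hran] at hp hp'
  obtain ⟨s, rfl⟩ := hp
  obtain ⟨s', rfl⟩ := hp'
  have hs : FlowRel Y (c s) (s' - s) (c s') :=
    flowRel_of_curve (hc.isMIntegralCurveOn (Ioo (min s s' - 1) (max s s' + 1)))
      ⟨by linarith [min_le_left s s'], by linarith [le_max_left s s']⟩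
      ⟨by linarith [min_le_right s s'], by linarith [le_max_right s s']⟩
  exact ⟨s' - s, hs.flow_eq h.c1_Y⟩

theorem phi_mem_gam {z : ℝ × ℝ} (hz : z.2 ∈ Icc (-μ) μ) : φ z ∈ gam U X Y z.2 := by
  rw [← h.image_eq _ hz]
  exact ⟨z, ⟨mem_univ _, rfl⟩, rfl⟩

theorem phi_mem_col {z : ℝ × ℝ} (hz : z.2 ∈ Icc (-μ) μ) : φ z ∈ Col X Y U := by
  rw [← h.param.image_eq]
  exact ⟨z, ⟨mem_univ _, hz⟩, rfl⟩

theorem exists_phi_eq {p : M} (hp : p ∈ Col X Y U) : ∃ z : ℝ × ℝ, z.2 ∈ Icc (-μ) μ ∧ φ z = p := by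
  rw [← h.param.image_eq] at hp
  obtain ⟨z, ⟨-, hz⟩, rfl⟩ := hp
  exact ⟨z, hz, rfl⟩

theorem exists_phi_eq_of_mem_gam {t : ℝ} (ht : t ∈ Icc (-μ) μ) {p : M} (hp : p ∈ gam U X Y t) :
    ∃ θ, φ (θ, t) = p := by
  rw [← h.image_eq t ht] at hp
  obtain ⟨⟨θ, s⟩, ⟨-, rfl⟩, rfl⟩ := hp
  exact ⟨θ, rfl⟩

theorem gam_subset_col {t : ℝ} (ht : t ∈ Icc (-μ) μ) : gam U X Y t ⊆ Col X Y U := by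
  intro p hp
  obtain ⟨θ, rfl⟩ := h.exists_phi_eq_of_mem_gam ht hp
  exact h.phi_mem_col (z := (θ, t)) ht

theorem phi_add_int {θ s : ℝ} (hs : s ∈ Icc (-μ) μ) (k : ℤ) : φ (θ + k, s) = φ (θ, s) := by
  induction k using Int.induction_on with
  | zero => simp
  | succ n ih =>
    have := h.param.periodic (θ + (n : ℤ)) s hs
    rw [ih] at this
    rw [← this]; push_cast; ring_nf
  | pred n ih =>
    have := h.param.periodic (θ + ((-n - 1 : ℤ) : ℝ)) s hs
    rw [← this, ← ih]; push_cast; ring_nf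

/-- Points of the locus close to `φ z₀` are images of points close to `z₀`. -/
theorem eventually_exists_phi_eq {z₀ : ℝ × ℝ} (hz₀ : z₀.2 ∈ Icc (-μ) μ) {N : Set (ℝ × ℝ)}
    (hN : N ∈ 𝓝 z₀) :
    ∀ᶠ q in 𝓝 (φ z₀), q ∈ Col X Y U → ∃ z ∈ N, z.2 ∈ Icc (-μ) μ ∧ φ z = q := by
  -- `K` is a fundamental domain centred at `z₀` with a neighbourhood of `z₀` removed. Its image is
  -- compact and misses `φ z₀` by injectivity modulo `1`, so the complement of that image is a
  -- neighbourhood of `φ z₀`.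
  set K : Set (ℝ × ℝ) := (Icc (z₀.1 - 1 / 2) (z₀.1 + 1 / 2) ×ˢ Icc (-μ) μ) \ interior N with hK
  have hKc : IsCompact K := (isCompact_Icc.prod isCompact_Icc).diff isOpen_interior
  have hKsub : K ⊆ univ ×ˢ Icc (-μ) μ := fun z hz => ⟨mem_univ _, hz.1.2⟩
  have himg : IsCompact (φ '' K) :=
    hKc.image_of_continuousOn (h.param.contMDiffOn.continuousOn.mono hKsub)
  have hnot : φ z₀ ∉ φ '' K := by
    rintro ⟨z, hz, hzz⟩
    obtain ⟨h1, k, h2⟩ := h.param.injective z.1 z₀.1 z.2 hz.1.2 z₀.2 hz₀ hzz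
    have h3 := hz.1.1.1
    have h4 := hz.1.1.2
    have hk : k = 0 := by
      have a1 : (k : ℝ) < 1 := by linarith
      have a2 : (-1 : ℝ) < k := by linarith
      have a1' : k < 1 := by exact_mod_cast a1
      have a2' : -1 < k := by exact_mod_cast a2
      omega
    rw [hk, Int.cast_zero, add_zero] at h2
    have : z = z₀ := Prod.ext h2.symm h1
    exact hz.2 (this ▸ mem_interior_iff_mem_nhds.2 hN)
  filter_upwards [himg.isClosed.isOpen_compl.mem_nhds hnot] with q hq hqC
  obtain ⟨z, hz, rfl⟩ := h.exists_phi_eq hqC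
  -- Rounding translates the angle by an integer into the fundamental domain.
  have hz' : φ (z.1 + (-round (z.1 - z₀.1) : ℤ), z.2) = φ z := h.phi_add_int hz _
  refine ⟨(z.1 + (-round (z.1 - z₀.1) : ℤ), z.2), ?_, hz, hz'⟩
  · by_contra hzN
    refine hq ⟨(z.1 + (-round (z.1 - z₀.1) : ℤ), z.2),
      ⟨⟨?_, hz⟩, fun hi => hzN (interior_subset hi)⟩, hz'⟩
    have := abs_le.1 (abs_sub_round (z.1 - z₀.1))
    push_cast
    constructor <;> linarith [this.1, this.2]

theorem mem_nhds_strip {z₀ : ℝ × ℝ} (hz₀ : z₀.2 ∈ Ioo (-μ) μ) :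
    (univ : Set ℝ) ×ˢ Icc (-μ) μ ∈ 𝓝 z₀ :=
  prod_mem_nhds univ_mem (Icc_mem_nhds hz₀.1 hz₀.2)

theorem contMDiffAt_phi {z₀ : ℝ × ℝ} (hz₀ : z₀.2 ∈ Ioo (-μ) μ) :
    ContMDiffAt 𝓘(ℝ, ℝ × ℝ) (𝓡 3) 1 φ z₀ :=
  h.param.contMDiffOn.contMDiffAt (h.mem_nhds_strip hz₀)

end

/-- The parametrisation of the annulus, read in the chart at `p`. -/
def phiChart (φ : ℝ × ℝ → M) (p : M) (z : ℝ × ℝ) : E3 := extChartAt (𝓡 3) p (φ z)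

section

variable (h : IsAnnulus U X Y Sg e₁ e₂ μ φ)

include h

theorem contDiffAt_phiChart {z₀ : ℝ × ℝ} (hz₀ : z₀.2 ∈ Ioo (-μ) μ) {p : M}
    (hp : φ z₀ ∈ (extChartAt (𝓡 3) p).source) : ContDiffAt ℝ 1 (phiChart φ p) z₀ := by
  rw [← contMDiffAt_iff_contDiffAt]
  exact (contMDiffAt_extChartAt_of_mem hp 1).comp z₀ (h.contMDiffAt_phi hz₀)

theorem fderiv_phiChart {z₀ : ℝ × ℝ} (hz₀ : z₀.2 ∈ Ioo (-μ) μ) {p : M}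
    (hp : φ z₀ ∈ (extChartAt (𝓡 3) p).source) (w : ℝ × ℝ) :
    fderiv ℝ (phiChart φ p) z₀ w = dchart p (φ z₀)
      (mfderivWithin 𝓘(ℝ, ℝ × ℝ) (𝓡 3) φ (univ ×ˢ Icc (-μ) μ) z₀ w) := by
  have h1 := ((h.contMDiffAt_phi hz₀).mdifferentiableAt one_ne_zero).hasMFDerivAt
  have h2 := HasMFDerivAt.comp z₀ (hasMFDerivAt_dchart hp) h1
  have h3 : HasMFDerivAt 𝓘(ℝ, ℝ × ℝ) 𝓘(ℝ, E3) (phiChart φ p) z₀ (fderiv ℝ (phiChart φ p) z₀) :=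
    ((h.contDiffAt_phiChart hz₀ hp).differentiableAt one_ne_zero).hasFDerivAt.hasMFDerivAt
  rw [mfderivWithin_of_mem_nhds (h.mem_nhds_strip hz₀)]
  exact DFunLike.congr_fun (hasMFDerivAt_unique h3 h2) w

theorem fderiv_phiChart_injective {z₀ : ℝ × ℝ} (hz₀ : z₀.2 ∈ Ioo (-μ) μ) {p : M}
    (hp : φ z₀ ∈ (extChartAt (𝓡 3) p).source) :
    Function.Injective (fderiv ℝ (phiChart φ p) z₀) := by
  intro w w' hw
  rw [h.fderiv_phiChart hz₀ hp, h.fderiv_phiChart hz₀ hp] at hw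
  exact h.param.immersive z₀ ⟨mem_univ _, hz₀.1.le, hz₀.2.le⟩ (dchart_injective hp hw)

/-- Tubular coordinates around the annulus, in a chart. -/
theorem exists_isTube {z₀ : ℝ × ℝ} (hz₀ : z₀.2 ∈ Ioo (-μ) μ) {e : E3}
    (he : ∀ z, fderiv ℝ (phiChart φ (φ z₀)) z₀ z ≠ e) :
    ∃ (om : E3 →L[ℝ] ℝ) (H : E3 → ℝ) (pr : E3 → E3),
      IsTube ((extChartAt (𝓡 3) (φ z₀)).symm ⁻¹' Col X Y U) (extChartAt (𝓡 3) (φ z₀) (φ z₀)) e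
        om H pr ∧
      (∀ z, om (fderiv ℝ (phiChart φ (φ z₀)) z₀ z) = 0) ∧
      ∀ v, ∃ z, v = fderiv ℝ (phiChart φ (φ z₀)) z₀ z + om v • e := by
  have hsrc : φ z₀ ∈ (extChartAt (𝓡 3) (φ z₀)).source := mem_extChartAt_source _
  refine CommutingFields.exists_isTube (by simp) (h.contDiffAt_phiChart hz₀ hsrc)
    (h.fderiv_phiChart_injective hz₀ hsrc) he ?_ fun N hN => ?_
  · filter_upwards [(h.contMDiffAt_phi hz₀).continuousAt.eventually
      (extChartAt_source_mem_nhds (I := 𝓡 3) (φ z₀)), h.mem_nhds_strip hz₀] with z h1 h2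
    rw [mem_preimage, phiChart, (extChartAt (𝓡 3) (φ z₀)).left_inv h1]
    exact h.phi_mem_col h2.2
  · refine eventually_of_eventually_extChartAt ?_
    filter_upwards [h.eventually_exists_phi_eq ⟨hz₀.1.le, hz₀.2.le⟩ hN,
      extChartAt_source_mem_nhds (I := 𝓡 3) (φ z₀)] with q h1 h2 h3
    rw [mem_preimage, (extChartAt (𝓡 3) (φ z₀)).left_inv h2] at h3
    obtain ⟨z, hz, -, rfl⟩ := h1 h3
    exact ⟨z, hz, rfl⟩

end

end IsAnnulus

end

section

variable {M : Type*} [TopologicalSpace M] [ChartedSpace E3 M] [IsManifold (𝓡 3) ∞ M] [T2Space M]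
  {U : Set M} {X Y : ∀ x : M, TangentSpace (𝓡 3) x} {Sg : M → Circle}
  {e₁ e₂ : ∀ x : M, TangentSpace (𝓡 3) x} {μ : ℝ} {φ : ℝ × ℝ → M}

/-! ### Real lifts of a map to the circle -/

/-- A coordinate on the circle near `z₀`. -/
def circleCoord (z₀ z : Circle) : ℝ := extChartAt (𝓡 1) z₀ z 0

theorem eventually_circleCoord_injective (z₀ : Circle) :
    ∀ᶠ w in 𝓝 z₀ ×ˢ 𝓝 z₀, circleCoord z₀ w.1 = circleCoord z₀ w.2 → w.1 = w.2 := by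
  filter_upwards [tendsto_fst.eventually (extChartAt_source_mem_nhds (I := 𝓡 1) z₀),
    tendsto_snd.eventually (extChartAt_source_mem_nhds (I := 𝓡 1) z₀)] with w h1 h2 h
  refine (extChartAt (𝓡 1) z₀).injOn h1 h2 ?_
  ext i
  fin_cases i
  exact h

/-- A lift of `Sg` near `p`. -/
def lift (Sg : M → Circle) (p q : M) : ℝ := circleCoord (Sg p) (Sg q)

theorem contMDiffAt_lift {p q : M} (h : ContMDiffAt (𝓡 3) (𝓡 1) ∞ Sg q)
    (hq : Sg q ∈ (extChartAt (𝓡 1) (Sg p)).source) :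
    ContMDiffAt (𝓡 3) 𝓘(ℝ, ℝ) ∞ (lift Sg p) q := by
  rw [extChartAt_source] at hq
  have h1 := (contMDiffAt_extChartAt' (I := 𝓡 1) (n := ∞) hq).comp q h
  have h2 : ContMDiff 𝓘(ℝ, EuclideanSpace ℝ (Fin 1)) 𝓘(ℝ, ℝ) ∞
      (fun v : EuclideanSpace ℝ (Fin 1) => v 0) :=
    (EuclideanSpace.proj (𝕜 := ℝ) (0 : Fin 1)).contDiff.contMDiff
  exact h2.contMDiffAt.comp q h1

theorem dscalar_lift_eq_zero_iff {p : M} (h : MDifferentiableAt (𝓡 3) (𝓡 1) Sg p)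
    (v : TangentSpace (𝓡 3) p) :
    dscalar (lift Sg p) p v = 0 ↔ mfderiv (𝓡 3) (𝓡 1) Sg p v = 0 := by
  have h1 : HasMFDerivAt (𝓡 1) 𝓘(ℝ, EuclideanSpace ℝ (Fin 1)) (extChartAt (𝓡 1) (Sg p)) (Sg p)
      (mfderiv (𝓡 1) 𝓘(ℝ, EuclideanSpace ℝ (Fin 1)) (extChartAt (𝓡 1) (Sg p)) (Sg p)) :=
    (mdifferentiableAt_extChartAt (mem_chart_source _ _)).hasMFDerivAt
  have h2 : HasMFDerivAt 𝓘(ℝ, EuclideanSpace ℝ (Fin 1)) 𝓘(ℝ, ℝ)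
      (fun v : EuclideanSpace ℝ (Fin 1) => v 0) (extChartAt (𝓡 1) (Sg p) (Sg p))
      (EuclideanSpace.proj (𝕜 := ℝ) (0 : Fin 1)) :=
    (EuclideanSpace.proj (𝕜 := ℝ) (0 : Fin 1)).hasFDerivAt.hasMFDerivAt
  have h3 : HasMFDerivAt (𝓡 3) 𝓘(ℝ, ℝ) (lift Sg p) p
      ((EuclideanSpace.proj (𝕜 := ℝ) (0 : Fin 1)).comp
        ((mfderiv (𝓡 1) 𝓘(ℝ, EuclideanSpace ℝ (Fin 1)) (extChartAt (𝓡 1) (Sg p)) (Sg p)).comp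
          (mfderiv (𝓡 3) (𝓡 1) Sg p))) :=
    HasMFDerivAt.comp (g := fun v : EuclideanSpace ℝ (Fin 1) => v 0)
      (f := fun q => extChartAt (𝓡 1) (Sg p) (Sg q)) p h2
      (HasMFDerivAt.comp (g := extChartAt (𝓡 1) (Sg p)) p h1 h.hasMFDerivAt)
  set w : EuclideanSpace ℝ (Fin 1) :=
    mfderiv (𝓡 1) 𝓘(ℝ, EuclideanSpace ℝ (Fin 1)) (extChartAt (𝓡 1) (Sg p)) (Sg p)
      (mfderiv (𝓡 3) (𝓡 1) Sg p v) with hw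
  have h4 : dscalar (lift Sg p) p v = w 0 := DFunLike.congr_fun h3.mfderiv v
  rw [h4]
  constructor
  · intro h5
    refine (isInvertible_mfderiv_extChartAt (I := 𝓡 1) (mem_extChartAt_source (Sg p))).injective ?_
    rw [map_zero]
    have h6 : w = 0 := by
      ext i
      fin_cases i
      exact h5
    exact h6
  · intro h5
    rw [hw, h5]
    have h6 : mfderiv (𝓡 1) 𝓘(ℝ, EuclideanSpace ℝ (Fin 1)) (extChartAt (𝓡 1) (Sg p)) (Sg p) 0 = 0 :=
      map_zero _
    exact congrFun (congrArg WithLp.ofLp h6) 0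

/-! ### Linear algebra -/

theorem exists_coord_of_linearIndependent {u v w : E3} (h : LinearIndependent ℝ ![u, v, w]) :
    ∃ eta : E3 →L[ℝ] ℝ, eta u = 1 ∧ eta v = 0 ∧ eta w = 0 ∧
      ∀ x, ∃ y z : ℝ, x = eta x • u + y • v + z • w := by
  set b := basisOfLinearIndependentOfCardEqFinrank h (by simp) with hb
  have hb' : ∀ i, b i = ![u, v, w] i := fun i => by
    rw [hb, coe_basisOfLinearIndependentOfCardEqFinrank]
  have hc : ∀ i, b.coord 0 (![u, v, w] i) = if i = 0 then 1 else 0 := by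
    intro i
    rw [← hb', Module.Basis.coord_apply, Module.Basis.repr_self, Finsupp.single_apply]
  refine ⟨LinearMap.toContinuousLinearMap (b.coord 0), by simpa using hc 0, by simpa using hc 1,
    by simpa using hc 2, fun x => ⟨b.repr x 1, b.repr x 2, ?_⟩⟩
  have := b.sum_repr x
  rw [Fin.sum_univ_three, hb', hb', hb'] at this
  exact this.symm

theorem not_forall_mem_range_of_linearIndependent {u v w : E3} (h : LinearIndependent ℝ ![u, v, w])
    (D : ℝ × ℝ →L[ℝ] E3) {x y z : ℝ × ℝ} (hx : D x = u) (hy : D y = v) (hz : D z = w) : False := by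
  have h1 : ![u, v, w] = (D : ℝ × ℝ →ₗ[ℝ] E3) ∘ ![x, y, z] := by
    ext i : 1
    fin_cases i
    · exact hx.symm
    · exact hy.symm
    · exact hz.symm
  rw [h1] at h
  have h2 := (LinearIndependent.of_comp _ h).fintype_card_le_finrank
  simp at h2

/-! ### The local model at a point of the annulus -/

/-- The field `X - t Y` in the chart at `p`. -/
def shiftChart (X Y : ∀ x : M, TangentSpace (𝓡 3) x) (t : ℝ) (p : M) (y : E3) : E3 :=
  inChart X p y - t • inChart Y p y

theorem shiftChart_extChartAt {t : ℝ} {p q : M} (hq : q ∈ (extChartAt (𝓡 3) p).source) :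
    shiftChart X Y t p (extChartAt (𝓡 3) p q) = dchart p q (vec X q - t • vec Y q) := by
  rw [shiftChart, inChart_extChartAt _ hq, inChart_extChartAt _ hq, map_sub, map_smul]

/-- The differential of the lift of `Sg` in the chart at `p`. -/
def dliftChart (Sg : M → Circle) (p : M) (y : E3) : E3 →L[ℝ] ℝ :=
  fderiv ℝ (fun y => lift Sg p ((extChartAt (𝓡 3) p).symm y)) y

namespace IsAnnulus

variable (h : IsAnnulus U X Y Sg e₁ e₂ μ φ)

include h

theorem contDiffAt_shiftChart (t : ℝ) {p : M} {y : E3} (hy : y ∈ (extChartAt (𝓡 3) p).target) :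
    ContDiffAt ℝ 1 (shiftChart X Y t p) y :=
  (contDiffAt_inChart h.c1_X p hy).sub ((contDiffAt_inChart h.c1_Y p hy).const_smul t)

theorem contMDiffAt_Sg {p : M} (hp : p ∈ U) : ContMDiffAt (𝓡 3) (𝓡 1) ∞ Sg p := by
  obtain ⟨W, hW, hUW, hs⟩ := h.smooth
  exact hs.contMDiffAt (hW.mem_nhds (hUW hp))

theorem basis_chart {p q : M} (hq : q ∈ U) (hp : q ∈ (extChartAt (𝓡 3) p).source) :
    LinearIndependent ℝ
      ![dchart p q (vec e₁ q), dchart p q (vec e₂ q), dchart p q (vec Y q)] := by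
  have h1 := (h.basis q hq).map' (dchart p q : E3 →ₗ[ℝ] E3)
    (LinearMap.ker_eq_bot.2 (dchart_injective hp))
  have e : ![dchart p q (vec e₁ q), dchart p q (vec e₂ q), dchart p q (vec Y q)] =
      (dchart p q : E3 →ₗ[ℝ] E3) ∘ ![vec e₁ q, vec e₂ q, vec Y q] := by
    funext i
    fin_cases i <;> rfl
  rw [e]
  exact h1

theorem shiftChart_phiChart {z : ℝ × ℝ} (hz : z.2 ∈ Icc (-μ) μ) {p : M}
    (hp : φ z ∈ (extChartAt (𝓡 3) p).source) (t : ℝ) :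
    shiftChart X Y t p (phiChart φ p z) = (z.2 - t) • inChart Y p (phiChart φ p z) := by
  have h1 : vec X (φ z) = z.2 • vec Y (φ z) := sub_eq_zero.1 (h.phi_mem_gam hz).2
  rw [phiChart, shiftChart_extChartAt hp, inChart_extChartAt _ hp, h1, ← sub_smul, map_smul]

theorem hasDerivAt_flow_chart {p : M} :
    HasDerivAt (fun s => extChartAt (𝓡 3) p (flow Y p s)) (dchart p p (vec Y p)) 0 := by
  have h1 := hasDerivAt_extChartAt_comp (p := p)
    (by rw [flow_zero h.c1_Y]; exact mem_extChartAt_source p)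
    ((flowDef_zero h.c1_Y p).hasMFDerivAt h.c1_Y)
  rw [flow_zero h.c1_Y] at h1
  exact h1

theorem eventually_flow_mem_source {p : M} :
    ∀ᶠ s in 𝓝 (0 : ℝ), flow Y p s ∈ (extChartAt (𝓡 3) p).source := by
  have hc := ((flowDef_zero h.c1_Y p).hasMFDerivAt h.c1_Y).continuousAt
  refine hc.eventually ((isOpen_extChartAt_source (I := 𝓡 3) p).mem_nhds ?_)
  rw [flow_zero h.c1_Y]; exact mem_extChartAt_source p

/-- Otherwise tubular coordinates with transverse direction `Y` would exist; but the orbit of `Y`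
stays in the annulus, which forces `om Y = 0` against `om Y = 1`. -/
theorem exists_fderiv_phiChart_eq_Y {z₀ : ℝ × ℝ} (hz₀ : z₀.2 ∈ Ioo (-μ) μ) :
    ∃ w, fderiv ℝ (phiChart φ (φ z₀)) z₀ w = dchart (φ z₀) (φ z₀) (vec Y (φ z₀)) := by
  by_contra hcon
  obtain ⟨om, H, pr, htube, -, -⟩ := h.exists_isTube hz₀ (not_exists.1 hcon)
  have hI : z₀.2 ∈ Icc (-μ) μ := ⟨hz₀.1.le, hz₀.2.le⟩
  have h1 := htube.om_eq_zero h.hasDerivAt_flow_chart (by rw [flow_zero h.c1_Y]) (by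
    filter_upwards [h.eventually_flow_mem_source (p := φ z₀)] with s hs
    rw [mem_preimage, (extChartAt (𝓡 3) (φ z₀)).left_inv hs]
    exact h.gam_subset_col hI (h.flow_mem hI (h.phi_mem_gam hI) s).2)
  rw [htube.apply_eq_one] at h1
  exact one_ne_zero h1

theorem exists_fderiv_phiChart_eq_e₁ {z₀ : ℝ × ℝ} (hz₀ : z₀.2 ∈ Ioo (-μ) μ) :
    ∃ w, fderiv ℝ (phiChart φ (φ z₀)) z₀ w = dchart (φ z₀) (φ z₀) (vec e₁ (φ z₀)) := by
  obtain ⟨w, hw⟩ := h.tangent z₀ ⟨mem_univ _, hz₀.1.le, hz₀.2.le⟩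
  exact ⟨w, (h.fderiv_phiChart hz₀ (mem_extChartAt_source _) w).trans
    (congrArg (dchart (φ z₀) (φ z₀)) hw)⟩

/-- Differentiate `(X - t Y)(φ(θ, s)) = (s - t) Y(φ(θ, s))` at `s = t`: only the derivative of the
factor `s - t` survives. -/
theorem fderiv_shiftChart_phiChart {z₀ : ℝ × ℝ} (hz₀ : z₀.2 ∈ Ioo (-μ) μ) (w : ℝ × ℝ) :
    fderiv ℝ (shiftChart X Y z₀.2 (φ z₀)) (extChartAt (𝓡 3) (φ z₀) (φ z₀))
      (fderiv ℝ (phiChart φ (φ z₀)) z₀ w) = w.2 • dchart (φ z₀) (φ z₀) (vec Y (φ z₀)) := by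
  have hsrc : φ z₀ ∈ (extChartAt (𝓡 3) (φ z₀)).source := mem_extChartAt_source _
  have ha : phiChart φ (φ z₀) z₀ = extChartAt (𝓡 3) (φ z₀) (φ z₀) := rfl
  have htar := mem_extChartAt_target (I := 𝓡 3) (φ z₀)
  have d1 := ((h.contDiffAt_shiftChart z₀.2 htar).differentiableAt one_ne_zero).hasFDerivAt
  have d2 := ((h.contDiffAt_phiChart hz₀ hsrc).differentiableAt one_ne_zero).hasFDerivAt
  have d3 := HasFDerivAt.comp (g := shiftChart X Y z₀.2 (φ z₀)) z₀ d1 d2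
  have dY := ((contDiffAt_inChart h.c1_Y (φ z₀) htar).differentiableAt one_ne_zero).hasFDerivAt
  have d4 := HasFDerivAt.comp (g := inChart Y (φ z₀)) z₀ dY d2
  have d5 : HasFDerivAt (fun z : ℝ × ℝ => z.2 - z₀.2) (ContinuousLinearMap.snd ℝ ℝ ℝ) z₀ :=
    hasFDerivAt_snd.sub_const _
  have d6 := d5.smul d4
  have hev : (shiftChart X Y z₀.2 (φ z₀) ∘ phiChart φ (φ z₀)) =ᶠ[𝓝 z₀]
      fun z => (z.2 - z₀.2) • (inChart Y (φ z₀) ∘ phiChart φ (φ z₀)) z := by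
    filter_upwards [(h.contMDiffAt_phi hz₀).continuousAt.eventually
      (extChartAt_source_mem_nhds (I := 𝓡 3) (φ z₀)), h.mem_nhds_strip hz₀] with z h1 h2
    exact h.shiftChart_phiChart h2.2 h1 _
  have key := DFunLike.congr_fun (d3.unique (d6.congr_of_eventuallyEq hev)) w
  have hYa : inChart Y (φ z₀) (phiChart φ (φ z₀) z₀) = dchart (φ z₀) (φ z₀) (vec Y (φ z₀)) :=
    inChart_extChartAt _ hsrc
  simpa [hYa] using key

/-- `X - t Y` vanishes along the whole orbit `γ_t`. -/
theorem fderiv_shiftChart_Y {p : M} {t : ℝ} (ht : t ∈ Icc (-μ) μ) (hp : p ∈ gam U X Y t) :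
    fderiv ℝ (shiftChart X Y t p) (extChartAt (𝓡 3) p p) (dchart p p (vec Y p)) = 0 := by
  have d1 := ((h.contDiffAt_shiftChart t (mem_extChartAt_target (I := 𝓡 3) p)).differentiableAt
    one_ne_zero).hasFDerivAt
  have d1' : HasFDerivAt (shiftChart X Y t p) (fderiv ℝ (shiftChart X Y t p) (extChartAt (𝓡 3) p p))
      (extChartAt (𝓡 3) p (flow Y p 0)) := by rwa [flow_zero h.c1_Y]
  have d2 := d1'.comp_hasDerivAt (0 : ℝ) (h.hasDerivAt_flow_chart (p := p))
  refine d2.unique ((hasDerivAt_const (0 : ℝ) (0 : E3)).congr_of_eventuallyEq ?_)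
  filter_upwards [h.eventually_flow_mem_source (p := p)] with s hs
  rw [Function.comp_apply, shiftChart_extChartAt hs]
  have h1 : vec X (flow Y p s) - t • vec Y (flow Y p s) = 0 := (h.flow_mem ht hp s).2.2
  rw [h1, map_zero]

theorem dliftChart_dchart {p : M} (hp : p ∈ U) (v : E3) :
    dliftChart Sg p (extChartAt (𝓡 3) p p) (dchart p p v) = 0 ↔ mfderiv (𝓡 3) (𝓡 1) Sg p v = 0 := by
  have h1 := contMDiffAt_lift (p := p) (h.contMDiffAt_Sg hp) (mem_extChartAt_source _)
  rw [dliftChart, fderiv_comp_extChartAt_symm (mem_extChartAt_source p)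
    (h1.mdifferentiableAt (by simp))]
  exact dscalar_lift_eq_zero_iff ((h.contMDiffAt_Sg hp).mdifferentiableAt (by simp)) v

theorem exists_model {z₀ : ℝ × ℝ} (hz₀ : z₀.2 ∈ Ioo (-μ) μ) {p : M} (hp : φ z₀ = p) :
    ∃ (eta om : E3 →L[ℝ] ℝ) (H : E3 → ℝ) (pr : E3 → E3),
      IsCollinearModel ((extChartAt (𝓡 3) p).symm ⁻¹' Col X Y U) (shiftChart X Y z₀.2 p)
        (inChart Y p) (dliftChart Sg p) (extChartAt (𝓡 3) p p) (dchart p p (vec e₁ p))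
        (dchart p p (vec e₂ p)) eta om H pr
        (fderiv ℝ (shiftChart X Y z₀.2 p) (extChartAt (𝓡 3) p p))
        (fderiv ℝ (inChart Y p) (extChartAt (𝓡 3) p p)) ∧
      (∀ w, om (fderiv ℝ (phiChart φ p) z₀ w) = 0) ∧
      ∃ k : ℝ, k ≠ 0 ∧ fderiv ℝ (shiftChart X Y z₀.2 p) (extChartAt (𝓡 3) p p)
        (dchart p p (vec e₁ p)) = k • dchart p p (vec Y p) := by
  subst hp
  set p := φ z₀ with hp
  have hI : z₀.2 ∈ Icc (-μ) μ := ⟨hz₀.1.le, hz₀.2.le⟩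
  have hg : p ∈ gam U X Y z₀.2 := h.phi_mem_gam hI
  have hpU : p ∈ U := hg.1
  have hsrc : p ∈ (extChartAt (𝓡 3) p).source := mem_extChartAt_source _
  have htar := mem_extChartAt_target (I := 𝓡 3) p
  have hbasis := h.basis_chart hpU hsrc
  obtain ⟨wY, hwY⟩ := h.exists_fderiv_phiChart_eq_Y hz₀
  obtain ⟨w₁, hw₁⟩ := h.exists_fderiv_phiChart_eq_e₁ hz₀
  rw [← hp] at hwY hw₁
  obtain ⟨om, H, pr, htube, hom, hdec⟩ := h.exists_isTube hz₀ (e := dchart p p (vec e₂ p))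
    fun w hw => not_forall_mem_range_of_linearIndependent hbasis _ hw₁ hw hwY
  rw [← hp] at htube hom hdec
  obtain ⟨eta, he₁, he₂, heY, hcoord⟩ := exists_coord_of_linearIndependent hbasis
  have hYa : inChart Y p (extChartAt (𝓡 3) p p) = dchart p p (vec Y p) := inChart_extChartAt _ hsrc
  have hL₁ : dliftChart Sg p (extChartAt (𝓡 3) p p) (dchart p p (vec e₁ p)) = 0 :=
    (h.dliftChart_dchart hpU _).2 (h.e₁_fiber p hpU)
  have hL₂ : dliftChart Sg p (extChartAt (𝓡 3) p p) (dchart p p (vec e₂ p)) = 0 :=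
    (h.dliftChart_dchart hpU _).2 (h.e₂_fiber p hpU)
  have hLY : dliftChart Sg p (extChartAt (𝓡 3) p p) (dchart p p (vec Y p)) ≠ 0 :=
    fun h0 => h.transverse p hpU ((h.dliftChart_dchart hpU _).1 h0)
  have hom₁ : om (dchart p p (vec e₁ p)) = 0 := by rw [← hw₁, hom]
  have homY : om (dchart p p (vec Y p)) = 0 := by rw [← hwY, hom]
  refine ⟨eta, om, H, pr, ⟨htube, ?_, ?_, ?_, ?_, ?_, ?_, hL₁, hL₂, hom₁, ?_, he₁, he₂, ?_, ?_⟩,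
    hom, w₁.2, ?_, ?_⟩
  · exact (h.contDiffAt_shiftChart z₀.2 htar).hasStrictFDerivAt one_ne_zero
  · exact (contDiffAt_inChart h.c1_Y p htar).hasStrictFDerivAt one_ne_zero
  · rw [shiftChart_extChartAt hsrc]
    have h1 : vec X p - z₀.2 • vec Y p = 0 := hg.2
    rw [h1, map_zero]
  · refine eventually_of_eventually_extChartAt ?_
    filter_upwards [extChartAt_source_mem_nhds (I := 𝓡 3) p] with q hq hqC
    rw [mem_preimage, (extChartAt (𝓡 3) p).left_inv hq] at hqC
    obtain ⟨z, hz, rfl⟩ := h.exists_phi_eq hqC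
    exact ⟨_, h.shiftChart_phiChart hz hq _⟩
  · have h1 := contDiffAt_comp_extChartAt_symm (contMDiffAt_lift (p := p) (h.contMDiffAt_Sg hpU)
      (mem_extChartAt_source _))
    exact h1.continuousAt_fderiv (by simp)
  · rwa [hYa]
  · rwa [hYa]
  · rwa [hYa]
  · intro v
    obtain ⟨y, z, hyz⟩ := hcoord v
    rw [hYa]
    have h1 := congrArg om hyz
    have h2 := congrArg (dliftChart Sg p (extChartAt (𝓡 3) p p)) hyz
    simp only [map_add, map_smul, hom₁, homY, htube.apply_eq_one, hL₁, hL₂, smul_eq_mul, mul_zero,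
      zero_add, add_zero, mul_one] at h1 h2
    rw [h1, h2, mul_div_cancel_right₀ _ hLY]
    exact hyz
  -- Here `k` is the `s`-component of `e₁`. The `s`-component of `Y` is `0`, since `B Y = 0`; if
  -- that of `e₁` vanished too, `e₁` would be a multiple of `Y`.
  · intro h0
    have hY0 := h.fderiv_shiftChart_phiChart hz₀ wY
    rw [← hp, hwY, h.fderiv_shiftChart_Y hI hg] at hY0
    have hYne : dchart p p (vec Y p) ≠ 0 := fun h0 => hLY (by rw [h0, map_zero])
    have hwY2 : wY.2 = 0 := (smul_eq_zero.1 hY0.symm).resolve_right hYne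
    have hwY1 : wY.1 ≠ 0 := by
      intro h1
      refine hYne ?_
      rw [← hwY, show wY = 0 from Prod.ext h1 hwY2, map_zero]
    have h1 : w₁ = (w₁.1 / wY.1) • wY := by
      refine Prod.ext ?_ ?_
      · simp [div_mul_cancel₀ _ hwY1]
      · simp [h0, hwY2]
    rw [h1, map_smul, hwY] at hw₁
    have h2 : eta (dchart p p (vec e₁ p)) = 0 := by rw [← hw₁, map_smul, heY, smul_zero]
    rw [he₁] at h2
    exact one_ne_zero h2
  · rw [← hw₁]
    exact h.fderiv_shiftChart_phiChart hz₀ w₁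

end IsAnnulus

end

section

variable {M : Type*} [TopologicalSpace M] [ChartedSpace E3 M] [IsManifold (𝓡 3) ∞ M] [T2Space M]
  {U : Set M} {X Y : ∀ x : M, TangentSpace (𝓡 3) x} {Sg : M → Circle}
  {e₁ e₂ : ∀ x : M, TangentSpace (𝓡 3) x} {μ : ℝ} {φ : ℝ × ℝ → M}

/-! ### Transport along the flow -/

/-- The determinant of three vectors. -/
def det3 (u v w : E3) : ℝ :=
  u 0 * v 1 * w 2 - u 0 * v 2 * w 1 - u 1 * v 0 * w 2 + u 1 * v 2 * w 0 + u 2 * v 0 * w 1 -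
    u 2 * v 1 * w 0

theorem det3_ne_zero {u v w : E3} (h : LinearIndependent ℝ ![u, v, w]) : det3 u v w ≠ 0 := by
  have h1 := h.map' (WithLp.linearEquiv 2 ℝ (Fin 3 → ℝ)).toLinearMap (LinearEquiv.ker _)
  set A : Matrix (Fin 3) (Fin 3) ℝ := fun i j => ![u, v, w] i j with hA
  have h2 : LinearIndependent ℝ A.row := h1
  have h3 := (Matrix.isUnit_iff_isUnit_det A).1 (Matrix.linearIndependent_rows_iff_isUnit.1 h2)
  rw [Matrix.det_fin_three] at h3
  exact h3.ne_zero

/-- Cramer's rule, by which a coefficient in a moving frame is seen to vary continuously. -/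
theorem det3_combination (u v w : E3) (x y z : ℝ) :
    det3 u (x • u + y • v + z • w) w = y * det3 u v w := by
  simp only [det3, PiLp.add_apply, PiLp.smul_apply, smul_eq_mul]
  ring

theorem _root_.ContinuousAt.det3 {u v w : ℝ → E3} {s : ℝ} (hu : ContinuousAt u s)
    (hv : ContinuousAt v s) (hw : ContinuousAt w s) :
    ContinuousAt (fun s => det3 (u s) (v s) (w s)) s := by
  unfold CommutingFields.det3
  have key : ∀ {f : ℝ → E3} (i : Fin 3), ContinuousAt f s → ContinuousAt (fun s => f s i) s :=
    fun i hf => (EuclideanSpace.proj (𝕜 := ℝ) i).continuous.continuousAt.comp hf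
  have u0 := key 0 hu
  have u1 := key 1 hu
  have u2 := key 2 hu
  have v0 := key 0 hv
  have v1 := key 1 hv
  have v2 := key 2 hv
  have w0 := key 0 hw
  have w1 := key 1 hw
  have w2 := key 2 hw
  fun_prop

theorem dflow_self (hY : IsC1Field Y) {p : M} {s : ℝ} (hd : FlowDef Y p s) :
    dflow Y p s (vec Y p) = vec Y (flow Y p s) :=
  (flowsCommute_self hY).dflow_apply hY hY hd

/-- `dflow` is the partial differential in space of the flow, which is C¹ jointly in space and time;
hence it is continuous in time. -/
theorem continuousAt_dflow_chart (hY : IsC1Field Y) {p q : M} {s : ℝ} (hd : FlowDef Y p s)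
    (hq : flow Y p s ∈ (extChartAt (𝓡 3) q).source) (v : E3) :
    ContinuousAt (fun s => dchart q (flow Y p s) (dflow Y p s v)) s := by
  set a := extChartAt (𝓡 3) p p with ha
  have hsrc : p ∈ (extChartAt (𝓡 3) p).source := mem_extChartAt_source p
  set F : E3 × ℝ → E3 := fun z =>
    extChartAt (𝓡 3) q (flow Y ((extChartAt (𝓡 3) p).symm z.1) z.2) with hF
  have hFc : ContDiffAt ℝ 1 F (a, s) := by
    rw [← contMDiffAt_iff_contDiffAt]
    have h1 : ContMDiffAt 𝓘(ℝ, E3 × ℝ) (𝓡 3) 1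
        (fun z : E3 × ℝ => (extChartAt (𝓡 3) p).symm z.1) (a, s) :=
      ContMDiffAt.comp (I' := 𝓘(ℝ, E3)) (a, s)
        (contMDiffAt_extChartAt_symm (mem_extChartAt_target (I := 𝓡 3) p) 1)
        contDiffAt_fst.contMDiffAt
    have h2 : ContMDiffAt 𝓘(ℝ, E3 × ℝ) ((𝓡 3).prod 𝓘(ℝ, ℝ)) 1
        (fun z : E3 × ℝ => ((extChartAt (𝓡 3) p).symm z.1, z.2)) (a, s) :=
      h1.prodMk contDiffAt_snd.contMDiffAt
    have h3 : ContMDiffAt ((𝓡 3).prod 𝓘(ℝ, ℝ)) 𝓘(ℝ, E3) 1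
        (fun z : M × ℝ => extChartAt (𝓡 3) q (flow Y z.1 z.2)) (p, s) :=
      ContMDiffAt.comp (p, s) (contMDiffAt_extChartAt_of_mem hq 1) (hd.regular hY).1
    have h4 : ContMDiffAt ((𝓡 3).prod 𝓘(ℝ, ℝ)) 𝓘(ℝ, E3) 1
        (fun z : M × ℝ => extChartAt (𝓡 3) q (flow Y z.1 z.2))
        ((extChartAt (𝓡 3) p).symm (a, s).1, (a, s).2) := by
      simp only [ha, extChartAt_to_inv]
      exact h3
    exact ContMDiffAt.comp (g := fun z : M × ℝ => extChartAt (𝓡 3) q (flow Y z.1 z.2))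
      (f := fun z : E3 × ℝ => ((extChartAt (𝓡 3) p).symm z.1, z.2)) (a, s) h4 h2
  have hd' : ∀ᶠ σ in 𝓝 s, FlowDef Y p σ :=
    ((continuous_const.prodMk continuous_id).tendsto' s (p, s) rfl).eventually (hd.regular hY).2
  have hsrc' : ∀ᶠ σ in 𝓝 s, flow Y p σ ∈ (extChartAt (𝓡 3) q).source :=
    (hd.hasMFDerivAt hY).continuousAt.eventually
      ((isOpen_extChartAt_source (I := 𝓡 3) q).mem_nhds hq)
  have hpair : Tendsto (fun σ : ℝ => (a, σ)) (𝓝 s) (𝓝 (a, s)) :=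
    (continuous_const.prodMk continuous_id).tendsto' _ _ rfl
  have hdiff : ∀ᶠ σ in 𝓝 s, DifferentiableAt ℝ F (a, σ) :=
    hpair.eventually ((hFc.eventually (by simp)).mono fun z hz => hz.differentiableAt one_ne_zero)
  have hcont : ContinuousAt (fun σ => fderiv ℝ F (a, σ) (dchart p p v, 0)) s := by
    have h1 : ContinuousAt (fun σ => fderiv ℝ F (a, σ)) s :=
      ContinuousAt.comp (g := fderiv ℝ F) (hFc.continuousAt_fderiv one_ne_zero) hpair
    exact h1.clm_apply continuousAt_const
  refine hcont.congr ?_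
  filter_upwards [hd', hsrc', hdiff] with σ h1 h2 h3
  have h4 := fderiv_mapInChart hsrc h2
    ((h1.contMDiffAt hY).mdifferentiableAt one_ne_zero) v
  have h5 : HasFDerivAt (mapInChart (fun z => flow Y z σ) p q)
      ((fderiv ℝ F (a, σ)).comp (ContinuousLinearMap.inl ℝ E3 ℝ)) a :=
    HasFDerivAt.comp (g := F) (f := fun e => (e, σ)) a h3.hasFDerivAt (hasFDerivAt_prodMk_left a σ)
  rw [h5.fderiv] at h4
  exact h4

/-- The time `s` map carries both `X - t Y` and `Y` to themselves, so avoidance at the end of an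
orbit arc pulls back to its start. One point of `γ_t` thus decides for all of them. -/
theorem FlowsCommute.avoid_of_flow (hX : IsC1Field X) (hY : IsC1Field Y) (hc : FlowsCommute X Y)
    {t : ℝ} {p p' : M} {s : ℝ} (hd : FlowDef Y p s) (hp' : flow Y p s = p') {v : E3}
    (hav : Avoid (shiftChart X Y t p') (inChart Y p') (extChartAt (𝓡 3) p' p')
      (dchart p' p' (dflow Y p s v))) :
    Avoid (shiftChart X Y t p) (inChart Y p) (extChartAt (𝓡 3) p p) (dchart p p v) := by
  subst hp'
  set p' := flow Y p s with hp'
  have hr : ContMDiffAt (𝓡 3) 𝓘(ℝ, ℝ) 1 (fun _ : M => s) p := contMDiffAt_const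
  have hsrc : p ∈ (extChartAt (𝓡 3) p).source := mem_extChartAt_source p
  have hsrc' : p' ∈ (extChartAt (𝓡 3) p').source := mem_extChartAt_source p'
  have hG := contMDiffAt_flowMap hY (r := fun _ => s) hd hr
  have hGa : mapInChart (flowMap Y fun _ => s) p p' (extChartAt (𝓡 3) p p) =
      extChartAt (𝓡 3) p' p' := mapInChart_extChartAt _ hsrc
  have hX' := hc.eventually_inChart hX hY (p' := p') (r := fun _ => s) hd hr hsrc'
  have hY' := (flowsCommute_self hY).eventually_inChart hY hY (p' := p') (r := fun _ => s) hd hr hsrc'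
  have hder : fderiv ℝ (mapInChart (flowMap Y fun _ => s) p p') (extChartAt (𝓡 3) p p)
      (dchart p p v) = dchart p' p' (dflow Y p s v) :=
    fderiv_mapInChart hsrc hsrc' (hG.mdifferentiableAt one_ne_zero) v
  refine Avoid.pullback (V := shiftChart X Y t p') (Y := inChart Y p')
    (G := mapInChart (flowMap Y fun _ => s) p p') (contDiffAt_mapInChart hsrc hsrc' hG) ?_ ?_ ?_
  · filter_upwards [hX', hY'] with y h1 h2
    simp only [fderiv_fun_const, Pi.zero_apply, zero_apply, zero_smul, sub_zero] at h1 h2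
    simp only [shiftChart, h1, h2, map_sub, map_smul]
  · filter_upwards [hY'] with y h2
    simpa using h2
  · rw [hGa, hder]
    exact hav

namespace IsAnnulus

variable (h : IsAnnulus U X Y Sg e₁ e₂ μ φ)

include h

/-- The flow preserves the tangent planes of the annulus. -/
theorem dflow_e₁ {t : ℝ} (ht : t ∈ Ioo (-μ) μ) {p : M} (hp : p ∈ gam U X Y t) (s : ℝ) :
    ∃ k l : ℝ, k ≠ 0 ∧
      dflow Y p s (vec e₁ p) = k • vec e₁ (flow Y p s) + l • vec Y (flow Y p s) := by
  have hI : t ∈ Icc (-μ) μ := ⟨ht.1.le, ht.2.le⟩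
  obtain ⟨hd, hp'⟩ := h.flow_mem hI hp s
  set p' := flow Y p s with hp'_def
  obtain ⟨θ, rfl⟩ := h.exists_phi_eq_of_mem_gam hI hp
  obtain ⟨θ', hθ'⟩ := h.exists_phi_eq_of_mem_gam hI hp'
  obtain ⟨eta, om, H, pr, hmod, -, -⟩ := h.exists_model (z₀ := (θ', t)) ht hθ'
  obtain ⟨w, hw⟩ := h.exists_fderiv_phiChart_eq_e₁ (z₀ := (θ, t)) ht
  set p := φ (θ, t) with hp_def
  have hsrc : p ∈ (extChartAt (𝓡 3) p).source := mem_extChartAt_source p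
  have hsrc' : p' ∈ (extChartAt (𝓡 3) p').source := mem_extChartAt_source p'
  have hsm := (hd.contMDiffAt h.c1_Y)
  -- the image under the flow of a curve in the annulus
  have hline : HasDerivAt (fun σ : ℝ => ((θ, t) : ℝ × ℝ) + σ • w) w 0 := by
    simpa using ((hasDerivAt_id (0 : ℝ)).smul_const w).const_add ((θ, t) : ℝ × ℝ)
  have hline0 : ((θ, t) : ℝ × ℝ) + (0 : ℝ) • w = (θ, t) := by simp
  have d1 : HasFDerivAt (phiChart φ p) (fderiv ℝ (phiChart φ p) (θ, t))
      (((θ, t) : ℝ × ℝ) + (0 : ℝ) • w) := by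
    rw [hline0]
    exact ((h.contDiffAt_phiChart (z₀ := (θ, t)) ht hsrc).differentiableAt one_ne_zero).hasFDerivAt
  have d2 := d1.comp_hasDerivAt (0 : ℝ) hline
  have d3 : HasFDerivAt (mapInChart (fun z => flow Y z s) p p')
      (fderiv ℝ (mapInChart (fun z => flow Y z s) p p') (extChartAt (𝓡 3) p p))
      ((phiChart φ p ∘ fun σ : ℝ => ((θ, t) : ℝ × ℝ) + σ • w) 0) := by
    rw [Function.comp_apply, hline0]
    exact ((contDiffAt_mapInChart hsrc hsrc' hsm).differentiableAt one_ne_zero).hasFDerivAt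
  have d4 := d3.comp_hasDerivAt (0 : ℝ) d2
  rw [hw, fderiv_mapInChart hsrc hsrc' (hsm.mdifferentiableAt one_ne_zero)] at d4
  have hφt : Tendsto (fun σ : ℝ => ((θ, t) : ℝ × ℝ) + σ • w) (𝓝 0) (𝓝 (θ, t)) := by
    have := hline.continuousAt.tendsto
    rwa [hline0] at this
  have hφc := (h.contMDiffAt_phi (z₀ := (θ, t)) ht).continuousAt
  -- The image of a curve in the annulus stays in the annulus, so its velocity has no `e₂`
  -- component.
  have hom0 := hmod.tube.om_eq_zero d4 (by
      simp only [Function.comp_apply, hline0]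
      exact mapInChart_extChartAt _ hsrc) (by
    filter_upwards [hφt.eventually (h.mem_nhds_strip (z₀ := (θ, t)) ht),
      hφt.eventually (hφc.eventually (extChartAt_source_mem_nhds (I := 𝓡 3) p)),
      hφt.eventually (hφc.eventually (hsm.continuousAt.eventually
        (extChartAt_source_mem_nhds (I := 𝓡 3) p')))] with σ h1 h2 h3
    simp only [Function.comp_apply, phiChart]
    rw [mapInChart_extChartAt _ h2, mem_preimage, (extChartAt (𝓡 3) p').left_inv h3]
    exact h.gam_subset_col h1.2 (h.flow_mem h1.2 (h.phi_mem_gam h1.2) s).2)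
  set v : E3 := dflow Y p s (vec e₁ p) with hv
  have hom0' : om (dchart p' p' v) = 0 := hom0
  have hfr := hmod.frame (dchart p' p' v)
  rw [hom0', zero_smul, add_zero, inChart_extChartAt _ hsrc', ← map_smul, ← map_smul, ← map_add] at hfr
  obtain ⟨l, hl⟩ : ∃ l : ℝ, v = eta (dchart p' p' v) • vec e₁ p' + l • vec Y p' :=
    ⟨_, dchart_injective hsrc' hfr⟩
  refine ⟨_, l, ?_, hl⟩
  -- If `k` were `0`, then `e₁` and a multiple of `Y` would have the same image under the injective
  -- `dflow`.
  intro h0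
  rw [h0, zero_smul, zero_add, hp'_def, ← dflow_self h.c1_Y hd, ← map_smul] at hl
  have h5 := dflow_injective h.c1_Y hd hl
  have h6 := Fintype.linearIndependent_iff.1 (h.basis p hp.1) ![1, 0, -l] (by
    rw [Fin.sum_univ_three]
    change (1 : ℝ) • vec e₁ p + (0 : ℝ) • vec e₂ p + -l • vec Y p = 0
    rw [h5]
    module) 0
  exact one_ne_zero h6

theorem mem_span_frame {p : M} (hp : p ∈ U) (v : E3) :
    ∃ x y z : ℝ, v = x • vec e₁ p + y • vec e₂ p + z • vec Y p := by
  obtain ⟨eta, -, -, -, hx⟩ := exists_coord_of_linearIndependent (h.basis p hp)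
  obtain ⟨y, z, hyz⟩ := hx v
  exact ⟨_, _, _, hyz⟩

/-- The flow preserves the orientation of the planes transverse to `Y`. -/
theorem dflow_e₂ {t : ℝ} (ht : t ∈ Ioo (-μ) μ) {p : M} (hp : p ∈ gam U X Y t) (s : ℝ) :
    ∃ x y z : ℝ, 0 < y ∧ dflow Y p s (vec e₂ p) =
      x • vec e₁ (flow Y p s) + y • vec e₂ (flow Y p s) + z • vec Y (flow Y p s) := by
  have hI : t ∈ Icc (-μ) μ := ⟨ht.1.le, ht.2.le⟩
  have hmem := fun σ => h.flow_mem hI hp σ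
  choose x y z hxyz using fun σ => h.mem_span_frame (hmem σ).2.1 (dflow Y p σ (vec e₂ p))
  refine ⟨x s, y s, z s, ?_, hxyz s⟩
  have hy0 : y 0 = 1 := by
    have h1 := hxyz 0
    rw [dflow_zero h.c1_Y, flow_zero h.c1_Y] at h1
    have h2 := Fintype.linearIndependent_iff.1 (h.basis p hp.1) ![x 0, y 0 - 1, z 0] (by
      rw [Fin.sum_univ_three]
      change x 0 • vec e₁ p + (y 0 - 1) • vec e₂ p + z 0 • vec Y p = 0
      have h3 : vec e₂ p = x 0 • vec e₁ p + y 0 • vec e₂ p + z 0 • vec Y p := h1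
      rw [sub_smul, one_smul]
      nth_rewrite 2 [h3]
      abel) 1
    exact sub_eq_zero.1 h2
  -- The flow already maps the plane of `e₁, Y` onto that at the new point, so an image of `e₂` in
  -- the latter would contradict injectivity.
  have hyne : ∀ σ, y σ ≠ 0 := by
    intro σ h0
    obtain ⟨k, l, hk, hkl⟩ := h.dflow_e₁ ht hp σ
    have hYσ := dflow_self h.c1_Y (hmem σ).1
    have h1 := hxyz σ
    rw [h0, zero_smul, add_zero] at h1
    have h2 : dflow Y p σ (vec e₂ p) =
        dflow Y p σ ((x σ / k) • vec e₁ p + (z σ - x σ / k * l) • vec Y p) := by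
      rw [map_add, map_smul, map_smul, hkl, hYσ, h1, smul_add, smul_smul, smul_smul,
        div_mul_cancel₀ _ hk]
      module
    have h3 := dflow_injective h.c1_Y (hmem σ).1 h2
    have h4 := Fintype.linearIndependent_iff.1 (h.basis p hp.1)
      ![x σ / k, -1, z σ - x σ / k * l] (by
        rw [Fin.sum_univ_three]
        change (x σ / k) • vec e₁ p + (-1 : ℝ) • vec e₂ p + (z σ - x σ / k * l) • vec Y p = 0
        rw [h3]
        module) 1
    exact (neg_ne_zero.2 one_ne_zero) h4
  have hcont : Continuous y := by
    refine continuous_iff_continuousAt.2 fun σ₀ => ?_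
    set q := flow Y p σ₀ with hq
    have hqs : q ∈ (extChartAt (𝓡 3) q).source := mem_extChartAt_source q
    have hfc : ContinuousAt (flow Y p) σ₀ := ((hmem σ₀).1.hasMFDerivAt h.c1_Y).continuousAt
    have hfield : ∀ {w : ∀ x : M, TangentSpace (𝓡 3) x}, IsC0FieldOn w U →
        ContinuousAt (fun σ => dchart q (flow Y p σ) (vec w (flow Y p σ))) σ₀ := by
      intro w hw
      have h1 := hw.continuousWithinAt_dchart (hmem σ₀).2.1 hqs
      have h2 : Tendsto (flow Y p) (𝓝 σ₀) (𝓝[U] q) :=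
        tendsto_nhdsWithin_iff.2 ⟨hfc, Eventually.of_forall fun σ => (hmem σ).2.1⟩
      exact Tendsto.comp h1 h2
    have c₁ := hfield h.continuous_e₁
    have c₂ := hfield h.continuous_e₂
    have cY : ContinuousAt (fun σ => dchart q (flow Y p σ) (vec Y (flow Y p σ))) σ₀ :=
      ContinuousAt.comp (g := fun z => dchart q z (vec Y z)) (h.c1_Y.continuousAt_dchart hqs) hfc
    have cd := continuousAt_dflow_chart h.c1_Y (hmem σ₀).1 hqs (vec e₂ p)
    have hg := c₁.det3 c₂ cY
    have hgne := det3_ne_zero (h.basis_chart (hmem σ₀).2.1 hqs)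
    refine ((c₁.det3 cd cY).div hg hgne).congr ?_
    filter_upwards [hg.eventually_ne hgne] with σ hσ
    simp only [Pi.div_apply]
    rw [hxyz σ, map_add, map_add, map_smul, map_smul, map_smul, det3_combination,
      mul_div_cancel_right₀ _ hσ]
  -- The coefficient is continuous in time, never zero, and `1` at time `0`.
  by_contra hneg
  obtain ⟨σ, hσ⟩ := mem_range_of_exists_le_of_exists_ge hcont ⟨s, not_lt.1 hneg⟩
    ⟨0, by rw [hy0]; exact zero_le_one⟩
  exact hyne σ hσ

end IsAnnulus

end

section

variable {M : Type*} [TopologicalSpace M] [ChartedSpace E3 M] [IsManifold (𝓡 3) ∞ M] [T2Space M]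
  {U : Set M} {X Y : ∀ x : M, TangentSpace (𝓡 3) x} {Sg : M → Circle}
  {e₁ e₂ : ∀ x : M, TangentSpace (𝓡 3) x} {μ : ℝ} {φ : ℝ × ℝ → M}

/-! ### The differential of a return map -/

namespace IsAnnulus

section

variable (h : IsAnnulus U X Y Sg e₁ e₂ μ φ)

include h

/-- A map along the flow that preserves the fibers of `Sg` fixes the points of the annulus. -/
theorem flowMap_eq_self {r : M → ℝ} {q : M} (hq : q ∈ Col X Y U) (hS : Sg (flowMap Y r q) = Sg q) :
    flowMap Y r q = q := by
  obtain ⟨z, hz, rfl⟩ := h.exists_phi_eq hq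
  have hg := h.phi_mem_gam hz
  exact (h.unique z.2 hz (Sg (φ z))).unique ⟨(h.flow_mem hz hg _).2, hS⟩ ⟨hg, rfl⟩

variable {z₀ : ℝ × ℝ} (hz₀ : z₀.2 ∈ Ioo (-μ) μ) {p : M} (hp : φ z₀ = p) {r : M → ℝ}
  (hr : ContMDiffAt (𝓡 3) 𝓘(ℝ, ℝ) 1 r p) (hrp : flowMap Y r p = p)
  (hS : ∀ᶠ q in 𝓝 p, Sg (flowMap Y r q) = Sg q)

include hz₀ hp

theorem mem_gam : p ∈ gam U X Y z₀.2 := hp ▸ h.phi_mem_gam ⟨hz₀.1.le, hz₀.2.le⟩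

theorem flowDef (s : ℝ) : FlowDef Y p s :=
  (h.flow_mem ⟨hz₀.1.le, hz₀.2.le⟩ (h.mem_gam hz₀ hp) s).1

include hr hrp hS

theorem flowMap_self_mem_source : flowMap Y r p ∈ (extChartAt (𝓡 3) p).source := by
  rw [hrp]; exact mem_extChartAt_source p

theorem contDiffAt_return :
    ContDiffAt ℝ 1 (mapInChart (flowMap Y r) p p) (extChartAt (𝓡 3) p p) :=
  contDiffAt_mapInChart (mem_extChartAt_source p) (h.flowMap_self_mem_source hz₀ hp hr hrp hS)
    (contMDiffAt_flowMap h.c1_Y (h.flowDef hz₀ hp _) hr)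

theorem return_self : mapInChart (flowMap Y r) p p (extChartAt (𝓡 3) p p) =
    extChartAt (𝓡 3) p p := by
  rw [mapInChart_extChartAt _ (mem_extChartAt_source p), hrp]

/-- The return map fixes the annulus, so composing it with the parametrisation changes nothing near
`z₀`; differentiate. -/
theorem return_apply_phiChart (w : ℝ × ℝ) :
    fderiv ℝ (mapInChart (flowMap Y r) p p) (extChartAt (𝓡 3) p p)
      (fderiv ℝ (phiChart φ p) z₀ w) = fderiv ℝ (phiChart φ p) z₀ w := by
  have hsrc : φ z₀ ∈ (extChartAt (𝓡 3) p).source := by rw [hp]; exact mem_extChartAt_source p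
  have hφ := (h.contMDiffAt_phi hz₀).continuousAt
  have d1 := ((h.contDiffAt_phiChart hz₀ hsrc).differentiableAt one_ne_zero).hasFDerivAt
  have d2 : HasFDerivAt (mapInChart (flowMap Y r) p p)
      (fderiv ℝ (mapInChart (flowMap Y r) p p) (extChartAt (𝓡 3) p p)) (phiChart φ p z₀) := by
    rw [phiChart, hp]
    exact ((h.contDiffAt_return hz₀ hp hr hrp hS).differentiableAt one_ne_zero).hasFDerivAt
  have d3 := HasFDerivAt.comp z₀ d2 d1
  refine DFunLike.congr_fun (d3.unique (d1.congr_of_eventuallyEq ?_)) w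
  filter_upwards [hφ.eventually ((isOpen_extChartAt_source (I := 𝓡 3) p).mem_nhds hsrc),
    h.mem_nhds_strip hz₀, hφ.eventually (p := fun q => Sg (flowMap Y r q) = Sg q) (by rwa [hp])]
    with z h1 h2 h3
  rw [Function.comp_apply, phiChart, mapInChart_extChartAt _ h1,
    h.flowMap_eq_self (h.phi_mem_col h2.2) h3]

theorem eventually_return_shiftChart : ∀ᶠ y in 𝓝 (extChartAt (𝓡 3) p p),
    shiftChart X Y z₀.2 p (mapInChart (flowMap Y r) p p y) =
      fderiv ℝ (mapInChart (flowMap Y r) p p) y (shiftChart X Y z₀.2 p y) -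
      fderiv ℝ (fun y => r ((extChartAt (𝓡 3) p).symm y)) y (shiftChart X Y z₀.2 p y) •
        inChart Y p (mapInChart (flowMap Y r) p p y) := by
  have hsrc := h.flowMap_self_mem_source hz₀ hp hr hrp hS
  have hd := h.flowDef hz₀ hp (r p)
  filter_upwards [h.commute.eventually_inChart h.c1_X h.c1_Y hd hr hsrc,
    (flowsCommute_self h.c1_Y).eventually_inChart h.c1_Y h.c1_Y hd hr hsrc] with y h1 h2
  simp only [shiftChart, map_sub, map_smul]
  rw [h1, sub_eq_iff_eq_add.1 h2.symm]
  module

theorem eventually_return_Y : ∀ᶠ y in 𝓝 (extChartAt (𝓡 3) p p),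
    fderiv ℝ (mapInChart (flowMap Y r) p p) y (inChart Y p y) =
      (1 + fderiv ℝ (fun y => r ((extChartAt (𝓡 3) p).symm y)) y (inChart Y p y)) •
        inChart Y p (mapInChart (flowMap Y r) p p y) := by
  have hsrc := h.flowMap_self_mem_source hz₀ hp hr hrp hS
  have hd := h.flowDef hz₀ hp (r p)
  filter_upwards [(flowsCommute_self h.c1_Y).eventually_inChart h.c1_Y h.c1_Y hd hr hsrc] with y h2
  rw [add_smul, one_smul]
  exact sub_eq_iff_eq_add.1 h2.symm

theorem eventually_dliftChart_return : ∀ᶠ y in 𝓝 (extChartAt (𝓡 3) p p), ∀ v,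
    dliftChart Sg p (mapInChart (flowMap Y r) p p y)
      (fderiv ℝ (mapInChart (flowMap Y r) p p) y v) = dliftChart Sg p y v := by
  have hpU : p ∈ U := (h.mem_gam hz₀ hp).1
  have hR := h.contDiffAt_return hz₀ hp hr hrp hS
  have hS1 := contDiffAt_comp_extChartAt_symm (n := 1)
    ((contMDiffAt_lift (p := p) (h.contMDiffAt_Sg hpU) (mem_extChartAt_source _)).of_le
      (by exact_mod_cast le_top))
  have hdS := (hS1.eventually (by simp)).mono fun y hy => hy.differentiableAt one_ne_zero
  have hdR := (hR.eventually (by simp)).mono fun y hy => hy.differentiableAt one_ne_zero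
  have hRt : Tendsto (mapInChart (flowMap Y r) p p) (𝓝 (extChartAt (𝓡 3) p p))
      (𝓝 (extChartAt (𝓡 3) p p)) := by
    have := hR.continuousAt.tendsto
    rwa [h.return_self hz₀ hp hr hrp hS] at this
  have hinv : ∀ᶠ y in 𝓝 (extChartAt (𝓡 3) p p),
      lift Sg p ((extChartAt (𝓡 3) p).symm (mapInChart (flowMap Y r) p p y)) =
        lift Sg p ((extChartAt (𝓡 3) p).symm y) := by
    refine eventually_of_eventually_extChartAt ?_
    have hc := (contMDiffAt_flowMap h.c1_Y (h.flowDef hz₀ hp _) hr).continuousAt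
    filter_upwards [extChartAt_source_mem_nhds (I := 𝓡 3) p, hS,
      hc.eventually ((isOpen_extChartAt_source (I := 𝓡 3) p).mem_nhds
        (h.flowMap_self_mem_source hz₀ hp hr hrp hS))] with q h1 h2 h3
    rw [mapInChart_extChartAt _ h1, (extChartAt (𝓡 3) p).left_inv h1,
      (extChartAt (𝓡 3) p).left_inv h3, lift, lift, h2]
  filter_upwards [hinv.eventually_nhds, hdS, hRt.eventually hdS, hdR] with y h1 h2 h3 h4 v
  have d1 := HasFDerivAt.comp (g := fun y => lift Sg p ((extChartAt (𝓡 3) p).symm y)) y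
    h3.hasFDerivAt h4.hasFDerivAt
  exact DFunLike.congr_fun (d1.unique (h2.hasFDerivAt.congr_of_eventuallyEq h1)) v

/-- The differential of a return map is the identity at the points of the open annulus. -/
theorem fderiv_return_eq_id :
    fderiv ℝ (mapInChart (flowMap Y r) p p) (extChartAt (𝓡 3) p p) =
      ContinuousLinearMap.id ℝ E3 := by
  have hI : z₀.2 ∈ Icc (-μ) μ := ⟨hz₀.1.le, hz₀.2.le⟩
  have hg := h.mem_gam hz₀ hp
  have hsrc : p ∈ (extChartAt (𝓡 3) p).source := mem_extChartAt_source p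
  have hYa : inChart Y p (extChartAt (𝓡 3) p p) = dchart p p (vec Y p) := inChart_extChartAt _ hsrc
  obtain ⟨eta, om, H, pr, hmod, -, k, hk, hBk⟩ := h.exists_model hz₀ hp
  obtain ⟨wY, hwY⟩ := h.exists_fderiv_phiChart_eq_Y hz₀
  obtain ⟨w₁, hw₁⟩ := h.exists_fderiv_phiChart_eq_e₁ hz₀
  rw [hp] at hwY hw₁
  set R := mapInChart (flowMap Y r) p p with hR
  set a := extChartAt (𝓡 3) p p with ha
  have hA₁ : fderiv ℝ R a (dchart p p (vec e₁ p)) = dchart p p (vec e₁ p) := by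
    rw [← hw₁]; exact h.return_apply_phiChart hz₀ hp hr hrp hS w₁
  have hAY : fderiv ℝ R a (inChart Y p a) = inChart Y p a := by
    rw [hYa, ← hwY]; exact h.return_apply_phiChart hz₀ hp hr hrp hS wY
  have hRa : R a = a := h.return_self hz₀ hp hr hrp hS
  have hL := (h.eventually_dliftChart_return hz₀ hp hr hrp hS)
  set l := om (fderiv ℝ R a (dchart p p (vec e₂ p))) with hl_def
  set b := eta (fderiv ℝ R a (dchart p p (vec e₂ p))) with hb_def
  have hA₂ : fderiv ℝ R a (dchart p p (vec e₂ p)) =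
      b • dchart p p (vec e₁ p) + l • dchart p p (vec e₂ p) := by
    have h1 := hL.self_of_nhds (dchart p p (vec e₂ p))
    rw [← hR, hRa, hmod.L_e₂] at h1
    have h2 := hmod.frame (fderiv ℝ R a (dchart p p (vec e₂ p)))
    rw [h1, zero_div, zero_smul, add_zero] at h2
    exact h2
  have hret : IsLocalReturn ((extChartAt (𝓡 3) p).symm ⁻¹' Col X Y U) (shiftChart X Y z₀.2 p)
      (inChart Y p) (dliftChart Sg p) a (dchart p p (vec e₁ p)) (dchart p p (vec e₂ p)) R l b := by
    refine ⟨h.contDiffAt_return hz₀ hp hr hrp hS, hRa, ?_, ?_, ?_, hL, hA₁, hA₂, hAY⟩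
    · refine eventually_of_eventually_extChartAt ?_
      filter_upwards [extChartAt_source_mem_nhds (I := 𝓡 3) p, hS] with q h1 h2 h3
      rw [mem_preimage, (extChartAt (𝓡 3) p).left_inv h1] at h3
      rw [hR, mapInChart_extChartAt _ h1, h.flowMap_eq_self h3 h2]
    · filter_upwards [h.eventually_return_shiftChart hz₀ hp hr hrp hS] with y hy
      exact ⟨_, by rw [hy, sub_eq_add_neg, ← neg_smul]⟩
    · exact (h.eventually_return_Y hz₀ hp hr hrp hS).mono fun y hy => ⟨_, hy⟩
  -- The differential of the return map differs from that of the time `r p` flow only by a multiple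
  -- of `Y`, which `om` kills; so `l` is the positive coefficient of `dflow_e₂`.
  have hl : 0 < l := by
    obtain ⟨x, y, z, hy, hxyz⟩ := h.dflow_e₂ hz₀ hg (r p)
    have hrp' : flow Y p (r p) = p := hrp
    rw [hrp'] at hxyz
    have h1 := fderiv_mapInChart hsrc (h.flowMap_self_mem_source hz₀ hp hr hrp hS)
      ((contMDiffAt_flowMap h.c1_Y (h.flowDef hz₀ hp _) hr).mdifferentiableAt one_ne_zero)
      (vec e₂ p)
    have h2 := mfderiv_flowMap_apply h.c1_Y (h.flowDef hz₀ hp (r p))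
      (hr.mdifferentiableAt one_ne_zero) (vec e₂ p)
    rw [hxyz, hrp] at h2
    rw [hrp] at h1
    have h3 : fderiv ℝ R a (dchart p p (vec e₂ p)) = dchart p p (x • vec e₁ p + y • vec e₂ p +
        z • vec Y p + dscalar r p (vec e₂ p) • vec Y p) := h1.trans (congrArg (dchart p p) h2)
    have homY := hmod.om_Y
    rw [hYa] at homY
    rw [hl_def, h3]
    simp only [map_add, map_smul, hmod.om_e₁, hmod.tube.apply_eq_one, homY, smul_eq_mul, mul_zero,
      mul_one, zero_add, add_zero]
    exact hy
  have hr' : ContDiffAt ℝ 1 (fun y => r ((extChartAt (𝓡 3) p).symm y)) a :=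
    contDiffAt_comp_extChartAt_symm (n := 1) hr
  -- The return map sends `Y` to `(1 + dr(Y)) Y` at `a`, and it fixes `Y`.
  have hrY : fderiv ℝ (fun y => r ((extChartAt (𝓡 3) p).symm y)) a (inChart Y p a) = 0 := by
    have h1 := (h.eventually_return_Y hz₀ hp hr hrp hS).self_of_nhds
    rw [← hR, ← ha, hRa, hAY, add_smul, one_smul] at h1
    exact (smul_eq_zero.1 (left_eq_add.1 h1)).resolve_right hmod.Y_ne_zero
  -- The homotopy passes through the fields `X - ρ t Y` with `|ρ t| < μ`, whose zero sets lie in the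
  -- open annulus and hence miss the boundary of `U`.
  have hbd : ∀ ρ ∈ Icc (0 : ℝ) 1, ∀ x ∈ frontier U, vec X x - (ρ * z₀.2) • vec Y x ≠ 0 := by
    intro ρ hρ x hx h0
    have hx' : x ∈ U := h.isCompact.isClosed.frontier_subset hx
    refine (h.disjoint (ρ * z₀.2) ?_).le_bot ⟨⟨hx', h0⟩, hx⟩
    have h1 : |ρ * z₀.2| < μ := by
      rw [abs_mul, abs_of_nonneg hρ.1]
      have h2 : |z₀.2| < μ := abs_lt.2 hz₀
      calc ρ * |z₀.2| ≤ 1 * |z₀.2| := mul_le_mul_of_nonneg_right hρ.2 (abs_nonneg _)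
        _ < μ := by rwa [one_mul]
    exact abs_lt.1 h1
  rcases hret.eq_id_or_avoid hmod hl hk (by rw [hYa]; exact hBk) hr' hrY
    (h.eventually_return_shiftChart hz₀ hp hr hrp hS) with hid | hav | hav
  · exact hid
  -- Avoidance of `e₁` at `p` is carried to every point of `γ_t`, since the flow maps `e₁` to a
  -- nonzero multiple of `e₁` modulo `Y`.
  · exfalso
    refine h.index_ne_zero (poincareHopfIndex_eq_zero_of_avoid h.isCompact h.c1_X h.c1_Y
      h.continuous_e₁ hbd fun p' hp'U hp' => ?_)
    have hp'g : p' ∈ gam U X Y z₀.2 := ⟨hp'U, hp'⟩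
    obtain ⟨s, hs⟩ := h.exists_flow_eq hI hp'g hg
    obtain ⟨k', l', hk', hkl⟩ := h.dflow_e₁ hz₀ hp'g s
    refine h.commute.avoid_of_flow h.c1_X h.c1_Y (h.flow_mem hI hp'g s).1 hs ?_
    rw [hs] at hkl
    rw [hkl, map_add, map_smul, map_smul, ← hYa]
    exact hav.combination hmod.strict_Y.hasFDerivAt.continuousAt hk' l'
  -- Here every direction outside the plane of `e₁, Y` is avoided at `p`, in particular all the
  -- images of `e₂` under the flow, whose `e₂` component is positive.
  · exfalso
    refine h.index_ne_zero (poincareHopfIndex_eq_zero_of_avoid h.isCompact h.c1_X h.c1_Y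
      h.continuous_e₂ hbd fun p' hp'U hp' => ?_)
    have hp'g : p' ∈ gam U X Y z₀.2 := ⟨hp'U, hp'⟩
    obtain ⟨s, hs⟩ := h.exists_flow_eq hI hp'g hg
    obtain ⟨x, y, z, hy, hxyz⟩ := h.dflow_e₂ hz₀ hp'g s
    refine h.commute.avoid_of_flow h.c1_X h.c1_Y (h.flow_mem hI hp'g s).1 hs (hav _ ?_)
    rw [hs] at hxyz
    have hb := Fintype.linearIndependent_iff.1 (h.basis_chart hg.1 hsrc)
    rw [hxyz, hYa, Fintype.linearIndependent_iff]
    intro g hsum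
    rw [Fin.sum_univ_three] at hsum
    change g 0 • dchart p p (vec e₁ p) + g 1 • dchart p p (x • vec e₁ p + y • vec e₂ p + z • vec Y p)
      + g 2 • dchart p p (vec Y p) = 0 at hsum
    have h1 := hb ![g 0 + g 1 * x, g 1 * y, g 2 + g 1 * z] (by
      rw [Fin.sum_univ_three]
      change (g 0 + g 1 * x) • dchart p p (vec e₁ p) + (g 1 * y) • dchart p p (vec e₂ p) +
        (g 2 + g 1 * z) • dchart p p (vec Y p) = 0
      rw [← hsum, map_add, map_add, map_smul, map_smul, map_smul]
      module)
    have h10 : g 0 + g 1 * x = 0 := h1 0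
    have h11 : g 1 * y = 0 := h1 1
    have h12 : g 2 + g 1 * z = 0 := h1 2
    have hg1 : g 1 = 0 := (mul_eq_zero.1 h11).resolve_right hy.ne'
    rw [hg1, zero_mul, add_zero] at h10 h12
    intro i
    fin_cases i
    · exact h10
    · exact hg1
    · exact h12

end

end IsAnnulus

end

section

variable {M : Type*} [TopologicalSpace M] [ChartedSpace E3 M] [IsManifold (𝓡 3) ∞ M] [T2Space M]
  {U : Set M} {X Y : ∀ x : M, TangentSpace (𝓡 3) x} {Sg : M → Circle}
  {e₁ e₂ : ∀ x : M, TangentSpace (𝓡 3) x} {μ : ℝ} {φ : ℝ × ℝ → M}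

/-! ### The return time -/

theorem isInvertible_of_apply_one_ne_zero {A : ℝ →L[ℝ] ℝ} (h : A 1 ≠ 0) : A.IsInvertible :=
  ⟨ContinuousLinearEquiv.unitsEquivAut ℝ (Units.mk0 (A 1) h), by ext; simp⟩

/-- Near a point `x` with `Y_s(x) = x` there is a unique time close to `s` at which an orbit
transverse to the fibers of `Sg` comes back to the same fiber. -/
theorem exists_return_time (hY : IsC1Field Y) {x : M} (hSg : ContMDiffAt (𝓡 3) (𝓡 1) ∞ Sg x)
    (htr : mfderiv (𝓡 3) (𝓡 1) Sg x (Y x) ≠ 0) {s : ℝ} (hd : FlowDef Y x s)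
    (hx : flow Y x s = x) :
    ∃ r : M → ℝ, ContMDiffAt (𝓡 3) 𝓘(ℝ, ℝ) 1 r x ∧ r x = s ∧
      (∀ᶠ q in 𝓝 x, Sg (flowMap Y r q) = Sg q) ∧
      ∀ᶠ z in 𝓝 (x, s), Sg (flow Y z.1 z.2) = Sg z.1 → r z.1 = z.2 := by
  set a := extChartAt (𝓡 3) x x with ha
  have hlift : ContMDiffAt (𝓡 3) 𝓘(ℝ, ℝ) 1 (lift Sg x) x :=
    (contMDiffAt_lift hSg (mem_extChartAt_source _)).of_le (by exact_mod_cast le_top)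
  set g : M × ℝ → ℝ := fun z => lift Sg x (flow Y z.1 z.2) - lift Sg x z.1 with hg
  have hgc : ContMDiffAt ((𝓡 3).prod 𝓘(ℝ, ℝ)) 𝓘(ℝ, ℝ) 1 g (x, s) := by
    have h1 : ContMDiffAt (𝓡 3) 𝓘(ℝ, ℝ) 1 (lift Sg x) (flow Y x s) := by rwa [hx]
    have h2 : ContMDiffAt ((𝓡 3).prod 𝓘(ℝ, ℝ)) 𝓘(ℝ, ℝ) 1
        (fun z : M × ℝ => lift Sg x (flow Y z.1 z.2)) (x, s) :=
      ContMDiffAt.comp (g := lift Sg x) (f := fun z : M × ℝ => flow Y z.1 z.2) (x, s) h1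
        (hd.regular hY).1
    exact h2.sub (ContMDiffAt.comp (g := lift Sg x) (f := fun z : M × ℝ => z.1) (x, s) hlift
      contMDiffAt_fst)
  set f : E3 × ℝ → ℝ := fun z => g ((extChartAt (𝓡 3) x).symm z.1, z.2) with hf
  have hfc : ContDiffAt ℝ 1 f (a, s) := by
    rw [← contMDiffAt_iff_contDiffAt]
    have h1 : ContMDiffAt 𝓘(ℝ, E3 × ℝ) (𝓡 3) 1
        (fun z : E3 × ℝ => (extChartAt (𝓡 3) x).symm z.1) (a, s) :=
      ContMDiffAt.comp (I' := 𝓘(ℝ, E3)) (a, s)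
        (contMDiffAt_extChartAt_symm (mem_extChartAt_target (I := 𝓡 3) x) 1)
        contDiffAt_fst.contMDiffAt
    have h2 : ContMDiffAt 𝓘(ℝ, E3 × ℝ) ((𝓡 3).prod 𝓘(ℝ, ℝ)) 1
        (fun z : E3 × ℝ => ((extChartAt (𝓡 3) x).symm z.1, z.2)) (a, s) :=
      h1.prodMk contDiffAt_snd.contMDiffAt
    have h3 : ContMDiffAt ((𝓡 3).prod 𝓘(ℝ, ℝ)) 𝓘(ℝ, ℝ) 1 g
        ((extChartAt (𝓡 3) x).symm (a, s).1, (a, s).2) := by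
      simp only [ha, extChartAt_to_inv]
      exact hgc
    exact ContMDiffAt.comp (g := g) (f := fun z : E3 × ℝ => ((extChartAt (𝓡 3) x).symm z.1, z.2))
      (a, s) h3 h2
  have hf0 : f (a, s) = 0 := by simp only [hf, hg, ha, extChartAt_to_inv, hx, sub_self]
  -- The time derivative is the derivative of the lift of `Sg` along `Y`; transversality makes it
  -- nonzero, so the implicit function theorem applies.
  have hpart : fderiv ℝ f (a, s) (0, 1) = dscalar (lift Sg x) x (vec Y x) := by
    have h1 : HasDerivAt (fun σ : ℝ => f (a, σ)) (fderiv ℝ f (a, s) (0, 1)) s := by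
      have h2 : HasDerivAt (fun σ : ℝ => ((a, σ) : E3 × ℝ)) (0, 1) s :=
        (hasDerivAt_const s a).prodMk (hasDerivAt_id s)
      exact HasFDerivAt.comp_hasDerivAt (l := f) s
        (hfc.differentiableAt one_ne_zero).hasFDerivAt h2
    have h3 : HasMFDerivAt 𝓘(ℝ, ℝ) 𝓘(ℝ, ℝ) (fun σ => lift Sg x (flow Y x σ)) s
        ((dscalar (lift Sg x) x).comp ((1 : ℝ →L[ℝ] ℝ).smulRight (vec Y x))) := by
      have h4 : HasMFDerivAt (𝓡 3) 𝓘(ℝ, ℝ) (lift Sg x) (flow Y x s) (dscalar (lift Sg x) x) := by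
        rw [hx]
        exact (hlift.mdifferentiableAt one_ne_zero).hasMFDerivAt
      have h5 := hd.hasMFDerivAt hY
      rw [hx] at h5
      exact HasMFDerivAt.comp (g := lift Sg x) s h4 h5
    have h6 : HasDerivAt (fun σ => lift Sg x (flow Y x σ)) (dscalar (lift Sg x) x (vec Y x)) s := by
      have h8 : HasMFDerivAt 𝓘(ℝ, ℝ) 𝓘(ℝ, ℝ) (fun σ => lift Sg x (flow Y x σ)) s
          ((1 : ℝ →L[ℝ] ℝ).smulRight (dscalar (lift Sg x) x (vec Y x))) := by
        refine h3.congr_mfderiv ?_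
        ext1
        change dscalar (lift Sg x) x ((1 : ℝ) • vec Y x) = (1 : ℝ) • dscalar (lift Sg x) x (vec Y x)
        rw [map_smul]
      exact (hasDerivAt_iff_hasFDerivAt).2 h8.hasFDerivAt
    have h7 : HasDerivAt (fun σ : ℝ => f (a, σ)) (dscalar (lift Sg x) x (vec Y x)) s := by
      have := h6.sub_const (lift Sg x x)
      simpa only [hf, hg, ha, extChartAt_to_inv] using this
    exact h1.unique h7
  have hinv : (fderiv ℝ f (a, s) ∘L .inr ℝ E3 ℝ).IsInvertible := by
    refine isInvertible_of_apply_one_ne_zero ?_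
    have h1 : (fderiv ℝ f (a, s) ∘L .inr ℝ E3 ℝ) 1 = fderiv ℝ f (a, s) (0, 1) := rfl
    rw [h1, hpart]
    exact fun h0 => htr ((dscalar_lift_eq_zero_iff (hSg.mdifferentiableAt (by simp)) _).1 h0)
  set ψ := hfc.implicitFunction one_ne_zero hinv with hψ
  have hψc : ContDiffAt ℝ 1 ψ a := hfc.contDiffAt_implicitFunction one_ne_zero hinv
  have hψa : ψ a = s := hfc.implicitFunction_apply_self one_ne_zero hinv
  have hψ1 : ∀ᶠ y in 𝓝 a, f (y, ψ y) = f (a, s) :=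
    hfc.eventually_apply_implicitFunction one_ne_zero hinv
  have hψ2 : ∀ᶠ v in 𝓝 (a, s), f v = f (a, s) ↔ ψ v.1 = v.2 :=
    hfc.eventually_apply_eq_iff_implicitFunction one_ne_zero hinv
  have hr : ContMDiffAt (𝓡 3) 𝓘(ℝ, ℝ) 1 (fun q => ψ (extChartAt (𝓡 3) x q)) x :=
    hψc.contMDiffAt.comp x contMDiffAt_extChartAt
  have hgf : ∀ {q : M} (σ : ℝ), q ∈ (extChartAt (𝓡 3) x).source →
      f (extChartAt (𝓡 3) x q, σ) = g (q, σ) := by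
    intro q σ hq
    simp only [hf, (extChartAt (𝓡 3) x).left_inv hq]
  refine ⟨fun q => ψ (extChartAt (𝓡 3) x q), hr, hψa, ?_, ?_⟩
  · have hc : ContinuousAt (flowMap Y fun q => ψ (extChartAt (𝓡 3) x q)) x := by
      refine (contMDiffAt_flowMap hY ?_ hr).continuousAt
      rw [← ha, hψa]; exact hd
    have hval : flowMap Y (fun q => ψ (extChartAt (𝓡 3) x q)) x = x := by
      rw [flowMap, ← ha, hψa, hx]
    have hpair : Tendsto (fun q => (Sg (flowMap Y (fun q => ψ (extChartAt (𝓡 3) x q)) q), Sg q))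
        (𝓝 x) (𝓝 (Sg x) ×ˢ 𝓝 (Sg x)) := by
      refine Tendsto.prodMk ?_ hSg.continuousAt
      have := hc.tendsto
      rw [hval] at this
      exact hSg.continuousAt.tendsto.comp this
    filter_upwards [eventually_extChartAt hψ1, hpair.eventually
      (eventually_circleCoord_injective (Sg x)), extChartAt_source_mem_nhds (I := 𝓡 3) x]
      with q h1 h2 h3
    rw [hf0, hgf _ h3] at h1
    exact h2 (sub_eq_zero.1 h1)
  · have ht : Tendsto (fun z : M × ℝ => (extChartAt (𝓡 3) x z.1, z.2)) (𝓝 (x, s)) (𝓝 (a, s)) := by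
      have h1 : ContinuousAt (fun z : M × ℝ => (extChartAt (𝓡 3) x z.1, z.2)) (x, s) :=
        ((continuousAt_extChartAt (I := 𝓡 3) x).comp continuousAt_fst).prodMk continuousAt_snd
      exact h1
    filter_upwards [ht.eventually hψ2, continuousAt_fst.eventually
      (extChartAt_source_mem_nhds (I := 𝓡 3) x)] with z h1 h2 h3
    refine h1.1 ?_
    rw [hf0, hgf _ h2]
    simp only [hg, lift, h3, sub_self]

/-! ### The first return map -/

theorem IsFirstReturn.unique (hY : IsC1Field Y) {S : Set M} {q z z' : M}
    (h : IsFirstReturn Y S q z) (h' : IsFirstReturn Y S q z') : z = z' := by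
  obtain ⟨c, T, hT, hc, h0, rfl, hz, hfirst⟩ := h
  obtain ⟨c', T', hT', hc', h0', rfl, hz', hfirst'⟩ := h'
  have e : ∀ σ ∈ Icc 0 T, flow Y q σ = c σ := fun σ hσ => by
    have := (flowRel_of_curve_Icc hY hT hc ⟨le_rfl, hT.le⟩ hσ).flow_eq hY
    rwa [h0, sub_zero] at this
  have e' : ∀ σ ∈ Icc 0 T', flow Y q σ = c' σ := fun σ hσ => by
    have := (flowRel_of_curve_Icc hY hT' hc' ⟨le_rfl, hT'.le⟩ hσ).flow_eq hY
    rwa [h0', sub_zero] at this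
  rcases lt_trichotomy T T' with hlt | heq | hlt
  · refine absurd ?_ (hfirst' T ⟨hT, hlt⟩)
    rwa [← e' T ⟨hT.le, hlt.le⟩, e T ⟨hT.le, le_rfl⟩]
  · rw [← e T ⟨hT.le, le_rfl⟩, ← e' T' ⟨hT'.le, le_rfl⟩, heq]
  · refine absurd ?_ (hfirst T' ⟨hT', hlt⟩)
    rwa [← e T' ⟨hT'.le, hlt.le⟩, e' T' ⟨hT'.le, le_rfl⟩]

theorem firstReturn_eq (hY : IsC1Field Y) {S : Set M} {q z : M} (h : IsFirstReturn Y S q z) :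
    firstReturn Y S q = z := by
  have hex : ∃ z, IsFirstReturn Y S q z := ⟨z, h⟩
  rw [firstReturn, dif_pos hex]
  exact hex.choose_spec.unique hY h

theorem exists_int_of_periodic_eq {c : ℝ → M} {T : ℝ} (hT : 0 < T) (hc : Function.Periodic c T)
    (hinj : InjOn c (Ico 0 T)) {a b : ℝ} (h : c a = c b) : ∃ n : ℤ, b - a = n * T := by
  have ea := toIcoMod_add_toIcoDiv_zsmul hT 0 a
  have eb := toIcoMod_add_toIcoDiv_zsmul hT 0 b
  have h1 : c (toIcoMod hT 0 a) = c a := by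
    conv_rhs => rw [← ea]
    exact ((hc.zsmul _) _).symm
  have h2 : c (toIcoMod hT 0 b) = c b := by
    conv_rhs => rw [← eb]
    exact ((hc.zsmul _) _).symm
  have h3 := hinj (toIcoMod_mem_Ico' hT a) (toIcoMod_mem_Ico' hT b) (by rw [h1, h2, h])
  refine ⟨toIcoDiv hT 0 b - toIcoDiv hT 0 a, ?_⟩
  rw [zsmul_eq_mul] at ea eb
  push_cast
  linarith

/-! ### The first return near the annulus and its differential up to the boundary circles. -/

namespace IsAnnulus

variable (h : IsAnnulus U X Y Sg e₁ e₂ μ φ)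

include h

/-- At the points of the annulus there is a positive time of return, before which the orbit does not
meet the initial fiber. -/
theorem exists_period {t : ℝ} (ht : t ∈ Icc (-μ) μ) {x : M} (hx : x ∈ gam U X Y t) :
    ∃ T > 0, flow Y x T = x ∧ ∀ σ ∈ Ioo 0 (2 * T), Sg (flow Y x σ) = Sg x → σ = T := by
  obtain ⟨T, c, hc, hT, hper, hinj, hran⟩ := h.orbit t ht
  have hx' := hx
  rw [← hran] at hx'
  obtain ⟨s, rfl⟩ := hx'
  have hflow : ∀ σ, flow Y (c s) σ = c (s + σ) := by
    intro σ
    have hs : FlowRel Y (c s) (s + σ - s) (c (s + σ)) :=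
      flowRel_of_curve (hc.isMIntegralCurveOn (Ioo (min s (s + σ) - 1) (max s (s + σ) + 1)))
        ⟨by linarith [min_le_left s (s + σ)], by linarith [le_max_left s (s + σ)]⟩
        ⟨by linarith [min_le_right s (s + σ)], by linarith [le_max_right s (s + σ)]⟩
    rw [add_sub_cancel_left] at hs
    exact hs.flow_eq h.c1_Y
  refine ⟨T, hT, by rw [hflow, hper], fun σ hσ hS => ?_⟩
  -- `γ_t` meets the fibre only once, so a return to the fibre is a return to the point itself, and
  -- its time is an integer multiple of the period.
  have h1 : flow Y (c s) σ = c s :=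
    (h.unique t ht (Sg (c s))).unique ⟨(h.flow_mem ht hx σ).2, hS⟩ ⟨hx, rfl⟩
  rw [hflow] at h1
  obtain ⟨n, hn⟩ := exists_int_of_periodic_eq hT hper hinj h1.symm
  rw [add_sub_cancel_left] at hn
  have h2 : 0 < (n : ℝ) := by
    by_contra hneg
    nlinarith [hσ.1, not_lt.1 hneg]
  have h3 : (n : ℝ) < 2 := by
    by_contra hneg
    nlinarith [hσ.2, not_lt.1 hneg]
  have h2' : 0 < n := by exact_mod_cast h2
  have h3' : n < 2 := by exact_mod_cast h3
  have h4 : n = 1 := by omega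
  rw [hn, h4, Int.cast_one, one_mul]

/-- Near a point of the annulus, the first return map is the flow at a smooth time. -/
theorem exists_firstReturn {t : ℝ} (ht : t ∈ Icc (-μ) μ) {x : M} (hx : x ∈ gam U X Y t) :
    ∃ r : M → ℝ, ContMDiffAt (𝓡 3) 𝓘(ℝ, ℝ) 1 r x ∧ flowMap Y r x = x ∧
      (∀ᶠ q in 𝓝 x, Sg (flowMap Y r q) = Sg q) ∧
      ∀ᶠ q in 𝓝 x, IsFirstReturn Y (Sg ⁻¹' {Sg q}) q (flowMap Y r q) := by
  obtain ⟨T, hT, hTx, hTu⟩ := h.exists_period ht hx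
  have hSgx := h.contMDiffAt_Sg hx.1
  have hd := fun σ => (h.flow_mem ht hx σ).1
  obtain ⟨r, hr, hrT, hrS, hru⟩ := exists_return_time h.c1_Y hSgx (h.transverse x hx.1) (hd T) hTx
  -- Uniqueness of the return time near time `0`, where `0` itself is a solution: nearby orbits do
  -- not meet their own fibre again at small nonzero times.
  obtain ⟨r₀, -, -, -, hru₀⟩ := exists_return_time h.c1_Y hSgx (h.transverse x hx.1) (hd 0)
    (flow_zero h.c1_Y x)
  have hzero : ∀ᶠ z in 𝓝 (x, (0 : ℝ)), Sg (flow Y z.1 z.2) = Sg z.1 → z.2 = 0 := by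
    have hproj : Tendsto (fun z : M × ℝ => (z.1, (0 : ℝ))) (𝓝 (x, (0 : ℝ))) (𝓝 (x, 0)) :=
      (continuous_fst.prodMk continuous_const).tendsto' _ _ rfl
    filter_upwards [hru₀, hproj.eventually hru₀] with z h1 h2 h3
    rw [← h1 h3]
    exact h2 (by rw [flow_zero h.c1_Y])
  -- Compactness of `[0, 3T/2]` excludes other returns: near the times `0` and `T` by local
  -- uniqueness, at the others because the orbit of `x` is off the fibre. The end `3T/2` lies above
  -- the return times of nearby points and below the second return of `x`.
  have hcomp : ∀ᶠ q in 𝓝 x, ∀ σ ∈ Icc (0 : ℝ) (3 / 2 * T), σ ∈ Icc (0 : ℝ) (3 / 2 * T) →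
      Sg (flow Y q σ) = Sg q → σ = 0 ∨ r q = σ := by
    refine isCompact_Icc.eventually_forall_of_forall_eventually
      (P := fun q σ => σ ∈ Icc (0 : ℝ) (3 / 2 * T) → Sg (flow Y q σ) = Sg q → σ = 0 ∨ r q = σ) ?_
    intro σ hσ
    rcases eq_or_ne σ 0 with rfl | h0
    · filter_upwards [hzero] with z hz _ hS using Or.inl (hz hS)
    rcases eq_or_ne σ T with rfl | h1
    · filter_upwards [hru] with z hz _ hS using Or.inr (hz hS)
    have hne : Sg (flow Y x σ) ≠ Sg x := by
      intro hS
      exact h1 (hTu σ ⟨lt_of_le_of_ne hσ.1 h0.symm, by linarith [hσ.2]⟩ hS)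
    have c1 : ContinuousAt (fun z : M × ℝ => Sg (flow Y z.1 z.2)) (x, σ) :=
      ContinuousAt.comp (g := Sg) (f := fun z : M × ℝ => flow Y z.1 z.2)
        (h.contMDiffAt_Sg (h.flow_mem ht hx σ).2.1).continuousAt
        ((hd σ).regular h.c1_Y).1.continuousAt
    have c2 : ContinuousAt (fun z : M × ℝ => Sg z.1) (x, σ) :=
      ContinuousAt.comp (g := Sg) (f := fun z : M × ℝ => z.1) hSgx.continuousAt continuousAt_fst
    filter_upwards [(c1.prodMk c2).eventually (isClosed_diagonal.isOpen_compl.mem_nhds hne)]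
      with z hz _ hS
    exact absurd hS hz
  have hrlt : ∀ᶠ q in 𝓝 x, r q ∈ Ioo 0 (3 / 2 * T) :=
    hr.continuousAt.eventually (Ioo_mem_nhds (by rw [hrT]; exact hT) (by rw [hrT]; linarith))
  have hrx : flowMap Y r x = x := by rw [flowMap, hrT, hTx]
  refine ⟨r, hr, hrx, hrS, ?_⟩
  filter_upwards [hcomp, hrlt, hrS, eventually_flowDef_flowMap h.c1_Y (hd _) hr.continuousAt]
    with q h1 h2 h3 h4
  obtain ⟨a, b, h0, hrq, hcurve, -⟩ := h4.exists_curve h.c1_Y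
  refine ⟨flow Y q, r q, h2.1, hcurve.mono fun σ hσ => ⟨h0.1.trans_le hσ.1, hσ.2.trans_lt hrq.2⟩,
    flow_zero h.c1_Y q, rfl, h3, fun σ hσ hS => ?_⟩
  have hσ' : σ ∈ Icc 0 (3 / 2 * T) := ⟨hσ.1.le, (hσ.2.trans h2.2).le⟩
  rcases h1 σ hσ' hσ' hS with h5 | h5
  · exact hσ.1.ne' h5
  · exact hσ.2.ne' h5

/-- The differential of a return map is the identity at the points of the open annulus. -/
theorem mfderiv_return {z₀ : ℝ × ℝ} (hz₀ : z₀.2 ∈ Ioo (-μ) μ) {p : M} (hp : φ z₀ = p) {r : M → ℝ}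
    (hr : ContMDiffAt (𝓡 3) 𝓘(ℝ, ℝ) 1 r p) (hrp : flowMap Y r p = p)
    (hS : ∀ᶠ q in 𝓝 p, Sg (flowMap Y r q) = Sg q) (v : E3) :
    mfderiv (𝓡 3) (𝓡 3) (flowMap Y r) p v = v := by
  have hsrc : p ∈ (extChartAt (𝓡 3) p).source := mem_extChartAt_source p
  have h1 := fderiv_mapInChart hsrc (h.flowMap_self_mem_source hz₀ hp hr hrp hS)
    ((contMDiffAt_flowMap h.c1_Y (h.flowDef hz₀ hp _) hr).mdifferentiableAt one_ne_zero) v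
  rw [h.fderiv_return_eq_id hz₀ hp hr hrp hS, hrp] at h1
  exact (dchart_injective hsrc h1).symm

/-- The differential of a return map is the identity at the points of the annulus. -/
theorem mfderiv_return_of_Icc {z₀ : ℝ × ℝ} (hz₀ : z₀.2 ∈ Icc (-μ) μ) {x : M} (hx : φ z₀ = x)
    {r : M → ℝ} (hr : ContMDiffAt (𝓡 3) 𝓘(ℝ, ℝ) 1 r x) (hrx : flowMap Y r x = x)
    (hS : ∀ᶠ q in 𝓝 x, Sg (flowMap Y r q) = Sg q) (v : E3) :
    mfderiv (𝓡 3) (𝓡 3) (flowMap Y r) x v = v := by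
  have hg : x ∈ gam U X Y z₀.2 := hx ▸ h.phi_mem_gam hz₀
  have hsrc : x ∈ (extChartAt (𝓡 3) x).source := mem_extChartAt_source x
  have hsrc' : flowMap Y r x ∈ (extChartAt (𝓡 3) x).source := by rwa [hrx]
  have hd : FlowDef Y x (r x) := (h.flow_mem hz₀ hg _).1
  have hsm := contMDiffAt_flowMap h.c1_Y hd hr
  have hR := contDiffAt_mapInChart hsrc hsrc' hsm
  have hcont := hR.continuousAt_fderiv one_ne_zero
  -- The same `r` is a return time at nearby points of the open annulus, where the differential is
  -- already known to be the identity.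
  have hev : ∀ᶠ q in 𝓝 x, (∃ z : ℝ × ℝ, z.2 ∈ Ioo (-μ) μ ∧ φ z = q) →
      fderiv ℝ (mapInChart (flowMap Y r) x x) (extChartAt (𝓡 3) x q) =
        ContinuousLinearMap.id ℝ E3 := by
    filter_upwards [(contMDiffAt_iff_contMDiffAt_nhds (by simp)).1 hr, hS.eventually_nhds,
      (isOpen_extChartAt_source (I := 𝓡 3) x).mem_nhds hsrc] with q h1 h2 h3
    rintro ⟨z, hz, hzq⟩
    have hq : flowMap Y r q = q :=
      h.flowMap_eq_self (hzq ▸ h.phi_mem_col ⟨hz.1.le, hz.2.le⟩) h2.self_of_nhds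
    have h4 : flowMap Y r q ∈ (extChartAt (𝓡 3) x).source := by rwa [hq]
    have h5 := contMDiffAt_flowMap h.c1_Y (h.flowDef hz hzq _) h1
    ext1 w
    obtain ⟨v, rfl⟩ := dchart_surjective h3 w
    have h6 := fderiv_mapInChart h3 h4 (h5.mdifferentiableAt one_ne_zero) v
    have h7 := h.mfderiv_return hz hzq h1 hq h2 v
    rw [hq] at h6
    exact h6.trans (congrArg (dchart x q) h7)
  have hne : (𝓝[Ioo (-μ) μ] z₀.2).NeBot := by
    rw [← mem_closure_iff_nhdsWithin_neBot, closure_Ioo (by linarith [h.pos])]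
    exact hz₀
  have hpath : Tendsto (fun s => φ (z₀.1, s)) (𝓝[Ioo (-μ) μ] z₀.2) (𝓝 x) := by
    have h1 : ContinuousWithinAt φ (univ ×ˢ Icc (-μ) μ) z₀ :=
      h.param.contMDiffOn.continuousOn z₀ ⟨mem_univ _, hz₀⟩
    have h2 : Tendsto (fun s : ℝ => (z₀.1, s)) (𝓝[Ioo (-μ) μ] z₀.2)
        (𝓝[univ ×ˢ Icc (-μ) μ] z₀) := by
      refine tendsto_nhdsWithin_iff.2 ⟨?_, ?_⟩
      · exact ((continuous_const.prodMk continuous_id).tendsto' _ _ rfl).mono_left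
          nhdsWithin_le_nhds
      · filter_upwards [self_mem_nhdsWithin] with s hs
        exact ⟨mem_univ _, hs.1.le, hs.2.le⟩
    have := h1.tendsto.comp h2
    rwa [hx] at this
  have hlim := (hcont.tendsto.comp (continuousAt_extChartAt (I := 𝓡 3) x).tendsto).comp hpath
  have hconst : ∀ᶠ s in 𝓝[Ioo (-μ) μ] z₀.2, ContinuousLinearMap.id ℝ E3 =
      ((fderiv ℝ (mapInChart (flowMap Y r) x x) ∘ extChartAt (𝓡 3) x) ∘ fun s => φ (z₀.1, s)) s := by
    filter_upwards [hpath.eventually hev, self_mem_nhdsWithin] with s h1 h2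
    exact (h1 ⟨(z₀.1, s), h2, rfl⟩).symm
  -- The point `x` is a limit of points of the open annulus along the segment of constant angle, and
  -- the differential of the return map is continuous at `x`.
  have hid := tendsto_nhds_unique (Tendsto.congr' hconst tendsto_const_nhds) hlim
  have h6 := fderiv_mapInChart hsrc hsrc' (hsm.mdifferentiableAt one_ne_zero) v
  rw [← hid, hrx] at h6
  exact (dchart_injective hsrc h6).symm

end IsAnnulus

theorem IsPreparedCounterexample.exists_isAnnulus {e₃ : ∀ x : M, TangentSpace (𝓡 3) x}
    (h : IsPreparedCounterexample U X Y Sg e₁ e₂ e₃) : ∃ μ φ, IsAnnulus U X Y Sg e₁ e₂ μ φ := by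
  obtain ⟨μ, φ, τ, hμ, hφ, himg, horb, -, hdisj, huniq, -, htan⟩ := h.annulus
  have hc := h.counterexample
  refine ⟨μ, φ, hc.isCompact, hc.c1_X, hc.c1_Y, hc.commute.flowsCommute hc.c1_X hc.c1_Y,
    hc.index_ne_zero, h.smooth, h.transverse, h.continuous_e₁, h.continuous_e₂, fun x hx => ?_,
    h.e₁_fiber, h.e₂_fiber, hμ, hφ, himg, fun t ht => ⟨_, horb t ht⟩, hdisj, huniq, htan⟩
  have h1 := (h.basis x hx).1
  rw [h.e₃_eq x hx] at h1
  exact h1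

theorem IsPreparedCounterexample.firstReturn_spec {e₃ : ∀ x : M, TangentSpace (𝓡 3) x}
    (h : IsPreparedCounterexample U X Y Sg e₁ e₂ e₃) {x : M} (hx : x ∈ Col X Y U) (hSx : Sg x = 1) :
    (∀ᶠ y in 𝓝[Sg ⁻¹' {1}] x, ∃ z, IsFirstReturn Y (Sg ⁻¹' {1}) y z) ∧
      firstReturn Y (Sg ⁻¹' {1}) x = x ∧
      HasMFDerivWithinAt (𝓡 3) (𝓡 3) (firstReturn Y (Sg ⁻¹' {1})) (Sg ⁻¹' {1}) x
        (ContinuousLinearMap.id ℝ (TangentSpace (𝓡 3) x)) := by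
  obtain ⟨μ, φ, ha⟩ := h.exists_isAnnulus
  obtain ⟨z₀, hz₀, hzx⟩ := ha.exists_phi_eq hx
  have hg : x ∈ gam U X Y z₀.2 := hzx ▸ ha.phi_mem_gam hz₀
  obtain ⟨r, hr, hrx, hrS, hrF⟩ := ha.exists_firstReturn hz₀ hg
  -- On `{Sg = 1}` the return of a point to its own fibre is its return to this surface, so there
  -- `firstReturn` is the restriction of a map that is C¹ near `x` in `M`.
  have hF : ∀ᶠ y in 𝓝[Sg ⁻¹' {1}] x, IsFirstReturn Y (Sg ⁻¹' {1}) y (flowMap Y r y) := by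
    filter_upwards [hrF.filter_mono nhdsWithin_le_nhds, self_mem_nhdsWithin] with y h1 h2
    have h2' : Sg y = 1 := h2
    rwa [h2'] at h1
  have hFx : firstReturn Y (Sg ⁻¹' {1}) x = flowMap Y r x :=
    firstReturn_eq ha.c1_Y (hF.self_of_nhdsWithin hSx)
  refine ⟨hF.mono fun y hy => ⟨_, hy⟩, hFx.trans hrx, ?_⟩
  have hsm := contMDiffAt_flowMap ha.c1_Y (ha.flow_mem hz₀ hg (r x)).1 hr
  have h1 := (hsm.mdifferentiableAt one_ne_zero).hasMFDerivAt.hasMFDerivWithinAt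
    (s := Sg ⁻¹' {1})
  have h2 := h1.congr_of_eventuallyEq (hF.mono fun y hy => firstReturn_eq ha.c1_Y hy) hFx
  have h3 : (mfderiv (𝓡 3) (𝓡 3) (flowMap Y r) x : E3 →L[ℝ] E3) = ContinuousLinearMap.id ℝ E3 := by
    ext1 v
    exact ha.mfderiv_return_of_Icc hz₀ hzx hr hrx hrS v
  exact ⟨h2.1, HasFDerivWithinAt.congr_fderiv h2.2 h3⟩

end

end CommutingFields

end

open CommutingFields in
theorem mainTheorem3 {M : Type*} [TopologicalSpace M] [T2Space M] [SecondCountableTopology M]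
    [ChartedSpace E3 M] [IsManifold (𝓡 3) ∞ M]
    (U : Set M) (X Y : ∀ x : M, TangentSpace (𝓡 3) x) (Sg : M → Circle)
    (e₁ e₂ e₃ : ∀ x : M, TangentSpace (𝓡 3) x)
    (h : IsPreparedCounterexample U X Y Sg e₁ e₂ e₃) :
    ∀ x ∈ Col X Y U, Sg x = 1 →
      (∀ᶠ y in 𝓝[Sg ⁻¹' {1}] x, ∃ z, IsFirstReturn Y (Sg ⁻¹' {1}) y z) ∧
      firstReturn Y (Sg ⁻¹' {1}) x = x ∧
      HasMFDerivWithinAt (𝓡 3) (𝓡 3) (firstReturn Y (Sg ⁻¹' {1})) (Sg ⁻¹' {1}) x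
        (ContinuousLinearMap.id ℝ (TangentSpace (𝓡 3) x)) := by
  exact fun x hx hSx => h.firstReturn_spec hx hSx
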